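/- Let $\tau>1$. A $\tau$-HST is a finite rooted tree with positive edge lengths such that along every path leading away from the root, each edge is at least $\tau$ times as long as the next one. A metric space $(X,d)$ is induced by an HST if $X$ is identified with a set of vertices of it (for instance its set of leaves) in such a way that $d(x,y)$ is the total length of the tree path between $x$ and $y$. The hop-diameter $D$ of the tree is the maximum number of edges on a simple path in it. In the $k$-server problem on a finite metric space $(X,d)$, an online algorithm starts from a given set $A_0\subseteq X$ of $k$ points, and upon each request $r_t\in X$, $t=1,2,\dots$, without knowledge of future requests, it has to choose a set $A_t\subseteq X$ of $k$ points with $r_t\in A_t$. Its cost on $r_1,\dots,r_T$ is $\sum_{t=1}^T d(A_{t-1},A_t)$, where $d(A,A')$ is the earthmover distance, i.e. the minimum of $\sum_{x\in A}d(x,f(x))$ over all bijections $f:A\to A'$. Let $\mathrm{OPT}_{A_0}(r_1,\dots,r_T)$ be the minimum cost of an offline solution that starts from $A_0$. **Theorem.** For every $\tau>1$ there is a constant $C>0$ such that for every $n$-point metric space $(X,d)$ that is induced by a $\tau$-HST of hop-diameter $D$, and every $k\ge 1$, the following holds. There is a number $b$ (independent of the request sequence and of the initial set) such that for every initial set $A_0$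 of $k$ points there is a randomized online algorithm for the $k$-server problem that satisfies, for every $T\geq 0$ and every request sequence $r_1,\dots,r_T$ fixed in advance, $$\mathbb{E}\bigl[\mathrm{cost}(r_1,\dots,r_T)\bigr]\le C\cdot\min\{D,\log n\}\cdot\log(k+1)\cdot \mathrm{OPT}_{A_0}(r_1,\dots,r_T)+b .$$ That is, there is a randomized $O(\min\{D,\log n\}\cdot\log k)$-competitive algorithm for the $k$-server problem on HST metrics. -/

import Mathlib

/-! ### Trees with edge lengths and HSTs -/

section Trees

variable {V : Type*}

/-- `v` is a child of `u` in the tree `G` rooted at `root`. -/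
def IsChild (G : SimpleGraph V) (root u v : V) : Prop :=
  G.Adj u v ∧ G.dist root v = G.dist root u + 1

/-- `G`, rooted at `root` and with edge lengths `len`, is a `τ`-HST: a tree with positive edge
lengths in which consecutive edge lengths decrease by a factor of at least `τ` when walking away
from the root. -/
structure IsHST (τ : ℝ) (G : SimpleGraph V) (root : V) (len : Sym2 V → ℝ) : Prop where
  isTree : G.IsTree
  len_pos : ∀ e ∈ G.edgeSet, 0 < len e
  len_decreasing : ∀ u v w, IsChild G root u v → IsChild G root v w →
    τ * len s(v, w) ≤ len s(u, v)

/-- The distance in a tree with edge lengths `len`: the total length of the path from `u` to `v`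
(in a tree there is exactly one such path, so the infimum is over a one-element type). -/
noncomputable def treeDist (G : SimpleGraph V) (len : Sym2 V → ℝ) (u v : V) : ℝ :=
  ⨅ p : G.Path u v, (p.1.edges.map len).sum

/-- The hop-diameter: the maximum number of edges on a simple path. -/
noncomputable def hopDiameter (G : SimpleGraph V) : ℕ :=
  sSup {m | ∃ (u v : V) (p : G.Walk u v), p.IsPath ∧ p.length = m}

end Trees

/-! ### The `k`-server problem -/

section Server

/-- A configuration: a set of `k` points, the locations of the `k` servers. -/
abbrev Config (X : Type*) (k : ℕ) : Type _ := {S : Finset X // S.card = k}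

variable {X : Type*} {k : ℕ}

/-- The earthmover distance between two configurations: the least total distance that the servers
travel, over all bijections from the old locations to the new ones. -/
noncomputable def moveCost [MetricSpace X] (S S' : Config X k) : ℝ :=
  ⨅ f : {x // x ∈ S.1} ≃ {x // x ∈ S'.1}, ∑ x : {x // x ∈ S.1}, dist (x : X) (f x : X)

/-- The total movement cost of a sequence of configurations `A 0, A 1, …, A T`. -/
noncomputable def pathCost [MetricSpace X] {T : ℕ} (A : Fin (T + 1) → Config X k) : ℝ :=
  ∑ t : Fin T, moveCost (A t.castSucc) (A t.succ)

/-- `A 0, …, A T` starts in `A₀` and serves the requests `r 0, …, r (T - 1)`: the configuration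
`A (t + 1)` answers the request `r t`. -/
def IsFeasible (A₀ : Config X k) (r : ℕ → X) {T : ℕ} (A : Fin (T + 1) → Config X k) : Prop :=
  A 0 = A₀ ∧ ∀ t : Fin T, r t ∈ (A t.succ).1

/-- The optimal offline cost of serving the first `T` requests of `r`, starting in `A₀`. -/
noncomputable def offlineOpt [MetricSpace X] (A₀ : Config X k) (r : ℕ → X) (T : ℕ) : ℝ :=
  sInf {c | ∃ A : Fin (T + 1) → Config X k, IsFeasible A₀ r A ∧ pathCost A = c}

/-- A randomized online algorithm for the `k`-server problem. From the requests `ρ 0, …, ρ t` seen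
so far and its own configurations `A 0, …, A t` so far, it chooses at random the next
configuration, which must have a server at the latest request `ρ t`. -/
structure RandomizedServerAlgorithm (X : Type*) (k : ℕ) where
  next : (t : ℕ) → (ρ : Fin (t + 1) → X) → (A : Fin (t + 1) → Config X k) → PMF (Config X k)
  serves : ∀ t ρ A, ∀ S ∈ (next t ρ A).support, ρ (Fin.last t) ∈ S.1

namespace RandomizedServerAlgorithm

/-- The joint law of the configurations `A 0, …, A t` of the algorithm when it starts in `A₀` and
the request sequence, fixed in advance, is `r`. -/
noncomputable def law (alg : RandomizedServerAlgorithm X k) (A₀ : Config X k) (r : ℕ → X) :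
    (t : ℕ) → PMF (Fin (t + 1) → Config X k)
  | 0 => PMF.pure fun _ => A₀
  | t + 1 => (law alg A₀ r t).bind fun A =>
      (alg.next t (fun i => r i) A).map fun S => Fin.snoc (α := fun _ => Config X k) A S

/-- The expected cost of the algorithm on the first `T` requests of `r`, starting in `A₀`. -/
noncomputable def expectedCost [Fintype X] [MetricSpace X] (alg : RandomizedServerAlgorithm X k)
    (A₀ : Config X k) (r : ℕ → X) (T : ℕ) : ℝ :=
  ∑ A : Fin (T + 1) → Config X k, (alg.law A₀ r T A).toReal * pathCost A

/-- Started in `A₀`, the algorithm is `c`-competitive with additive term `b`, against every request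
sequence that is fixed in advance. -/
def IsCompetitive [Fintype X] [MetricSpace X] (alg : RandomizedServerAlgorithm X k)
    (A₀ : Config X k) (c b : ℝ) : Prop :=
  ∀ (r : ℕ → X) (T : ℕ), alg.expectedCost A₀ r T ≤ c * offlineOpt A₀ r T + b

end RandomizedServerAlgorithm

end Server

/-! The algorithm maintains a fractional state, rounds it online to random server positions, and
lets the real servers follow lazily.

Fractional part. The number of servers below each tree vertex is encoded in `serverPolytope`. A
request at a leaf is served by repeated proximal steps: minimize the shifted relative entropy to the
current state, weighted by edge lengths, plus a small linear cost at the leaf. The Bregman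
three-point identity makes the divergence to every state that serves the request drop by at least
the proximal cost. Testing optimality in a direction built from the depths (`exists_prox_step`)
bounds the movement by the depth bound `H` times this drop, up to a linear potential that telescopes
(`exists_fractional_serve`). When the offline solution moves, the divergence grows by at most `O(log
k)` times its cost, because the shift is `δ = 1/(4k)` (`entropyDiv_integralState_le`). This gives
the ratio `O(H log k)`.

Rounding. Contracting the edges shorter than `σ * 2 ^ j` gives nested clusters whose metric is
equivalent to the HST metric (`exists_hierarchy_of_hst`). A random integral placement is kept
balanced: in every cluster its count is the floor or the ceiling of the fractional mass, with the
correct mean at every point. When the masses change, the placement is repaired from the top level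
downwards. The error at level `j` exceeds that at level `j + 1` by at most twice the change of
masses at level `j`, and since scales double this sums to a constant factor
(`Hierarchy.exists_rounding_kernel`). Real servers occupy distinct points and move only to serve a
request; the lag behind the virtual servers is a further potential (`exists_lazy_update`).

Depth. The depth is at most the hop-diameter, which gives the bound with `D`. For `log n`, only
those clusters are kept that hold at most half of the points of their parent cluster. At most `log₂
n` of these contain a given point, and among two clusters that separate two points inside a common
parent at least one is kept, so the resulting shallow 2-HST has an equivalent metric
(`exists_log_competitive_of_hst`). -/

open Filter Topology

/-! ### Weighted rooted trees given by a parent function -/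

/-- A rooted tree on `V` given by its parent function, with depths and positive edge weights
(`wt v` is the weight of the edge from `v` to its parent). -/
structure ParentTree (V : Type*) where
  root : V
  par : V → V
  dep : V → ℕ
  wt : V → ℝ
  par_root : par root = root
  dep_root : dep root = 0
  dep_par : ∀ v, v ≠ root → dep v = dep (par v) + 1
  wt_pos : ∀ v, 0 < wt v

/-! ### The shifted relative entropy -/

/-- The shifted relative entropy of two numbers. -/
noncomputable def klTerm (δ a b : ℝ) : ℝ := (a + δ) * Real.log ((a + δ) / (b + δ)) - a + b

lemma klTerm_nonneg {δ a b : ℝ} (hδ : 0 < δ) (ha : 0 ≤ a) (hb : 0 ≤ b) : 0 ≤ klTerm δ a b := by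
  have h := Real.one_sub_inv_le_log_of_pos (x := (a + δ) / (b + δ)) (by positivity)
  have h2 := mul_le_mul_of_nonneg_left h (show 0 ≤ a + δ by positivity)
  have h3 : (a + δ) * (1 - ((a + δ) / (b + δ))⁻¹) = a - b := by
    have : a + δ ≠ 0 := by positivity
    field_simp
    ring
  unfold klTerm
  linarith

lemma sub_le_mul_log {δ a b : ℝ} (hδ : 0 < δ) (ha : 0 ≤ a) (hb : 0 ≤ b) :
    a - b ≤ (a + δ) * Real.log ((a + δ) / (b + δ)) := by
  have := klTerm_nonneg hδ ha hb
  unfold klTerm at this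
  linarith

lemma klTerm_self {δ a : ℝ} (hδ : 0 < δ) (ha : 0 ≤ a) : klTerm δ a a = 0 := by
  have : a + δ ≠ 0 := by positivity
  simp [klTerm, div_self this]

/-- This is the Bregman three-point identity: `klTerm δ` is the divergence generated by `a ↦ (a + δ)
* log (a + δ)`. It converts first-order optimality of a proximal step into a drop of the divergence.
-/
lemma klTerm_sub_klTerm {δ a b c : ℝ} (hδ : 0 < δ) (ha : 0 ≤ a) (hb : 0 ≤ b) (hc : 0 ≤ c) :
    klTerm δ a b - klTerm δ a c - klTerm δ c b = Real.log ((c + δ) / (b + δ)) * (a - c) := by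
  have h1 : a + δ ≠ 0 := by positivity
  have h2 : b + δ ≠ 0 := by positivity
  have h3 : c + δ ≠ 0 := by positivity
  unfold klTerm
  rw [Real.log_div h1 h2, Real.log_div h1 h3, Real.log_div h3 h2]
  ring

/-- The shift keeps the divergence finite at `b = 0`. This bound is the source of the factor `log
k`, as `δ` will be `1/(4k)`. -/
lemma klTerm_le {δ a b : ℝ} (hδ : 0 < δ) (ha : 0 ≤ a) (ha1 : a ≤ 1) (hb : 0 ≤ b) (hb1 : b ≤ 1) :
    klTerm δ a b ≤ (1 + δ) * Real.log ((1 + δ) / δ) + 1 := by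
  have hl : Real.log ((a + δ) / (b + δ)) ≤ Real.log ((1 + δ) / δ) := by
    apply Real.log_le_log (by positivity)
    gcongr
    linarith
  have h0 : 0 ≤ Real.log ((1 + δ) / δ) := by
    apply Real.log_nonneg
    rw [le_div_iff₀ hδ]; linarith
  have h1 : (a + δ) * Real.log ((a + δ) / (b + δ)) ≤ (1 + δ) * Real.log ((1 + δ) / δ) :=
    (mul_le_mul_of_nonneg_left hl (by positivity)).trans
      (mul_le_mul_of_nonneg_right (by linarith) h0)
  unfold klTerm
  linarith

lemma hasDerivAt_klTerm {δ b c d : ℝ} (hδ : 0 < δ) (hc : 0 ≤ c) (hb : 0 ≤ b) :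
    HasDerivAt (fun t : ℝ => klTerm δ (c + t * d) b) (Real.log ((c + δ) / (b + δ)) * d) 0 := by
  have h1 : c + δ ≠ 0 := by positivity
  have h2 : b + δ ≠ 0 := by positivity
  have h0 : HasDerivAt (fun t : ℝ => c + t * d) d 0 := by
    simpa using ((hasDerivAt_id (0 : ℝ)).mul_const d).const_add c
  have h3 : HasDerivAt (fun t : ℝ => c + t * d + δ) d 0 := h0.add_const δ
  have h4 : HasDerivAt (fun t : ℝ => (c + t * d + δ) / (b + δ)) (d / (b + δ)) 0 := h3.div_const _
  have h5 := h4.log (by simp only [zero_mul, add_zero]; positivity)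
  have h6 := ((h3.mul h5).sub h0).add_const b
  have e : (fun t : ℝ => klTerm δ (c + t * d) b) = fun t : ℝ =>
    ((((fun t : ℝ => c + t * d + δ) * fun t : ℝ => Real.log ((c + t * d + δ) / (b + δ))) -
      fun t : ℝ => c + t * d) t + b) := by
    funext t; simp [klTerm]
  rw [e]
  convert! h6 using 1
  simp only [zero_mul, add_zero]
  field_simp
  ring

lemma continuousOn_klTerm {δ b : ℝ} (hδ : 0 < δ) (hb : 0 ≤ b) :
    ContinuousOn (fun a : ℝ => klTerm δ a b) (Set.Ici 0) := by
  have h2 : b + δ ≠ 0 := by positivity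
  unfold klTerm
  refine ContinuousOn.add (ContinuousOn.sub (ContinuousOn.mul (by fun_prop) ?_) (by fun_prop))
    (by fun_prop)
  refine ContinuousOn.log (by fun_prop) ?_
  intro x hx
  have : (0 : ℝ) ≤ x := hx
  positivity

lemma eventually_nonneg_add_mul {a d : ℝ} (ha : 0 ≤ a) (h : a = 0 → 0 ≤ d) :
    ∀ᶠ t in 𝓝[>] (0 : ℝ), 0 ≤ a + t * d := by
  rcases ha.eq_or_lt with h0 | h0
  · filter_upwards [self_mem_nhdsWithin] with t ht
    have := h h0.symm
    have ht' : (0 : ℝ) < t := ht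
    rw [← h0]; positivity
  · have : Tendsto (fun t : ℝ => a + t * d) (𝓝[>] 0) (𝓝 (a + 0 * d)) :=
      (Continuous.tendsto (by fun_prop) 0).mono_left nhdsWithin_le_nhds
    filter_upwards [this.eventually_const_lt (show 0 < a + 0 * d by simpa using h0)] with t ht
    exact ht.le

lemma deriv_nonneg_of_eventually_le {f : ℝ → ℝ} {f' : ℝ} (hf : HasDerivAt f f' 0)
    (h : ∀ᶠ t in 𝓝[>] (0 : ℝ), f 0 ≤ f t) : 0 ≤ f' := by
  have h1 : Tendsto (slope f 0) (𝓝[>] 0) (𝓝 f') :=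
    hf.tendsto_slope.mono_left (nhdsWithin_mono _ fun t ht => ne_of_gt ht)
  refine ge_of_tendsto h1 ?_
  filter_upwards [h, self_mem_nhdsWithin] with t ht ht0
  have ht0' : (0 : ℝ) < t := ht0
  rw [slope_def_field]
  apply div_nonneg <;> linarith

/-! ### The polytope of fractional server states -/

section Polytope

variable {V : Type*} [Fintype V] {k : ℕ}

/-- The set of pairs `S` consists of children of `u`. -/
def IsChildSet (T : ParentTree V) (u : V) (S : Finset (V × Fin k)) : Prop :=
  ∀ p ∈ S, p.1 ≠ T.root ∧ T.par p.1 = u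

/-- Fractional states of `k` servers on a tree: `1 - x (u, i)` is the probability that more than
`i` servers are below `u`. -/
def serverPolytope (T : ParentTree V) (k : ℕ) : Set (V × Fin k → ℝ) :=
  -- No bound `x ≤ 1` is imposed, so that states may be pushed upwards in the optimality argument;
  -- `exists_prox_step` recovers the bound for the minimizer. If `S` has more than `k` elements, the
  -- right-hand sum simply runs over all of `Fin k`.
  {x | (∀ p, 0 ≤ x p) ∧ (∀ i, x (T.root, i) = 0) ∧
    ∀ u (S : Finset (V × Fin k)), IsChildSet T u S →
      ∑ p ∈ S, (1 - x p) ≤ ∑ i : Fin k with i.val < S.card, (1 - x (u, i))}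

/-- The multiscale shifted relative entropy. -/
noncomputable def entropyDiv (T : ParentTree V) (δ : ℝ) (y x : V × Fin k → ℝ) : ℝ :=
  ∑ p, T.wt p.1 * klTerm δ (y p) (x p)

lemma entropyDiv_nonneg (T : ParentTree V) {δ : ℝ} (hδ : 0 < δ) {y x : V × Fin k → ℝ}
    (hy : ∀ p, 0 ≤ y p) (hx : ∀ p, 0 ≤ x p) : 0 ≤ entropyDiv T δ y x :=
  Finset.sum_nonneg fun p _ => mul_nonneg (T.wt_pos _).le (klTerm_nonneg hδ (hy p) (hx p))

/-- There are finitely many linear constraints and the slack ones survive a short step, so only the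
tight ones restrict the direction `d`. -/
lemma eventually_mem_serverPolytope (T : ParentTree V) {x d : V × Fin k → ℝ}
    (hx : x ∈ serverPolytope T k) (h0 : ∀ p, x p = 0 → 0 ≤ d p) (hr : ∀ i, d (T.root, i) = 0)
    (hd : ∀ u (S : Finset (V × Fin k)), IsChildSet T u S →
      ∑ p ∈ S, (1 - x p) = ∑ i : Fin k with i.val < S.card, (1 - x (u, i)) →
      ∑ i : Fin k with i.val < S.card, d (u, i) ≤ ∑ p ∈ S, d p) :
    ∀ᶠ t in 𝓝[>] (0 : ℝ), x + t • d ∈ serverPolytope T k := by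
  obtain ⟨hx0, hxr, hxS⟩ := hx
  have e1 : ∀ᶠ t in 𝓝[>] (0 : ℝ), ∀ p, 0 ≤ x p + t * d p :=
    eventually_all.2 fun p => eventually_nonneg_add_mul (hx0 p) (h0 p)
  have e2 : ∀ᶠ t in 𝓝[>] (0 : ℝ), ∀ u (S : Finset (V × Fin k)), IsChildSet T u S →
      0 ≤ (∑ i : Fin k with i.val < S.card, (1 - x (u, i)) - ∑ p ∈ S, (1 - x p)) +
        t * (∑ p ∈ S, d p - ∑ i : Fin k with i.val < S.card, d (u, i)) := by
    refine eventually_all.2 fun u => eventually_all.2 fun S => eventually_imp_distrib_left.2 fun h => ?_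
    apply eventually_nonneg_add_mul
    · linarith [hxS u S h]
    · intro h2
      linarith [hd u S h (by linarith)]
  filter_upwards [e1, e2] with t h1 h2
  refine ⟨fun p => by simpa using h1 p, fun i => by simp [hxr, hr], fun u S h => ?_⟩
  have h3 := h2 u S h
  rw [mul_sub, Finset.mul_sum, Finset.mul_sum] at h3
  simp only [Pi.add_apply, Pi.smul_apply, smul_eq_mul]
  have a1 : ∑ p ∈ S, (1 - (x p + t * d p)) = ∑ p ∈ S, (1 - x p) - ∑ p ∈ S, t * d p := by
    rw [← Finset.sum_sub_distrib]; exact Finset.sum_congr rfl fun _ _ => by ring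
  have a2 : ∑ i : Fin k with i.val < S.card, (1 - (x (u, i) + t * d (u, i))) =
      ∑ i : Fin k with i.val < S.card, (1 - x (u, i)) -
        ∑ i : Fin k with i.val < S.card, t * d (u, i) := by
    rw [← Finset.sum_sub_distrib]; exact Finset.sum_congr rfl fun _ _ => by ring
  rw [a1, a2]; linarith

omit [Fintype V] in
lemma serverPolytope_isClosed (T : ParentTree V) : IsClosed (serverPolytope T k) := by
  simp only [serverPolytope, Set.ofPred_and, Set.ofPred_forall]
  refine IsClosed.inter (isClosed_iInter fun p => isClosed_le (by fun_prop) (by fun_prop))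
    (IsClosed.inter (isClosed_iInter fun i => isClosed_eq (by fun_prop) (by fun_prop)) ?_)
  exact isClosed_iInter fun u => isClosed_iInter fun S => isClosed_iInter fun _ =>
    isClosed_le (by fun_prop) (by fun_prop)

omit [Fintype V] in
lemma serverPolytope_convex (T : ParentTree V) : Convex ℝ (serverPolytope T k) := by
  intro x hx y hy a b ha hb hab
  refine ⟨fun p => ?_, fun i => by simp [hx.2.1, hy.2.1], fun u S h => ?_⟩
  · have := hx.1 p; have := hy.1 p
    simp only [Pi.add_apply, Pi.smul_apply, smul_eq_mul]; positivity
  · have e : ∀ p, 1 - (a • x + b • y) p = a * (1 - x p) + b * (1 - y p) := fun p => by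
      simp only [Pi.add_apply, Pi.smul_apply, smul_eq_mul]; linear_combination -hab
    simp only [e, Finset.sum_add_distrib, ← Finset.mul_sum]
    have := mul_le_mul_of_nonneg_left (hx.2.2 u S h) ha
    have := mul_le_mul_of_nonneg_left (hy.2.2 u S h) hb
    linarith

/-- A minimizer of the proximal objective, together with its first order optimality condition. -/
lemma exists_prox_minimizer (T : ParentTree V) {δ : ℝ} (hδ : 0 < δ) {x : V × Fin k → ℝ}
    (hx : x ∈ serverPolytope T k) (hx1 : ∀ p, x p ≤ 1) (η : V × Fin k → ℝ) :
    ∃ z ∈ serverPolytope T k, (∀ p, z p ≤ 2) ∧ ∀ d : V × Fin k → ℝ,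
      (∀ᶠ t in 𝓝[>] (0 : ℝ), z + t • d ∈ serverPolytope T k) → (∀ p, z p = 2 → d p ≤ 0) →
        0 ≤ ∑ p, (T.wt p.1 * Real.log ((z p + δ) / (x p + δ)) + η p) * d p := by
  -- The box only supplies compactness. Its upper bound is 2 rather than 1 so that it becomes
  -- inactive once the minimizer is known to be at most 1.
  set K := serverPolytope T k ∩ Set.Icc 0 (fun _ => 2) with hK
  have hKc : IsCompact K := by
    rw [hK, Set.inter_comm]
    exact isCompact_Icc.inter_right (serverPolytope_isClosed T)
  set F : (V × Fin k → ℝ) → ℝ := fun z => ∑ p, (T.wt p.1 * klTerm δ (z p) (x p) + η p * z p) with hF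
  have hFc : ContinuousOn F K := by
    refine continuousOn_finsetSum _ fun p _ => ContinuousOn.add (ContinuousOn.mul (by fun_prop) ?_)
      (by fun_prop)
    refine (continuousOn_klTerm hδ (hx.1 p)).comp (by fun_prop) ?_
    intro z hz
    exact hz.1.1 p
  obtain ⟨z, hz, hmin⟩ := hKc.exists_isMinOn
    ⟨x, hx, fun p => hx.1 p, fun p => (hx1 p).trans (by norm_num)⟩ hFc
  refine ⟨z, hz.1, fun p => hz.2.2 p, fun d hd hd2 => ?_⟩
  have e2 : ∀ᶠ t in 𝓝[>] (0 : ℝ), ∀ p, 0 ≤ (2 - z p) + t * (- d p) :=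
    eventually_all.2 fun p => eventually_nonneg_add_mul (by linarith [show z p ≤ 2 from hz.2.2 p])
      fun h => by linarith [hd2 p (by linarith)]
  have hD : HasDerivAt (fun t : ℝ => F (z + t • d))
      (∑ p, (T.wt p.1 * Real.log ((z p + δ) / (x p + δ)) + η p) * d p) 0 := by
    simp only [hF, Pi.add_apply, Pi.smul_apply, smul_eq_mul]
    refine HasDerivAt.fun_sum fun p _ => ?_
    have h1 := (hasDerivAt_klTerm (d := d p) hδ (hz.1.1 p) (hx.1 p)).const_mul (T.wt p.1)
    have h2 : HasDerivAt (fun t : ℝ => η p * (z p + t * d p)) (η p * d p) 0 := by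
      simpa using (((hasDerivAt_id (0 : ℝ)).mul_const (d p)).const_add (z p)).const_mul (η p)
    convert! h1.add h2 using 1
    ring
  refine deriv_nonneg_of_eventually_le hD ?_
  filter_upwards [hd, e2] with t h1 h2
  simp only [zero_smul, add_zero]
  refine hmin ⟨h1, fun p => h1.1 p, fun p => ?_⟩
  have := h2 p
  simp only [Pi.add_apply, Pi.smul_apply, smul_eq_mul]; linarith

end Polytope

/-! ### Proximal steps and the fractional service of a request -/

section ProxStep

variable {V : Type*} [Fintype V] {k : ℕ}

/-- One proximal step towards serving the leaf `r`. -/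
lemma exists_prox_step (T : ParentTree V) {δ : ℝ} (hδ : 0 < δ) {x : V × Fin k → ℝ}
    (hx : x ∈ serverPolytope T k) (hx1 : ∀ p, x p ≤ 1) {H : ℝ} (hH : ∀ v, (T.dep v : ℝ) ≤ H)
    {r : V} (hr : r ≠ T.root) (hleaf : ∀ v, v ≠ T.root → T.par v ≠ r) (i₀ : Fin k)
    {η : ℝ} (hη : 0 < η) :
    ∃ z ∈ serverPolytope T k, (∀ p, z p ≤ 1) ∧
      (∀ y ∈ serverPolytope T k, (∀ p, y p ≤ 1) →
        entropyDiv T δ z x + η * (z (r, i₀) - y (r, i₀)) ≤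
          entropyDiv T δ y x - entropyDiv T δ y z) ∧
      (∑ p, T.wt p.1 * max (z p - x p) 0 ≤ ∑ p, T.dep p.1 * T.wt p.1 * (z p - x p) +
        H * (entropyDiv T δ z x + η * (z (r, i₀) + δ))) ∧
      (x (r, i₀) + δ) * Real.exp (-(η / T.wt r)) ≤ z (r, i₀) + δ := by
  classical
  obtain ⟨z, hz, hz2, hvar⟩ := exists_prox_minimizer T hδ hx hx1
    (fun p => if p = (r, i₀) then η else 0)
  set g : V × Fin k → ℝ := fun p => T.wt p.1 * Real.log ((z p + δ) / (x p + δ)) +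
    (if p = (r, i₀) then η else 0) with hg
  change ∀ d : V × Fin k → ℝ, _ → _ → 0 ≤ ∑ p, g p * d p at hvar
  have hlog : ∀ p, T.wt p.1 * Real.log ((z p + δ) / (x p + δ)) ≤ g p := fun p => by
    simp only [hg]; split_ifs <;> linarith
  have hzp : ∀ p, 0 < z p + δ := fun p => by linarith [hz.1 p]
  have hxp : ∀ p, 0 < x p + δ := fun p => by linarith [hx.1 p]
  -- Induction on the depth. If `z (v, i) > 1`, lowering this coordinate is feasible: dropping `(v,
  -- i)` from a tight set would increase the left side of its constraint, while the right side
  -- cannot increase since the parent coordinates are at most 1. But as `x ≤ 1`, lowering it would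
  -- also decrease the objective.
  have hz1 : ∀ n : ℕ, ∀ p : V × Fin k, T.dep p.1 = n → z p ≤ 1 := by
    intro n
    induction n with
    | zero =>
      rintro ⟨v, i⟩ hv
      have : v = T.root := by
        by_contra h
        have := T.dep_par v h
        simp only at hv
        omega
      rw [this, hz.2.1 i]; norm_num
    | succ n ih =>
      rintro ⟨v, i⟩ hv
      by_contra! hgt
      have hvr : v ≠ T.root := by
        rintro rfl
        simp [T.dep_root] at hv
      have hpar : ∀ j, z (T.par v, j) ≤ 1 := fun j => ih _ (by
        have := T.dep_par v hvr
        simp only at hv ⊢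
        omega)
      have hd := hvar (fun p => if p = (v, i) then -1 else 0) ?_ ?_
      · simp only [mul_ite, mul_zero, Finset.sum_ite_eq', Finset.mem_univ, if_true] at hd
        have h1 := hlog (v, i)
        have h2 : T.wt v * Real.log ((z (v, i) + δ) / (x (v, i) + δ)) ≤ 0 := by
          simp only at h1; linarith
        have h3 : 0 < Real.log ((z (v, i) + δ) / (x (v, i) + δ)) := by
          apply Real.log_pos
          rw [lt_div_iff₀ (hxp _)]
          linarith [hx1 (v, i)]
        have := mul_pos (T.wt_pos v) h3
        linarith
      · refine eventually_mem_serverPolytope T hz ?_ ?_ ?_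
        · intro p hp
          split_ifs with h
          · rw [h] at hp; linarith
          · exact le_rfl
        · intro j
          rw [if_neg]
          intro h
          exact hvr (congrArg Prod.fst h).symm
        · intro u S hS hact
          by_cases hmem : (v, i) ∈ S
          · exfalso
            have hu : T.par v = u := (hS _ hmem).2
            subst hu
            have hS' : IsChildSet T (T.par v) (S.erase (v, i)) := fun p hp =>
              hS p (Finset.mem_of_mem_erase hp)
            have h1 := hz.2.2 _ _ hS'
            have h2 : ∑ j : Fin k with j.val < (S.erase (v, i)).card, (1 - z (T.par v, j)) ≤
                ∑ j : Fin k with j.val < S.card, (1 - z (T.par v, j)) := by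
              refine Finset.sum_le_sum_of_subset_of_nonneg ?_ fun j _ _ => by linarith [hpar j]
              intro j hj
              simp only [Finset.mem_filter, Finset.mem_univ, true_and] at hj ⊢
              exact hj.trans_le (Finset.card_le_card (Finset.erase_subset _ _))
            rw [← Finset.add_sum_erase S _ hmem] at hact
            linarith
          · rw [Finset.sum_eq_zero (s := S) fun p hp => if_neg fun h : p = (v, i) => hmem (h ▸ hp)]
            exact Finset.sum_nonpos fun j _ => by split_ifs <;> norm_num
      · intro p _
        split_ifs <;> norm_num
  replace hz1 : ∀ p, z p ≤ 1 := fun p => hz1 _ p rfl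
  refine ⟨z, hz, hz1, ?_, ?_, ?_⟩
  · intro y hy hy1
    -- The direction towards `y`, combined with the three-point identity.
    have hd := hvar (fun p => y p - z p) ?_ (fun p hp => by linarith [hz1 p])
    · have e : ∑ p, g p * (y p - z p) = entropyDiv T δ y x - entropyDiv T δ y z -
          entropyDiv T δ z x + η * (y (r, i₀) - z (r, i₀)) := by
        simp only [entropyDiv, ← Finset.sum_sub_distrib, hg, add_mul, Finset.sum_add_distrib, ite_mul,
          zero_mul, Finset.sum_ite_eq', Finset.mem_univ, if_true]
        congr 1
        refine Finset.sum_congr rfl fun p _ => ?_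
        rw [mul_assoc, ← klTerm_sub_klTerm hδ (hy.1 p) (hx.1 p) (hz.1 p)]
        ring
      rw [e] at hd
      linarith
    · have : ∀ᶠ t in 𝓝[>] (0 : ℝ), t < 1 :=
        nhdsWithin_le_nhds (eventually_lt_nhds (by norm_num))
      filter_upwards [this, self_mem_nhdsWithin] with t ht ht0
      have ht0' : (0 : ℝ) < t := ht0
      have h := serverPolytope_convex T hz hy (show 0 ≤ 1 - t by linarith) ht0'.le (by ring)
      convert! h using 1
      funext p
      simp only [Pi.add_apply, Pi.smul_apply, smul_eq_mul]
      ring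
  -- The test direction behind the factor `H`. Children are one level deeper than `u`, so even after
  -- subtracting the indicator of `0 < g` their weights are at least `dep u`, which makes the
  -- direction feasible. The indicator part isolates the positive gradients and dominates the upward
  -- movement; the depth part equals a linear potential plus at most `H` times the proximal cost.
  · have hd := hvar (fun p => (T.dep p.1 - if 0 < g p then 1 else 0) * (z p + δ)) ?_
      (fun p hp => by linarith [hz1 p])
    · have e : ∀ p, g p * ((T.dep p.1 - if 0 < g p then 1 else 0) * (z p + δ)) ≤
          T.dep p.1 * T.wt p.1 * (z p - x p) + H * (T.wt p.1 * klTerm δ (z p) (x p)) +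
            (if p = (r, i₀) then H * (η * (z (r, i₀) + δ)) else 0)
            - T.wt p.1 * max (z p - x p) 0 := by
        intro p
        have hkl := klTerm_nonneg hδ (hz.1 p) (hx.1 p)
        have hw := T.wt_pos p.1
        have a1 : T.wt p.1 * max (z p - x p) 0 ≤ g p * (if 0 < g p then 1 else 0) * (z p + δ) := by
          have h1 := sub_le_mul_log hδ (hz.1 p) (hx.1 p)
          have h2 := mul_le_mul_of_nonneg_left h1 hw.le
          have h3 : T.wt p.1 * (z p - x p) ≤ g p * (z p + δ) := by
            have := mul_le_mul_of_nonneg_right (hlog p) (hzp p).le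
            linarith
          split_ifs with hgp
          · rcases max_cases (z p - x p) 0 with h | h <;> rw [h.1]
            · linarith
            · have := mul_pos hgp (hzp p)
              linarith
          · have h4 : g p * (z p + δ) ≤ 0 :=
              mul_nonpos_of_nonpos_of_nonneg (not_lt.1 hgp) (hzp p).le
            have h5 : z p - x p ≤ 0 := by
              by_contra! h6
              have := mul_pos hw h6
              linarith
            rw [max_eq_right h5]; simp
        have a2 : (T.dep p.1 : ℝ) * (g p * (z p + δ)) ≤
            T.dep p.1 * T.wt p.1 * (z p - x p) + H * (T.wt p.1 * klTerm δ (z p) (x p)) +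
            (if p = (r, i₀) then H * (η * (z (r, i₀) + δ)) else 0) := by
          have b1 : g p * (z p + δ) = T.wt p.1 * (z p - x p) + T.wt p.1 * klTerm δ (z p) (x p) +
              (if p = (r, i₀) then η * (z (r, i₀) + δ) else 0) := by
            simp only [hg, klTerm]
            split_ifs with h
            · rw [← h]; ring
            · ring
          rw [b1, mul_add, mul_add]
          have b2 := mul_le_mul_of_nonneg_right (hH p.1) (mul_nonneg hw.le hkl)
          have b3 : (T.dep p.1 : ℝ) * (if p = (r, i₀) then η * (z (r, i₀) + δ) else 0) ≤
              (if p = (r, i₀) then H * (η * (z (r, i₀) + δ)) else 0) := by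
            split_ifs with h
            · exact mul_le_mul_of_nonneg_right (hH p.1) (mul_nonneg hη.le (hzp _).le)
            · simp
          linarith
        linarith
      have h2 := hd.trans (Finset.sum_le_sum fun p _ => e p)
      simp only [Finset.sum_add_distrib, Finset.sum_sub_distrib, ← Finset.mul_sum,
        Finset.sum_ite_eq', Finset.mem_univ, if_true] at h2
      simp only [entropyDiv, mul_add H]
      linarith
    · refine eventually_mem_serverPolytope T hz ?_ ?_ ?_
      · intro p hp
        by_cases hpr : p.1 = T.root
        · have : g p ≤ 0 := by
            obtain ⟨v, i⟩ := p
            simp only at hpr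
            subst hpr
            simp only [hg]
            rw [hz.2.1, hx.2.1, div_self (by linarith), Real.log_one, if_neg]
            · simp
            · intro h; exact hr (congrArg Prod.fst h).symm
          rw [if_neg (not_lt.2 this), sub_zero]
          exact mul_nonneg (Nat.cast_nonneg _) (hzp p).le
        · have h1 : (1 : ℝ) ≤ T.dep p.1 := by
            rw [T.dep_par _ hpr]; push_cast; linarith [Nat.cast_nonneg (α := ℝ) (T.dep (T.par p.1))]
          apply mul_nonneg _ (hzp p).le
          split_ifs <;> linarith
      · intro i
        have : g (T.root, i) = 0 := by
          simp only [hg]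
          rw [hz.2.1, hx.2.1, div_self (by linarith), Real.log_one, if_neg]
          · simp
          · intro h; exact hr (congrArg Prod.fst h).symm
        simp [this, T.dep_root]
      · intro u S hS hact
        have h1 : ∑ p ∈ S, (T.dep u : ℝ) * (z p + δ) ≤
            ∑ p ∈ S, (T.dep p.1 - if 0 < g p then (1 : ℝ) else 0) * (z p + δ) := by
          refine Finset.sum_le_sum fun p hp => mul_le_mul_of_nonneg_right ?_ (hzp p).le
          obtain ⟨hp1, hp2⟩ := hS p hp
          rw [T.dep_par _ hp1, hp2]
          push_cast
          split_ifs <;> linarith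
        have h2 : ∑ i : Fin k with i.val < S.card,
            (T.dep u - if 0 < g (u, i) then (1 : ℝ) else 0) * (z (u, i) + δ) ≤
            ∑ i : Fin k with i.val < S.card, (T.dep u : ℝ) * (z (u, i) + δ) := by
          refine Finset.sum_le_sum fun i _ => mul_le_mul_of_nonneg_right ?_ (hzp _).le
          split_ifs <;> linarith
        -- Tightness equates the sums of `1 - z`, and the parent side has at most as many terms as
        -- `S`.
        have h3 : ∑ i : Fin k with i.val < S.card, (z (u, i) + δ) ≤ ∑ p ∈ S, (z p + δ) := by
          have c1 : ∑ p ∈ S, (z p + δ) = S.card * (1 + δ) - ∑ p ∈ S, (1 - z p) := by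
            rw [← nsmul_eq_mul, ← Finset.sum_const, ← Finset.sum_sub_distrib]
            exact Finset.sum_congr rfl fun _ _ => by ring
          have c2 : ∑ i : Fin k with i.val < S.card, (z (u, i) + δ) =
              (Finset.univ.filter fun i : Fin k => i.val < S.card).card * (1 + δ) -
                ∑ i : Fin k with i.val < S.card, (1 - z (u, i)) := by
            rw [← nsmul_eq_mul, ← Finset.sum_const, ← Finset.sum_sub_distrib]
            exact Finset.sum_congr rfl fun _ _ => by ring
          have c3 : (Finset.univ.filter fun i : Fin k => i.val < S.card).card ≤ S.card := by
            rw [Fin.card_filter_val_lt]; exact min_le_right _ _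
          have c4 : ((Finset.univ.filter fun i : Fin k => i.val < S.card).card : ℝ) ≤ S.card := by
            exact_mod_cast c3
          rw [c1, c2, hact]
          have := mul_le_mul_of_nonneg_right c4 (show 0 ≤ 1 + δ by linarith)
          linarith
        refine h2.trans (le_trans ?_ h1)
        rw [← Finset.mul_sum, ← Finset.mul_sum]
        exact mul_le_mul_of_nonneg_left h3 (Nat.cast_nonneg _)
  -- Raising the coordinate of a leaf is always feasible: it only relaxes the constraints at its
  -- parent, and a leaf imposes none on children. Hence one step cannot lower it too far.
  · have hd := hvar (fun p => if p = (r, i₀) then 1 else 0) ?_ ?_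
    · simp only [mul_ite, mul_one, mul_zero, Finset.sum_ite_eq', Finset.mem_univ, if_true, hg] at hd
      have hw := T.wt_pos r
      have h1 : -(η / T.wt r) ≤ Real.log ((z (r, i₀) + δ) / (x (r, i₀) + δ)) := by
        rw [← neg_div, div_le_iff₀ hw]; linarith
      have h2 := Real.exp_le_exp.2 h1
      rw [Real.exp_log (div_pos (hzp _) (hxp _)), le_div_iff₀ (hxp _)] at h2
      linarith
    · refine eventually_mem_serverPolytope T hz ?_ ?_ ?_
      · intro p hp
        split_ifs <;> norm_num
      · intro j
        rw [if_neg]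
        intro h
        exact hr (congrArg Prod.fst h).symm
      · intro u S hS hact
        by_cases hu : u = r
        · subst hu
          have : S = ∅ := Finset.eq_empty_of_forall_notMem fun p hp => hleaf _ (hS p hp).1 (hS p hp).2
          subst this
          simp
        · rw [Finset.sum_eq_zero]
          · exact Finset.sum_nonneg fun j _ => by split_ifs <;> norm_num
          · intro i _
            rw [if_neg]
            intro h
            exact hu (congrArg Prod.fst h)
    · intro p hp
      linarith [hz1 p]

/-- Serving a request at the leaf `r` fractionally: the movement is paid for by the decrease of the
relative entropy to every state that serves `r`, up to the change of a linear potential. -/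
lemma exists_fractional_serve (T : ParentTree V) {δ : ℝ} (hδ : 0 < δ) {x : V × Fin k → ℝ}
    (hx : x ∈ serverPolytope T k) (hx1 : ∀ p, x p ≤ 1) {H : ℝ} (hH : ∀ v, (T.dep v : ℝ) ≤ H)
    {r : V} (hr : r ≠ T.root) (hleaf : ∀ v, v ≠ T.root → T.par v ≠ r) (i₀ : Fin k)
    {y₀ : V × Fin k → ℝ} (hy₀ : y₀ ∈ serverPolytope T k) (hy₀1 : ∀ p, y₀ p ≤ 1)
    (hy₀r : y₀ (r, i₀) = 0) :
    ∃ z ∈ serverPolytope T k, (∀ p, z p ≤ 1) ∧ z (r, i₀) ≤ δ ∧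
      ∀ y ∈ serverPolytope T k, (∀ p, y p ≤ 1) → y (r, i₀) = 0 →
        ∑ p, T.wt p.1 * |z p - x p| ≤ ∑ p, (2 * T.dep p.1 - 1) * T.wt p.1 * (z p - x p) +
          6 * H * (entropyDiv T δ y x - entropyDiv T δ y z) := by
  have hH0 : 0 ≤ H := (Nat.cast_nonneg _).trans (hH T.root)
  have hw := T.wt_pos r
  -- With this step size `exp (-η / wt r) ≥ 3/4`. From a value above `δ`, one step therefore stays
  -- at least `3/4 * 2δ - δ = δ/2`.
  set η := T.wt r / 4 with hη
  have hη0 : 0 < η := by positivity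
  -- As long as the value at `r` exceeds `δ`, each step lowers the divergence to `y₀` by at least `η
  -- * (δ / 2)`. As the divergence is nonnegative, `m` bounds the number of steps.
  have key : ∀ m : ℕ, ∀ x ∈ serverPolytope T k, (∀ p, x p ≤ 1) →
      entropyDiv T δ y₀ x ≤ m * (η * (δ / 2)) →
      ∃ z ∈ serverPolytope T k, (∀ p, z p ≤ 1) ∧ z (r, i₀) ≤ δ ∧
      ∀ y ∈ serverPolytope T k, (∀ p, y p ≤ 1) → y (r, i₀) = 0 →
        ∑ p, T.wt p.1 * |z p - x p| ≤ ∑ p, (2 * T.dep p.1 - 1) * T.wt p.1 * (z p - x p) +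
          6 * H * (entropyDiv T δ y x - entropyDiv T δ y z) := by
    intro m
    induction m with
    | zero =>
      intro x hx hx1 hm
      by_cases hxr : x (r, i₀) ≤ δ
      · exact ⟨x, hx, hx1, hxr, fun y _ _ _ => by simp⟩
      · exfalso
        obtain ⟨z, hz, hz1, hzy, -, hzr⟩ := exists_prox_step T hδ hx hx1 hH hr hleaf i₀ hη0
        have h1 := hzy y₀ hy₀ hy₀1
        have h2 := entropyDiv_nonneg T hδ hy₀.1 hz.1
        have h3 := entropyDiv_nonneg T hδ hz.1 hx.1
        have h4 : 0 ≤ η * z (r, i₀) := mul_nonneg hη0.le (hz.1 _)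
        have h5 : 0 < z (r, i₀) := by
          have : Real.exp (-(η / T.wt r)) ≥ 3 / 4 := by
            have := Real.add_one_le_exp (-(η / T.wt r))
            have e : η / T.wt r = 1 / 4 := by rw [hη]; field_simp
            rw [e] at this ⊢; linarith
          push Not at hxr
          nlinarith
        have h6 := mul_pos hη0 h5
        simp only [CharP.cast_eq_zero, zero_mul] at hm
        rw [hy₀r] at h1
        linarith
    | succ m ih =>
      intro x hx hx1 hm
      by_cases hxr : x (r, i₀) ≤ δ
      · exact ⟨x, hx, hx1, hxr, fun y _ _ _ => by simp⟩
      obtain ⟨z, hz, hz1, hzy, hzm, hzr⟩ := exists_prox_step T hδ hx hx1 hH hr hleaf i₀ hη0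
      have h3 := entropyDiv_nonneg T hδ hz.1 hx.1
      have h5 : δ / 2 ≤ z (r, i₀) := by
        have : Real.exp (-(η / T.wt r)) ≥ 3 / 4 := by
          have := Real.add_one_le_exp (-(η / T.wt r))
          have e : η / T.wt r = 1 / 4 := by rw [hη]; field_simp
          rw [e] at this ⊢; linarith
        push Not at hxr
        nlinarith
      have h6 := mul_le_mul_of_nonneg_left h5 hη0.le
      obtain ⟨z', hz', hz'1, hz'r, hz'm⟩ := ih z hz hz1 (by
        have h1 := hzy y₀ hy₀ hy₀1
        rw [hy₀r] at h1
        push_cast at hm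
        linarith)
      refine ⟨z', hz', hz'1, hz'r, fun y hy hy1 hyr => ?_⟩
      have h1 := hz'm y hy hy1 hyr
      have h2 := hzy y hy hy1
      rw [hyr] at h2
      -- Since `z (r, i₀) ≥ δ/2`, the shifted value `z (r, i₀) + δ` is at most three times the
      -- unshifted one.
      have h7 : H * (entropyDiv T δ z x + η * (z (r, i₀) + δ)) ≤
          H * (3 * (entropyDiv T δ y x - entropyDiv T δ y z)) := by
        apply mul_le_mul_of_nonneg_left _ hH0
        nlinarith
      -- Only upward movement has been bounded; the total movement is twice that minus the net
      -- change. This explains the potential `2 * dep - 1` and the constant `6 = 2 * 3`.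
      have h8 : ∑ p, T.wt p.1 * |z p - x p| =
          2 * ∑ p, T.wt p.1 * max (z p - x p) 0 - ∑ p, T.wt p.1 * (z p - x p) := by
        rw [Finset.mul_sum, ← Finset.sum_sub_distrib]
        refine Finset.sum_congr rfl fun p _ => ?_
        rcases le_total (z p - x p) 0 with h | h
        · rw [abs_of_nonpos h, max_eq_right h]; ring
        · rw [abs_of_nonneg h, max_eq_left h]; ring
      have h9 : ∑ p, T.wt p.1 * |z' p - x p| ≤
          ∑ p, T.wt p.1 * |z' p - z p| + ∑ p, T.wt p.1 * |z p - x p| := by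
        rw [← Finset.sum_add_distrib]
        refine Finset.sum_le_sum fun p _ => ?_
        rw [← mul_add]
        exact mul_le_mul_of_nonneg_left (abs_sub_le _ _ _) (T.wt_pos _).le
      have h10 : ∑ p, (2 * T.dep p.1 - 1) * T.wt p.1 * (z' p - x p) =
          ∑ p, (2 * T.dep p.1 - 1) * T.wt p.1 * (z' p - z p) +
          (2 * ∑ p, T.dep p.1 * T.wt p.1 * (z p - x p) - ∑ p, T.wt p.1 * (z p - x p)) := by
        rw [Finset.mul_sum, ← Finset.sum_sub_distrib, ← Finset.sum_add_distrib]
        exact Finset.sum_congr rfl fun p _ => by ring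
      rw [h10]
      linarith
  obtain ⟨m, hm⟩ := exists_nat_ge (entropyDiv T δ y₀ x / (η * (δ / 2)))
  exact key m x hx hx1 ((div_le_iff₀ (by positivity)).1 hm)

end ProxStep

/-! ### Ancestors and server counts -/

section Ancestors

variable {V : Type*}

/-- `a` is `v` or an ancestor of `v`. -/
def IsAnc (T : ParentTree V) (a v : V) : Prop := ∃ m, T.par^[m] v = a

lemma isAnc_root_iff (T : ParentTree V) {a : V} : IsAnc T a T.root ↔ a = T.root := by
  constructor
  · rintro ⟨m, rfl⟩
    exact Function.iterate_fixed T.par_root m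
  · rintro rfl
    exact ⟨0, rfl⟩

lemma isAnc_iff (T : ParentTree V) {a v : V} : IsAnc T a v ↔ a = v ∨ IsAnc T a (T.par v) := by
  constructor
  · rintro ⟨_ | m, h⟩
    · exact Or.inl h.symm
    · exact Or.inr ⟨m, h⟩
  · rintro (rfl | ⟨m, h⟩)
    · exact ⟨0, rfl⟩
    · exact ⟨m + 1, h⟩

lemma isAnc_refl (T : ParentTree V) (v : V) : IsAnc T v v := ⟨0, rfl⟩

lemma IsAnc.dep_le {T : ParentTree V} {a v : V} (h : IsAnc T a v) : T.dep a ≤ T.dep v := by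
  obtain ⟨m, rfl⟩ := h
  induction m with
  | zero => exact le_rfl
  | succ m ih =>
    rw [Function.iterate_succ_apply']
    refine le_trans ?_ ih
    by_cases hr : T.par^[m] v = T.root
    · rw [hr, T.par_root]
    · rw [T.dep_par _ hr]; omega

lemma isAnc_root (T : ParentTree V) (v : V) : IsAnc T T.root v := by
  induction h : T.dep v generalizing v with
  | zero =>
    by_cases hr : v = T.root
    · rw [hr]; exact isAnc_refl T _
    · have := T.dep_par _ hr; omega
  | succ n ih =>
    by_cases hr : v = T.root
    · rw [hr]; exact isAnc_refl T _
    · exact (isAnc_iff T).2 (Or.inr (ih _ (by have := T.dep_par _ hr; omega)))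

/-- Induction from the root downwards. -/
lemma ParentTree.induction (T : ParentTree V) {P : V → Prop} (root : P T.root)
    (step : ∀ v, v ≠ T.root → P (T.par v) → P v) (v : V) : P v := by
  induction h : T.dep v generalizing v with
  | zero =>
    by_cases hr : v = T.root
    · rwa [hr]
    · have := T.dep_par _ hr; omega
  | succ n ih =>
    by_cases hr : v = T.root
    · rwa [hr]
    · exact step v hr (ih _ (by have := T.dep_par _ hr; omega))

open Classical in
/-- The indicator function of "`a` is an ancestor of `v` or `v` itself". -/
noncomputable def ancInd (T : ParentTree V) (a v : V) : ℝ := if IsAnc T a v then 1 else 0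

open Classical in
lemma ancInd_root (T : ParentTree V) (a : V) : ancInd T a T.root = if a = T.root then 1 else 0 := by
  simp [ancInd, isAnc_root_iff]

open Classical in
lemma ancInd_eq (T : ParentTree V) (a : V) {v : V} (hv : v ≠ T.root) :
    ancInd T a v = (if a = v then 1 else 0) + ancInd T a (T.par v) := by
  unfold ancInd
  by_cases h : a = v
  · subst h
    have : ¬ IsAnc T a (T.par a) := fun h => by
      have := h.dep_le
      have := T.dep_par _ hv
      omega
    simp [this, isAnc_refl]
  · rw [isAnc_iff T (a := a) (v := v)]
    simp [h]

variable [Fintype V]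

-- If `v` lies below `u`, exactly one child of `u` is an ancestor of `v`, except when `v = u`.
open Classical in
lemma ancInd_sub_sum_children (T : ParentTree V) (u v : V) :
    ancInd T u v - ∑ c with c ≠ T.root ∧ T.par c = u, ancInd T c v = if v = u then 1 else 0 := by
  induction v using T.induction with
  | root =>
    rw [Finset.sum_eq_zero]
    · rw [ancInd_root, sub_zero]
      exact if_congr eq_comm rfl rfl
    · intro c hc
      rw [ancInd_root, if_neg (Finset.mem_filter.1 hc).2.1]
  | step v hv ih =>
    have h1 : ∑ c with c ≠ T.root ∧ T.par c = u, ancInd T c v =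
        (if T.par v = u then 1 else 0) +
          ∑ c with c ≠ T.root ∧ T.par c = u, ancInd T c (T.par v) := by
      rw [Finset.sum_congr rfl fun c _ => ancInd_eq T c hv, Finset.sum_add_distrib,
        Finset.sum_ite_eq']
      simp [hv]
    rw [h1, ancInd_eq T u hv]
    have : (if u = v then (1 : ℝ) else 0) = if v = u then 1 else 0 := if_congr eq_comm rfl rfl
    linarith

/-- The tree metric defined by the edge weights. -/
noncomputable def edgeDist (T : ParentTree V) (u v : V) : ℝ :=
  -- The edge above `a` counts exactly when it separates `u` from `v`. The dummy weight at the root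
  -- never contributes, the root being an ancestor of every vertex.
  ∑ a, T.wt a * |ancInd T a u - ancInd T a v|

variable {ι : Type*} [Fintype ι]

open Classical in
/-- The number of servers below `u`. -/
noncomputable def serversBelow (T : ParentTree V) (s : ι → V) (u : V) : ℕ :=
  (Finset.univ.filter fun i => IsAnc T u (s i)).card

omit [Fintype V] in
lemma cast_serversBelow (T : ParentTree V) (s : ι → V) (u : V) :
    (serversBelow T s u : ℝ) = ∑ i, ancInd T u (s i) := by
  simp [serversBelow, ancInd]

omit [Fintype V] in
lemma serversBelow_le (T : ParentTree V) (s : ι → V) (u : V) :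
    serversBelow T s u ≤ Fintype.card ι := Finset.card_le_univ _

omit [Fintype V] in
lemma serversBelow_root (T : ParentTree V) (s : ι → V) :
    serversBelow T s T.root = Fintype.card ι := by
  simp [serversBelow, isAnc_root]

open Classical in
lemma serversBelow_sub_sum_children (T : ParentTree V) (s : ι → V) (u : V) :
    (serversBelow T s u : ℝ) - ∑ c with c ≠ T.root ∧ T.par c = u, (serversBelow T s c : ℝ) =
      (Finset.univ.filter fun i => s i = u).card := by
  simp only [cast_serversBelow]
  rw [Finset.sum_comm, ← Finset.sum_sub_distrib]
  simp [ancInd_sub_sum_children]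

open Classical in
lemma sum_children_serversBelow_le (T : ParentTree V) (s : ι → V) (u : V) :
    ∑ c with c ≠ T.root ∧ T.par c = u, serversBelow T s c ≤ serversBelow T s u := by
  have := serversBelow_sub_sum_children T s u
  have h2 : (0 : ℝ) ≤ (Finset.univ.filter fun i => s i = u).card := Nat.cast_nonneg _
  have h3 : (∑ c with c ≠ T.root ∧ T.par c = u, (serversBelow T s c : ℝ)) ≤ serversBelow T s u := by
    linarith
  exact_mod_cast h3

/-- Each edge must be crossed by at least the difference of the server counts below it, whatever the
matching. -/
lemma sum_wt_abs_serversBelow_sub_le (T : ParentTree V) {ι' : Type*} [Fintype ι'] (s : ι → V)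
    (s' : ι' → V) (e : ι ≃ ι') :
    ∑ u, T.wt u * |(serversBelow T s' u : ℝ) - serversBelow T s u| ≤
      ∑ i, edgeDist T (s i) (s' (e i)) := by
  unfold edgeDist
  rw [Finset.sum_comm]
  refine Finset.sum_le_sum fun u _ => ?_
  rw [← Finset.mul_sum]
  refine mul_le_mul_of_nonneg_left ?_ (T.wt_pos _).le
  rw [cast_serversBelow, cast_serversBelow, ← e.sum_comp, ← Finset.sum_sub_distrib]
  refine (Finset.abs_sum_le_sum_abs _ _).trans (le_of_eq ?_)
  exact Finset.sum_congr rfl fun i _ => abs_sub_comm _ _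

/-! ### Integral states -/

variable {k : ℕ}

/-- The point of the polytope that corresponds to servers at the positions `s`. -/
noncomputable def integralState (T : ParentTree V) (k : ℕ) (s : ι → V) : V × Fin k → ℝ :=
  fun p => if p.2.val < serversBelow T s p.1 then 0 else 1

omit [Fintype V] in
lemma integralState_nonneg (T : ParentTree V) (s : ι → V) (p : V × Fin k) :
    0 ≤ integralState T k s p := by
  unfold integralState; split_ifs <;> norm_num

omit [Fintype V] in
lemma integralState_le_one (T : ParentTree V) (s : ι → V) (p : V × Fin k) :
    integralState T k s p ≤ 1 := by
  unfold integralState; split_ifs <;> norm_num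

/-- The left side of a constraint counts at most one unit per pair in `S` and at most as many units
as there are servers below the children. It is thus at most `min S.card (serversBelow T s u)`, which
is the right side because there are only `k` servers. -/
lemma integralState_mem (T : ParentTree V) (s : ι → V) (hk : Fintype.card ι = k) :
    integralState T k s ∈ serverPolytope T k := by
  classical
  refine ⟨integralState_nonneg T s, fun i => ?_, fun u S hS => ?_⟩
  · simp [integralState, serversBelow_root, hk, i.2]
  · have e : ∀ p : V × Fin k, 1 - integralState T k s p =
        if p.2.val < serversBelow T s p.1 then 1 else 0 := fun p => by
      unfold integralState; split_ifs <;> norm_num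
    simp only [e, Finset.sum_boole]
    have h1 : (S.filter fun p => p.2.val < serversBelow T s p.1).card ≤ serversBelow T s u := by
      refine le_trans ?_ (sum_children_serversBelow_le T s u)
      rw [Finset.card_eq_sum_card_fiberwise (f := Prod.fst)
        (t := Finset.univ.filter fun c => c ≠ T.root ∧ T.par c = u)
        (fun p hp => by simpa using hS p (Finset.mem_filter.1 hp).1)]
      refine Finset.sum_le_sum fun c _ => ?_
      have : serversBelow T s c = (Finset.range (serversBelow T s c)).card := by simp
      rw [this]
      refine Finset.card_le_card_of_injOn (fun p => p.2.val) ?_ ?_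
      · intro p hp
        simp only [Finset.coe_filter, Finset.mem_filter, Set.mem_ofPred_eq] at hp
        simp only [Finset.coe_range, Set.mem_Iio]
        rw [← hp.2]; exact hp.1.2
      · intro p hp q hq hpq
        simp only [Finset.coe_filter, Finset.mem_filter, Set.mem_ofPred_eq] at hp hq
        exact Prod.ext (hp.2.trans hq.2.symm) (Fin.ext hpq)
    have h2 : (S.filter fun p => p.2.val < serversBelow T s p.1).card ≤ S.card :=
      Finset.card_filter_le _ _
    have h3 := hk ▸ serversBelow_le T s u
    have h4 : ((Finset.univ.filter fun i : Fin k => i.val < S.card).filter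
        fun i => i.val < serversBelow T s u).card = min k (min S.card (serversBelow T s u)) := by
      rw [Finset.filter_filter, ← Fin.card_filter_val_lt]
      congr 1
      ext i
      simp
    rw [h4]
    have h5 := h1.trans h3
    exact_mod_cast le_min h5 (le_min h2 h1)

omit [Fintype V] in
lemma integralState_eq_zero (T : ParentTree V) (s : ι → V) {i : ι} {p : V × Fin k}
    (hp : p.2.val = 0) (hi : s i = p.1) : integralState T k s p = 0 := by
  rw [integralState, if_pos]
  rw [hp, serversBelow, Finset.card_pos]
  exact ⟨i, by simp [hi, isAnc_refl]⟩

/-- At a vertex `u` the two states differ only in the coordinates between the two server counts, and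
each of these changes its divergence by at most the bound of `klTerm_le`. -/
lemma entropyDiv_integralState_le (T : ParentTree V) {δ : ℝ} (hδ : 0 < δ) {x : V × Fin k → ℝ}
    (hx : ∀ p, 0 ≤ x p) (hx1 : ∀ p, x p ≤ 1) {ι' : Type*} [Fintype ι'] (s : ι → V) (s' : ι' → V) :
    entropyDiv T δ (integralState T k s') x ≤ entropyDiv T δ (integralState T k s) x +
      ((1 + δ) * Real.log ((1 + δ) / δ) + 1) *
        ∑ u, T.wt u * |(serversBelow T s' u : ℝ) - serversBelow T s u| := by
  set B := (1 + δ) * Real.log ((1 + δ) / δ) + 1 with hB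
  have hB0 : 0 ≤ B := (klTerm_nonneg hδ le_rfl le_rfl).trans
    (klTerm_le (a := 0) (b := 0) hδ le_rfl zero_le_one le_rfl zero_le_one)
  rw [← sub_le_iff_le_add', entropyDiv, entropyDiv, ← Finset.sum_sub_distrib,
    Fintype.sum_prod_type, Finset.mul_sum]
  refine Finset.sum_le_sum fun u _ => ?_
  simp only [← mul_sub]
  rw [← Finset.mul_sum, mul_left_comm]
  refine mul_le_mul_of_nonneg_left ?_ (T.wt_pos u).le
  set a := serversBelow T s' u
  set b := serversBelow T s u
  have h1 : ∀ i : Fin k, klTerm δ (integralState T k s' (u, i)) (x (u, i)) -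
      klTerm δ (integralState T k s (u, i)) (x (u, i)) ≤
      if i.val ∈ Finset.Ico (min a b) (max a b) then B else 0 := by
    intro i
    have k1 := klTerm_le hδ (integralState_nonneg T s' (u, i)) (integralState_le_one T s' (u, i))
      (hx (u, i)) (hx1 (u, i))
    have k2 := klTerm_nonneg hδ (integralState_nonneg T s (u, i)) (hx (u, i))
    split_ifs with h
    · linarith
    · have : integralState T k s' (u, i) = integralState T k s (u, i) := by
        simp only [integralState]
        change (if i.val < a then (0 : ℝ) else 1) = if i.val < b then 0 else 1
        simp only [Finset.mem_Ico, not_and_or, not_le, not_lt, lt_min_iff, max_le_iff] at h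
        by_cases h1 : i.val < a <;> by_cases h2 : i.val < b <;> simp only [h1, h2, if_true, if_false] <;> omega
      rw [this, sub_self]
  refine (Finset.sum_le_sum fun i _ => h1 i).trans ?_
  rw [← Finset.sum_filter, Finset.sum_const, nsmul_eq_mul, mul_comm]
  refine mul_le_mul_of_nonneg_left ?_ hB0
  have h2 : (Finset.univ.filter fun i : Fin k => i.val ∈ Finset.Ico (min a b) (max a b)).card ≤
      (Finset.Ico (min a b) (max a b)).card :=
    Finset.card_le_card_of_injOn (fun i => i.val) (fun i hi => by simpa using hi)
      (fun i _ j _ h => Fin.ext h)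
  rw [Nat.card_Ico] at h2
  have h3 : ((max a b - min a b : ℕ) : ℝ) = |(a : ℝ) - b| := by
    rcases le_total a b with h | h
    · rw [max_eq_right h, min_eq_left h, Nat.cast_sub h, abs_sub_comm,
        abs_of_nonneg (by simpa using h)]
    · rw [max_eq_left h, min_eq_right h, Nat.cast_sub h, abs_of_nonneg (by simpa using h)]
  rw [← h3]
  exact_mod_cast h2

end Ancestors

/-! ### A superadditive Lipschitz rounding function -/

/-- A Lipschitz function that rounds numbers slightly above an integer down to it. -/
noncomputable def roundDown (s : ℝ) : ℝ := ⌊s⌋ + max 0 (2 * (s - ⌊s⌋) - 1)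

lemma roundDown_mono : Monotone roundDown := by
  intro s t hst
  unfold roundDown
  have h1 := Int.floor_le s
  have h2 := Int.lt_floor_add_one s
  have h3 := Int.floor_le t
  have h4 := Int.lt_floor_add_one t
  rcases (Int.floor_mono hst).eq_or_lt with h | h
  · rw [← h]
    gcongr
  · have : (⌊s⌋ : ℝ) + 1 ≤ ⌊t⌋ := by exact_mod_cast h
    have h5 := le_max_left 0 (2 * (t - ⌊t⌋) - 1)
    have h6 : max 0 (2 * (s - ⌊s⌋) - 1) ≤ 1 := max_le (by norm_num) (by linarith)
    linarith

lemma roundDown_sub_le {s t : ℝ} (hst : s ≤ t) : roundDown t - roundDown s ≤ 2 * (t - s) := by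
  unfold roundDown
  have h1 := Int.floor_le s
  have h2 := Int.lt_floor_add_one s
  have h3 := Int.floor_le t
  have h4 := Int.lt_floor_add_one t
  have h5 := le_max_left 0 (2 * (s - ⌊s⌋) - 1)
  have h6 := le_max_right 0 (2 * (s - ⌊s⌋) - 1)
  rcases (Int.floor_mono hst).eq_or_lt with h | h
  · rw [← h]
    rcases max_cases 0 (2 * (t - ⌊s⌋) - 1) with h7 | h7 <;> rw [h7.1] <;> linarith
  · have : (⌊s⌋ : ℝ) + 1 ≤ ⌊t⌋ := by exact_mod_cast h
    rcases max_cases 0 (2 * (t - ⌊t⌋) - 1) with h7 | h7 <;> rw [h7.1] <;> linarith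

lemma abs_roundDown_sub_le (s t : ℝ) : |roundDown t - roundDown s| ≤ 2 * |t - s| := by
  rcases le_total s t with h | h
  · rw [abs_of_nonneg (sub_nonneg.2 (roundDown_mono h)), abs_of_nonneg (sub_nonneg.2 h)]
    exact roundDown_sub_le h
  · rw [abs_sub_comm, abs_of_nonneg (sub_nonneg.2 (roundDown_mono h)), abs_sub_comm t,
      abs_of_nonneg (sub_nonneg.2 h)]
    exact roundDown_sub_le h

/-- Superadditivity lets the count below a vertex dominate the sum of its children's counts even
after rounding, so that no vertex receives negative mass. -/
lemma roundDown_add_le (s t : ℝ) : roundDown s + roundDown t ≤ roundDown (s + t) := by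
  unfold roundDown
  have h1 := Int.floor_le s
  have h2 := Int.lt_floor_add_one s
  have h3 := Int.floor_le t
  have h4 := Int.lt_floor_add_one t
  have h5 := le_max_left 0 (2 * (s + t - ⌊s + t⌋) - 1)
  have h6 := le_max_right 0 (2 * (s + t - ⌊s + t⌋) - 1)
  rcases (Int.le_floor_add s t).eq_or_lt with h | h
  · have h' : (⌊s + t⌋ : ℝ) = ⌊s⌋ + ⌊t⌋ := by exact_mod_cast h.symm
    have h8 := Int.lt_floor_add_one (s + t)
    rw [h'] at h5 h6 h8 ⊢
    rcases max_cases 0 (2 * (s - ⌊s⌋) - 1) with h7 | h7 <;> rw [h7.1] <;>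
    rcases max_cases 0 (2 * (t - ⌊t⌋) - 1) with h9 | h9 <;> rw [h9.1] <;> linarith
  · have h' : (⌊s⌋ : ℝ) + ⌊t⌋ + 1 ≤ ⌊s + t⌋ := by exact_mod_cast h
    have h10 : (⌊s + t⌋ : ℝ) ≤ ⌊s⌋ + ⌊t⌋ + 1 := by have := Int.le_floor_add_floor s t; exact_mod_cast (by omega : ⌊s + t⌋ ≤ ⌊s⌋ + ⌊t⌋ + 1)
    rcases max_cases 0 (2 * (s - ⌊s⌋) - 1) with h7 | h7 <;> rw [h7.1] <;>
    rcases max_cases 0 (2 * (t - ⌊t⌋) - 1) with h9 | h9 <;> rw [h9.1] <;> linarith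

lemma roundDown_zero : roundDown 0 = 0 := by simp [roundDown]

lemma sum_roundDown_le {ι : Type*} (s : Finset ι) (f : ι → ℝ) :
    ∑ i ∈ s, roundDown (f i) ≤ roundDown (∑ i ∈ s, f i) := by
  classical
  induction s using Finset.induction_on with
  | empty => simp [roundDown_zero]
  | insert a s ha ih =>
    rw [Finset.sum_insert ha, Finset.sum_insert ha]
    linarith [roundDown_add_le (f a) (∑ i ∈ s, f i)]

lemma roundDown_eq_of_le {n : ℕ} {s : ℝ} (h1 : (n : ℝ) ≤ s) (h2 : s ≤ n + 1 / 2) :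
    roundDown s = n := by
  have : ⌊s⌋ = n := by
    rw [Int.floor_eq_iff]
    push_cast
    constructor <;> linarith
  rw [roundDown, this, max_eq_left]
  · simp
  · push_cast; linarith

lemma one_le_roundDown {s : ℝ} (h1 : 1 ≤ s) : 1 ≤ roundDown s := by
  have := roundDown_mono h1
  rwa [show roundDown 1 = 1 by simp [roundDown]] at this

/-! ### The mass distribution of a fractional state -/

section Mass

variable {V : Type*} [Fintype V] {k : ℕ}

/-- The (slightly scaled and rounded) number of servers below `u` in the state `x`. -/
noncomputable def roundedCount (δ : ℝ) (x : V × Fin k → ℝ) (u : V) : ℝ :=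
  roundDown ((∑ i, (1 - x (u, i))) / (1 - δ))

open Classical in
/-- The mass that stays at `u` if `Y v` is the mass below `v`. -/
noncomputable def massAt (T : ParentTree V) (Y : V → ℝ) (u : V) : ℝ :=
  Y u - ∑ c with c ≠ T.root ∧ T.par c = u, Y c

-- Summation by parts along the tree: `Y c` enters positively at `c` and negatively at its parent.
open Classical in
lemma sum_massAt_mul (T : ParentTree V) (Y g : V → ℝ) :
    ∑ u, massAt T Y u * g u =
      Y T.root * g T.root + ∑ c with c ≠ T.root, Y c * (g c - g (T.par c)) := by
  simp only [massAt, sub_mul, Finset.sum_sub_distrib, mul_sub, Finset.sum_mul]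
  have h1 : ∑ u, ∑ c with c ≠ T.root ∧ T.par c = u, Y c * g u =
      ∑ c with c ≠ T.root, Y c * g (T.par c) := by
    simp only [← Finset.filter_filter]
    rw [← Finset.sum_fiberwise (Finset.univ.filter fun c => c ≠ T.root) T.par]
    refine Finset.sum_congr rfl fun u _ => Finset.sum_congr rfl fun c hc => ?_
    rw [(Finset.mem_filter.1 hc).2]
  have h2 : ∑ u, Y u * g u = Y T.root * g T.root + ∑ c with c ≠ T.root, Y c * g c := by
    rw [← Finset.sum_filter_add_sum_filter_not Finset.univ (fun c => c = T.root)]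
    congr 1
    rw [Finset.filter_eq' Finset.univ T.root]
    simp
  rw [h1, h2]
  ring

lemma sum_massAt (T : ParentTree V) (Y : V → ℝ) : ∑ u, massAt T Y u = Y T.root := by
  have := sum_massAt_mul T Y (fun _ => 1)
  simpa using this

-- The mass of a cluster depends only on `Y` at the root and at the edges leaving or entering the
-- cluster, and an edge between different clusters affects exactly two of them.
open Classical in
lemma sum_abs_fiber_massAt_le (T : ParentTree V) {W : Type*} [Fintype W] (c : V → W)
    (Y Y' : V → ℝ) (hroot : Y T.root = Y' T.root) :
    ∑ a, |∑ v with c v = a, massAt T Y v - ∑ v with c v = a, massAt T Y' v| ≤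
      2 * ∑ v with v ≠ T.root ∧ c v ≠ c (T.par v), |Y v - Y' v| := by
  have h1 : ∀ Y : V → ℝ, ∀ a, ∑ v with c v = a, massAt T Y v =
      Y T.root * (if c T.root = a then 1 else 0) + ∑ v with v ≠ T.root, Y v *
        ((if c v = a then 1 else 0) - (if c (T.par v) = a then 1 else 0)) := by
    intro Y a
    rw [← sum_massAt_mul T Y (fun v => if c v = a then 1 else 0), Finset.sum_filter]
    simp
  have h2 : ∀ a, |∑ v with c v = a, massAt T Y v - ∑ v with c v = a, massAt T Y' v| ≤
      ∑ v with v ≠ T.root ∧ c v ≠ c (T.par v), |Y v - Y' v| *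
        ((if c v = a then 1 else 0) + (if c (T.par v) = a then 1 else 0)) := by
    intro a
    rw [h1, h1, hroot, add_sub_add_left_eq_sub, ← Finset.sum_sub_distrib, ← Finset.filter_filter,
      Finset.sum_filter (fun v => c v ≠ c (T.par v))]
    refine (Finset.abs_sum_le_sum_abs _ _).trans (Finset.sum_le_sum fun v _ => ?_)
    rw [← sub_mul, abs_mul]
    by_cases h : c v = c (T.par v)
    · simp [h]
    · rw [if_pos h]
      refine mul_le_mul_of_nonneg_left ?_ (abs_nonneg _)
      split_ifs <;> norm_num
  refine (Finset.sum_le_sum fun a _ => h2 a).trans (le_of_eq ?_)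
  rw [Finset.sum_comm, Finset.mul_sum]
  refine Finset.sum_congr rfl fun v _ => ?_
  rw [← Finset.mul_sum, Finset.sum_add_distrib]
  simp
  ring

variable {δ : ℝ} {x : V × Fin k → ℝ}

-- For `δ = 1/(4k)` one has `k ≤ k / (1 - δ) ≤ k + 1/2`, and rounding returns `k`.
omit [Fintype V] in
lemma roundedCount_root (T : ParentTree V) (hk : 1 ≤ k) (hδ : δ = 1 / (4 * k))
    (hxr : ∀ i, x (T.root, i) = 0) : roundedCount δ x T.root = k := by
  have hk' : (1 : ℝ) ≤ k := by exact_mod_cast hk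
  have h1 : δ ≤ 1 / 4 := by
    rw [hδ]; exact one_div_le_one_div_of_le (by norm_num) (by linarith)
  have h2 : δ * k = 1 / 4 := by rw [hδ]; field_simp
  have h3 : 0 < δ := by rw [hδ]; positivity
  simp only [roundedCount, hxr, sub_zero, Finset.sum_const, Finset.card_univ, Fintype.card_fin,
    nsmul_eq_mul, mul_one]
  apply roundDown_eq_of_le
  · rw [le_div_iff₀ (by linarith)]; nlinarith
  · rw [div_le_iff₀ (by linarith)]; nlinarith

-- Dividing by `1 - δ` turns the approximate service `x ≤ δ` into at least one full unit.
omit [Fintype V] in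
lemma one_le_roundedCount (hδ1 : δ < 1) (hx1 : ∀ p, x p ≤ 1) {u : V} {i₀ : Fin k}
    (h : x (u, i₀) ≤ δ) : 1 ≤ roundedCount δ x u := by
  apply one_le_roundDown
  rw [le_div_iff₀ (by linarith), one_mul]
  have : 1 - x (u, i₀) ≤ ∑ i, (1 - x (u, i)) :=
    Finset.single_le_sum (f := fun i => 1 - x (u, i)) (fun i _ => by linarith [hx1 (u, i)])
      (Finset.mem_univ _)
  linarith

/-- Superadditivity of `roundDown` reduces this to the polytope constraint for the set of all pairs
over the children of `u`. -/
lemma massAt_roundedCount_nonneg (T : ParentTree V) (hδ1 : δ < 1) (hx : x ∈ serverPolytope T k)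
    (hx1 : ∀ p, x p ≤ 1) (u : V) : 0 ≤ massAt T (roundedCount δ x) u := by
  classical
  unfold massAt
  rw [sub_nonneg]
  refine (sum_roundDown_le _ _).trans (roundDown_mono ?_)
  rw [← Finset.sum_div]
  refine div_le_div_of_nonneg_right ?_ (by linarith)
  have h := hx.2.2 u ((Finset.univ.filter fun c => c ≠ T.root ∧ T.par c = u) ×ˢ Finset.univ)
    (fun p hp => by simpa using (Finset.mem_product.1 hp).1)
  rw [Finset.sum_product] at h
  exact h.trans (Finset.sum_le_sum_of_subset_of_nonneg (Finset.filter_subset _ _)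
    fun i _ _ => by linarith [hx1 (u, i)])

lemma massAt_leaf (T : ParentTree V) (Y : V → ℝ) {r : V} (hleaf : ∀ v, v ≠ T.root → T.par v ≠ r) :
    massAt T Y r = Y r := by
  classical
  unfold massAt
  rw [Finset.filter_eq_empty_iff.2 fun v _ h => hleaf v h.1 h.2]
  simp

-- The rounding is 2-Lipschitz and the scaling contributes at most `4/3`; `8/3` is rounded up to 3.
omit [Fintype V] in
lemma abs_roundedCount_sub_le (hδ : δ ≤ 1 / 4) (x x' : V × Fin k → ℝ) (u : V) :
    |roundedCount δ x' u - roundedCount δ x u| ≤ 3 * ∑ i, |x' (u, i) - x (u, i)| := by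
  refine (abs_roundDown_sub_le _ _).trans ?_
  rw [← sub_div, ← Finset.sum_sub_distrib, abs_div, abs_of_pos (show 0 < 1 - δ by linarith)]
  have h1 : |∑ i, ((1 - x' (u, i)) - (1 - x (u, i)))| ≤ ∑ i, |x' (u, i) - x (u, i)| := by
    refine (Finset.abs_sum_le_sum_abs _ _).trans (le_of_eq (Finset.sum_congr rfl fun i _ => ?_))
    rw [abs_sub_comm]; congr 1; ring
  have h0 : (0 : ℝ) ≤ ∑ i, |x' (u, i) - x (u, i)| := Finset.sum_nonneg fun i _ => abs_nonneg _
  rw [mul_div_assoc', div_le_iff₀ (by linarith)]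
  nlinarith

variable {ι : Type*} [Fintype ι]

-- On integers up to `k`, scaling by `1 / (1 - δ)` stays in the flat part of `roundDown`, so
-- rounding restores the exact server counts.
open Classical in
lemma massAt_integralState (T : ParentTree V) (hk : 1 ≤ k) (hδ : δ = 1 / (4 * k)) (s : ι → V)
    (hs : Fintype.card ι = k) (u : V) :
    massAt T (roundedCount δ (integralState T k s)) u =
      (Finset.univ.filter fun i => s i = u).card := by
  rw [← serversBelow_sub_sum_children T s u, massAt]
  have hk' : (1 : ℝ) ≤ k := by exact_mod_cast hk
  have h1 : δ ≤ 1 / 4 := by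
    rw [hδ]; exact one_div_le_one_div_of_le (by norm_num) (by linarith)
  have h2 : δ * k = 1 / 4 := by rw [hδ]; field_simp
  have h3 : 0 < δ := by rw [hδ]; positivity
  have key : ∀ v, roundedCount δ (integralState T k s) v = serversBelow T s v := by
    intro v
    have hle : serversBelow T s v ≤ k := hs ▸ serversBelow_le T s v
    have hle' : (serversBelow T s v : ℝ) ≤ k := by exact_mod_cast hle
    have e : ∑ i : Fin k, (1 - integralState T k s (v, i)) = serversBelow T s v := by
      have e : ∀ i : Fin k, 1 - integralState T k s (v, i) =
          if i.val < serversBelow T s v then 1 else 0 := fun p => by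
        unfold integralState; split_ifs <;> norm_num
      simp only [e, Finset.sum_boole]
      rw [Fin.card_filter_val_lt, min_eq_right hle]
    rw [roundedCount, e]
    have h4 : (0 : ℝ) ≤ serversBelow T s v := Nat.cast_nonneg _
    apply roundDown_eq_of_le
    · rw [le_div_iff₀ (by linarith)]; nlinarith
    · rw [div_le_iff₀ (by linarith)]; nlinarith
  simp only [key]

end Mass

/-! ### Adjusting one random coordinate -/

/-- A random variable with values in `{⌊z⌋, ⌈z⌉}` and mean `z` is close to a random variable with
mean `z'` and values in `[⌊z'⌋, ⌈z'⌉]`. -/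
lemma exists_adjusted_coordinate {Ω : Type*} [Fintype Ω] {p : Ω → ℝ}
    (hp1 : ∑ ω, p ω = 1) {z z' : ℝ} {n : Ω → ℝ} (hn : ∀ ω, (⌊z⌋ : ℝ) ≤ n ω)
    (hn' : ∀ ω, n ω ≤ ⌈z⌉) (hnm : ∑ ω, p ω * n ω = z) :
    ∃ y : Ω → ℝ, (∀ ω, (⌊z'⌋ : ℝ) ≤ y ω ∧ y ω ≤ ⌈z'⌉) ∧ ∑ ω, p ω * y ω = z' ∧
      ∑ ω, p ω * |y ω - n ω| ≤ |z - z'| := by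
  -- A change in one direction only has expected size equal to the difference of the means.
  have up : ∀ y : Ω → ℝ, (∀ ω, n ω ≤ y ω) → ∑ ω, p ω * y ω = z' →
      ∑ ω, p ω * |y ω - n ω| ≤ |z - z'| := by
    intro y hy hm
    refine le_trans (le_of_eq ?_) ((le_abs_self (z' - z)).trans_eq (abs_sub_comm _ _))
    rw [← hm, ← hnm, ← Finset.sum_sub_distrib]
    exact Finset.sum_congr rfl fun ω _ => by rw [abs_of_nonneg (sub_nonneg.2 (hy ω)), mul_sub]
  have down : ∀ y : Ω → ℝ, (∀ ω, y ω ≤ n ω) → ∑ ω, p ω * y ω = z' →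
      ∑ ω, p ω * |y ω - n ω| ≤ |z - z'| := by
    intro y hy hm
    refine le_trans (le_of_eq ?_) (le_abs_self (z - z'))
    rw [← hm, ← hnm, ← Finset.sum_sub_distrib]
    exact Finset.sum_congr rfl fun ω _ => by
      rw [abs_of_nonpos (sub_nonpos.2 (hy ω)), neg_sub, mul_sub]
  have hconst : ∑ ω, p ω * z' = z' := by rw [← Finset.sum_mul, hp1, one_mul]
  -- If `z'` lies beyond the box of `z`, the constant `z'` is already a one-directional change.
  -- Otherwise the box of `z` is contained in that of `z'`.
  rcases le_or_gt (⌈z⌉ : ℝ) z' with h1 | h1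
  · exact ⟨fun _ => z', fun _ => ⟨Int.floor_le _, Int.le_ceil _⟩, hconst,
      up _ (fun ω => (hn' ω).trans h1) hconst⟩
  rcases le_or_gt z' (⌊z⌋ : ℝ) with h2 | h2
  · exact ⟨fun _ => z', fun _ => ⟨Int.floor_le _, Int.le_ceil _⟩, hconst,
      down _ (fun ω => h2.trans (hn ω)) hconst⟩
  have hzc : ⌈z⌉ ≤ ⌊z⌋ + 1 := Int.ceil_le_floor_add_one z
  have hzc' : (⌈z⌉ : ℝ) ≤ ⌊z⌋ + 1 := by exact_mod_cast hzc
  have hf : (⌊z'⌋ : ℝ) ≤ ⌊z⌋ := by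
    have : ⌊z'⌋ < ⌈z⌉ := Int.floor_lt.2 h1
    exact_mod_cast (by omega : ⌊z'⌋ ≤ ⌊z⌋)
  have hc : (⌈z⌉ : ℝ) ≤ ⌈z'⌉ := by
    have : ⌊z⌋ < ⌈z'⌉ := Int.lt_ceil.2 h2
    exact_mod_cast (by omega : ⌈z⌉ ≤ ⌈z'⌉)
  rcases le_total z z' with h | h
  -- Every value is moved towards `⌈z⌉` by the same fraction, chosen to give the mean `z'`.
  · set l := (z' - z) / (⌈z⌉ - z) with hl
    have hd : 0 < ⌈z⌉ - z := by linarith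
    have hl0 : 0 ≤ l := div_nonneg (by linarith) hd.le
    have hl1 : l ≤ 1 := by rw [hl, div_le_one hd]; linarith
    have hld : l * (⌈z⌉ - z) = z' - z := by rw [hl]; field_simp
    have hm : ∑ ω, p ω * (n ω + l * (⌈z⌉ - n ω)) = z' := by
      have e : ∀ ω, p ω * (n ω + l * (⌈z⌉ - n ω)) =
        (1 - l) * (p ω * n ω) + p ω * (l * ⌈z⌉) := fun ω => by ring
      rw [Finset.sum_congr rfl fun ω _ => e ω, Finset.sum_add_distrib, ← Finset.mul_sum,
        ← Finset.sum_mul, hp1, hnm]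
      linarith
    have hge : ∀ ω, n ω ≤ n ω + l * (⌈z⌉ - n ω) := fun ω => by
      have := mul_nonneg hl0 (sub_nonneg.2 (hn' ω)); linarith
    refine ⟨_, fun ω => ⟨(hf.trans (hn ω)).trans (hge ω), ?_⟩, hm, up _ hge hm⟩
    have := mul_le_mul_of_nonneg_right hl1 (sub_nonneg.2 (hn' ω))
    linarith
  · set l := (z - z') / (z - ⌊z⌋) with hl
    have hd : 0 < z - ⌊z⌋ := by linarith
    have hl0 : 0 ≤ l := div_nonneg (by linarith) hd.le
    have hl1 : l ≤ 1 := by rw [hl, div_le_one hd]; linarith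
    have hld : l * (z - ⌊z⌋) = z - z' := by rw [hl]; field_simp
    have hm : ∑ ω, p ω * (n ω - l * (n ω - ⌊z⌋)) = z' := by
      have e : ∀ ω, p ω * (n ω - l * (n ω - ⌊z⌋)) =
        (1 - l) * (p ω * n ω) + p ω * (l * ⌊z⌋) := fun ω => by ring
      rw [Finset.sum_congr rfl fun ω _ => e ω, Finset.sum_add_distrib, ← Finset.mul_sum,
        ← Finset.sum_mul, hp1, hnm]
      linarith
    have hge : ∀ ω, n ω - l * (n ω - ⌊z⌋) ≤ n ω := fun ω => by
      have := mul_nonneg hl0 (sub_nonneg.2 (hn ω)); linarith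
    refine ⟨_, fun ω => ⟨?_, ((hge ω).trans (hn' ω)).trans hc⟩, hm, down _ hge hm⟩
    have := mul_le_mul_of_nonneg_right hl1 (sub_nonneg.2 (hn ω))
    linarith

/-! ### Correcting the sums of random vectors -/

open Classical in
/-- Random vectors `q` in an integral box can be changed, without changing the mean of any
coordinate, so that the sums over the fibers of `g` become prescribed random variables `R`.
The expected change is at most the expected discrepancy of the sums. -/
lemma exists_fiber_sum_correction {Ω ι B : Type*} [Fintype Ω] [Fintype ι] [Fintype B] {p : Ω → ℝ}
    (hp : ∀ ω, 0 < p ω) (g : ι → B) {lo hi : ι → ℤ} {q : Ω → ι → ℝ}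
    (hq : ∀ ω a, (lo a : ℝ) ≤ q ω a ∧ q ω a ≤ hi a) {R : Ω → B → ℝ} {L U : B → ℤ}
    (hLU : ∀ b, U b ≤ L b + 1) (hR : ∀ ω b, (L b : ℝ) ≤ R ω b ∧ R ω b ≤ U b)
    (hmean : ∀ b, ∑ ω, p ω * ∑ a with g a = b, q ω a = ∑ ω, p ω * R ω b) :
    ∃ m : Ω → ι → ℝ, (∀ ω a, (lo a : ℝ) ≤ m ω a ∧ m ω a ≤ hi a) ∧
      (∀ a, ∑ ω, p ω * m ω a = ∑ ω, p ω * q ω a) ∧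
      (∀ ω b, ∑ a with g a = b, m ω a = R ω b) ∧
      ∑ ω, p ω * ∑ a, |m ω a - q ω a| ≤ ∑ ω, p ω * ∑ b, |∑ a with g a = b, q ω a - R ω b| := by
  set Dq : ℝ := ∑ ω, p ω * ∑ b, |∑ a with g a = b, q ω a - R ω b| with hDq
  set D : (Ω → ι → ℝ) → ℝ := fun m => ∑ ω, p ω * ∑ b, |∑ a with g a = b, m ω a - R ω b| with hD
  -- Among the candidates whose change plus remaining discrepancy is within the budget `Dq`, one of
  -- least discrepancy is taken. It is shown to be zero, and then the whole budget bounds the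
  -- change.
  set K : Set (Ω → ι → ℝ) := {m | (∀ ω a, (lo a : ℝ) ≤ m ω a ∧ m ω a ≤ hi a) ∧
      (∀ a, ∑ ω, p ω * m ω a = ∑ ω, p ω * q ω a) ∧
      ∑ ω, p ω * ∑ a, |m ω a - q ω a| + D m ≤ Dq} with hK
  have hDc : Continuous D := by simp only [hD]; fun_prop
  have hKc : IsCompact K := by
    refine IsCompact.of_isClosed_subset (isCompact_Icc (a := fun (_ : Ω) a => (lo a : ℝ))
      (b := fun (_ : Ω) a => (hi a : ℝ))) ?_ ?_
    · simp only [hK, Set.ofPred_and, Set.ofPred_forall]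
      refine IsClosed.inter (isClosed_iInter fun ω => isClosed_iInter fun a =>
        IsClosed.inter (isClosed_le (by fun_prop) (by fun_prop))
          (isClosed_le (by fun_prop) (by fun_prop)))
        (IsClosed.inter (isClosed_iInter fun a => isClosed_eq (by fun_prop) (by fun_prop))
          (isClosed_le (by fun_prop) (by fun_prop)))
    · intro m hm
      exact ⟨fun ω a => (hm.1 ω a).1, fun ω a => (hm.1 ω a).2⟩
  obtain ⟨m, hm, hmin⟩ := hKc.exists_isMinOn (f := D) ⟨q, hq, fun _ => rfl, by simp [hDq, hD]⟩
    hDc.continuousOn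
  have hmm : ∀ b, ∑ ω, p ω * (∑ a with g a = b, m ω a - R ω b) = 0 := by
    intro b
    simp only [mul_sub, Finset.sum_sub_distrib]
    rw [← hmean b, sub_eq_zero]
    simp only [Finset.mul_sum]
    rw [Finset.sum_comm, Finset.sum_comm (s := Finset.univ) (t := Finset.univ.filter _)]
    exact Finset.sum_congr rfl fun a _ => hm.2.1 a
  have hsum : ∀ ω b, ∑ a with g a = b, m ω a = R ω b := by
    by_contra! hne
    obtain ⟨ω₀, b, hb⟩ := hne
    have hne' : ∃ ω, p ω * (∑ a with g a = b, m ω a - R ω b) ≠ 0 :=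
      ⟨ω₀, mul_ne_zero (hp _).ne' (sub_ne_zero.2 hb)⟩
    obtain ⟨ω₁, h1⟩ : ∃ ω, ∑ a with g a = b, m ω a < R ω b := by
      by_contra! hcon
      obtain ⟨ω, hω⟩ := hne'
      exact hω ((Finset.sum_eq_zero_iff_of_nonneg fun ω _ =>
        mul_nonneg (hp ω).le (sub_nonneg.2 (hcon ω))).1 (hmm b) ω (Finset.mem_univ _))
    obtain ⟨ω₂, h2⟩ : ∃ ω, R ω b < ∑ a with g a = b, m ω a := by
      by_contra! hcon
      obtain ⟨ω, hω⟩ := hne'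
      exact hω ((Finset.sum_eq_zero_iff_of_nonpos fun ω _ =>
        mul_nonpos_of_nonneg_of_nonpos (hp ω).le (sub_nonpos.2 (hcon ω))).1 (hmm b) ω
          (Finset.mem_univ _))
    have h12 : ω₁ ≠ ω₂ := by rintro rfl; linarith
    -- Equal means give an outcome `ω₁` with too small a sum and `ω₂` with too large a sum. If no
    -- coordinate could be raised at `ω₁` and lowered at `ω₂`, the integer `N` would separate the
    -- two sums. It would then lie strictly between `L b` and `U b`, which differ by at most 1.
    obtain ⟨a, hab, ha1, ha2⟩ : ∃ a, g a = b ∧ m ω₁ a < hi a ∧ lo a < m ω₂ a := by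
      by_contra! hcon
      set N : ℤ := ∑ a with g a = b, if (lo a : ℝ) < m ω₂ a then hi a else lo a with hN
      have n1 : (N : ℝ) ≤ ∑ a with g a = b, m ω₁ a := by
        rw [hN, Int.cast_sum]
        refine Finset.sum_le_sum fun a ha => ?_
        split_ifs with h
        · by_contra! hlt
          exact absurd h (not_lt.2 (hcon a (Finset.mem_filter.1 ha).2 hlt))
        · exact (hm.1 ω₁ a).1
      have n2 : ∑ a with g a = b, m ω₂ a ≤ (N : ℝ) := by
        rw [hN, Int.cast_sum]
        refine Finset.sum_le_sum fun a ha => ?_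
        split_ifs with h
        · exact (hm.1 ω₂ a).2
        · exact not_lt.1 h
      have n3 : (N : ℝ) < U b := by linarith [(hR ω₁ b).2]
      have n4 : (L b : ℝ) < N := by linarith [(hR ω₂ b).1]
      have n5 : N < U b := by exact_mod_cast n3
      have n6 : L b < N := by exact_mod_cast n4
      have := hLU b
      omega
    obtain ⟨ε, hε, e1, e2, e3, e4⟩ : ∃ ε : ℝ, 0 < ε ∧ ε / p ω₁ ≤ hi a - m ω₁ a ∧
        ε / p ω₂ ≤ m ω₂ a - lo a ∧ ε / p ω₁ ≤ R ω₁ b - ∑ a with g a = b, m ω₁ a ∧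
        ε / p ω₂ ≤ ∑ a with g a = b, m ω₂ a - R ω₂ b := by
      have p1 := hp ω₁
      have p2 := hp ω₂
      refine ⟨min (min ((hi a - m ω₁ a) * p ω₁) ((m ω₂ a - lo a) * p ω₂))
        (min ((R ω₁ b - ∑ a with g a = b, m ω₁ a) * p ω₁)
          ((∑ a with g a = b, m ω₂ a - R ω₂ b) * p ω₂)), ?_, ?_, ?_, ?_, ?_⟩
      · refine lt_min (lt_min ?_ ?_) (lt_min ?_ ?_) <;> apply mul_pos <;>
          first | assumption | linarith
      · rw [div_le_iff₀ p1]; exact (min_le_left _ _).trans (min_le_left _ _)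
      · rw [div_le_iff₀ p2]; exact (min_le_left _ _).trans (min_le_right _ _)
      · rw [div_le_iff₀ p1]; exact (min_le_right _ _).trans (min_le_left _ _)
      · rw [div_le_iff₀ p2]; exact (min_le_right _ _).trans (min_le_right _ _)
    set s : Ω → ℝ := fun ω => if ω = ω₁ then ε / p ω₁ else if ω = ω₂ then -(ε / p ω₂) else 0 with hs
    have hs1 : s ω₁ = ε / p ω₁ := by simp [hs]
    have hs2 : s ω₂ = -(ε / p ω₂) := by simp [hs, h12.symm]
    have hs3 : ∀ ω, ω ≠ ω₁ → ω ≠ ω₂ → s ω = 0 := fun ω h h' => by simp [hs, h, h']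
    have hps : ∀ f : ℝ → ℝ, f 0 = 0 → ∑ ω, p ω * f (s ω) =
        p ω₁ * f (ε / p ω₁) + p ω₂ * f (-(ε / p ω₂)) := by
      intro f hf
      rw [Fintype.sum_eq_add ω₁ ω₂ h12, hs1, hs2]
      rintro ω ⟨h, h'⟩
      rw [hs3 ω h h', hf, mul_zero]
    have hε1 : 0 < ε / p ω₁ := div_pos hε (hp _)
    have hε2 : 0 < ε / p ω₂ := div_pos hε (hp _)
    -- A transfer between two outcomes that preserves the mean of coordinate `a`. It lowers the
    -- discrepancy by `2 * ε` and adds at most `2 * ε` to the change, so it stays in `K` and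
    -- contradicts minimality.
    set m' : Ω → ι → ℝ := fun ω a' => m ω a' + if a' = a then s ω else 0 with hm'
    have hm's : ∀ ω b', ∑ a' with g a' = b', m' ω a' =
        ∑ a' with g a' = b', m ω a' + if b' = b then s ω else 0 := by
      intro ω b'
      simp only [hm', Finset.sum_add_distrib]
      congr 1
      rw [Finset.sum_ite_eq']
      simp only [Finset.mem_filter, Finset.mem_univ, true_and, hab]
      exact if_congr eq_comm rfl rfl
    have hDm' : D m' = D m - 2 * ε := by
      have : ∀ ω, ∑ b', |∑ a' with g a' = b', m' ω a' - R ω b'| =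
          ∑ b', |∑ a' with g a' = b', m ω a' - R ω b'| - |s ω| := by
        intro ω
        rw [eq_sub_iff_add_eq, ← Fintype.sum_ite_eq' b (fun _ => |s ω|), ← Finset.sum_add_distrib]
        refine Finset.sum_congr rfl fun b' _ => ?_
        rw [hm's]
        split_ifs with h
        · subst h
          by_cases hω : ω = ω₁
          · subst hω
            rw [hs1, abs_of_pos hε1, abs_of_nonpos (by linarith), abs_of_nonpos (by linarith)]
            ring
          · by_cases hω' : ω = ω₂
            · subst hω'
              rw [hs2, abs_neg, abs_of_pos hε2, abs_of_nonneg (by linarith),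
                abs_of_nonneg (by linarith)]
              ring
            · rw [hs3 ω hω hω']; simp
        · simp
      simp only [hD, this, mul_sub, Finset.sum_sub_distrib]
      rw [hps (fun t => |t|) (by simp), abs_neg, abs_of_pos hε1, abs_of_pos hε2,
        mul_div_cancel₀ _ (hp _).ne', mul_div_cancel₀ _ (hp _).ne']
      ring
    have hm'K : m' ∈ K := by
      refine ⟨fun ω a' => ?_, fun a' => ?_, ?_⟩
      · have hb := hm.1 ω a'
        simp only [hm']
        split_ifs with h
        · subst h
          by_cases hω : ω = ω₁
          · subst hω
            rw [hs1]; constructor <;> linarith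
          · by_cases hω' : ω = ω₂
            · subst hω'
              rw [hs2]; constructor <;> linarith
            · rw [hs3 ω hω hω', add_zero]; exact hb
        · rw [add_zero]; exact hb
      · rw [← hm.2.1 a']
        simp only [hm', mul_add, Finset.sum_add_distrib]
        split_ifs with h
        · rw [hps (fun t => t) rfl, mul_neg, mul_div_cancel₀ _ (hp _).ne',
            mul_div_cancel₀ _ (hp _).ne']
          ring
        · simp
      · have h3 : ∑ ω, p ω * ∑ a', |m' ω a' - q ω a'| ≤
            ∑ ω, p ω * ∑ a', |m ω a' - q ω a'| + 2 * ε := by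
          have : ∀ ω, ∑ a', |m' ω a' - q ω a'| ≤ ∑ a', |m ω a' - q ω a'| + |s ω| := by
            intro ω
            rw [← Fintype.sum_ite_eq' a (fun _ => |s ω|), ← Finset.sum_add_distrib]
            refine Finset.sum_le_sum fun a' _ => ?_
            simp only [hm']
            split_ifs with h
            · rw [add_sub_right_comm]; exact abs_add_le _ _
            · simp
          refine (Finset.sum_le_sum fun ω _ => mul_le_mul_of_nonneg_left (this ω) (hp ω).le).trans
            (le_of_eq ?_)
          simp only [mul_add, Finset.sum_add_distrib]
          rw [hps (fun t => |t|) (by simp), abs_neg, abs_of_pos hε1, abs_of_pos hε2,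
            mul_div_cancel₀ _ (hp _).ne', mul_div_cancel₀ _ (hp _).ne']
          ring
        rw [hDm']
        linarith [hm.2.2]
    have h4 : D m ≤ D m' := hmin hm'K
    rw [hDm'] at h4
    linarith
  refine ⟨m, hm.1, hm.2.1, hsum, ?_⟩
  have h5 : D m = 0 := by simp [hD, hsum]
  have := hm.2.2
  rw [h5, add_zero] at this
  exact this

/-! ### Hierarchical partitions -/

/-- A hierarchy of partitions of `Y`: `c j` maps each point to a representative of its cluster at
level `j`; the clusters at level `0` are the single points, and there is only one cluster at
level `J`. -/
structure Hierarchy (Y : Type*) where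
  c : ℕ → Y → Y
  J : ℕ
  top : Y
  c_zero : ∀ y, c 0 y = y
  c_comp : ∀ i j, i ≤ j → ∀ y, c j (c i y) = c j y
  c_top : ∀ y, c J y = top

section Hierarchy

variable {Y : Type*} [Fintype Y]

open Classical in
/-- The total mass of the clusters at level `j`, indexed by their representatives. -/
noncomputable def Hierarchy.lev (h : Hierarchy Y) (j : ℕ) (f : Y → ℝ) (a : Y) : ℝ :=
  ∑ y with h.c j y = a, f y

lemma Hierarchy.lev_zero (h : Hierarchy Y) (f : Y → ℝ) : h.lev 0 f = f := by
  classical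
  funext a
  simp [Hierarchy.lev, h.c_zero, Finset.sum_filter]

lemma Hierarchy.lev_lev (h : Hierarchy Y) {i j : ℕ} (hij : i ≤ j) (f : Y → ℝ) :
    h.lev j (h.lev i f) = h.lev j f := by
  classical
  funext a
  simp only [Hierarchy.lev]
  rw [Finset.sum_comm' (t' := Finset.univ.filter fun y => h.c j y = a) (s' := fun y => {h.c i y})]
  · simp
  · intro b y
    simp only [Finset.mem_filter, Finset.mem_univ, true_and, Finset.mem_singleton]
    constructor
    · rintro ⟨h1, rfl⟩
      exact ⟨rfl, by rw [← h1, h.c_comp i j hij]⟩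
    · rintro ⟨rfl, h1⟩
      exact ⟨by rw [h.c_comp i j hij, h1], rfl⟩

lemma Hierarchy.lev_eq_zero (h : Hierarchy Y) {j : ℕ} {a : Y} (ha : h.c j a ≠ a) (f : Y → ℝ) :
    h.lev j f a = 0 := by
  classical
  unfold Hierarchy.lev
  rw [Finset.filter_eq_empty_iff.2, Finset.sum_empty]
  rintro y - rfl
  exact ha (h.c_comp j j le_rfl y)

open Classical in
lemma Hierarchy.lev_top (h : Hierarchy Y) (f : Y → ℝ) (a : Y) :
    h.lev h.J f a = if a = h.top then ∑ y, f y else 0 := by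
  unfold Hierarchy.lev
  simp only [h.c_top]
  split_ifs with h1
  · simp [h1]
  · rw [Finset.filter_eq_empty_iff.2, Finset.sum_empty]
    intro y _ h2
    exact h1 h2.symm

lemma Hierarchy.lev_add (h : Hierarchy Y) (j : ℕ) (f g : Y → ℝ) (a : Y) :
    h.lev j (f + g) a = h.lev j f a + h.lev j g a := by
  simp [Hierarchy.lev, Finset.sum_add_distrib]

lemma Hierarchy.lev_smul (h : Hierarchy Y) (j : ℕ) (t : ℝ) (f : Y → ℝ) (a : Y) :
    h.lev j (t • f) a = t * h.lev j f a := by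
  simp [Hierarchy.lev, Finset.mul_sum]

lemma Hierarchy.continuous_lev (h : Hierarchy Y) (j : ℕ) (a : Y) :
    Continuous fun f : Y → ℝ => h.lev j f a := by
  unfold Hierarchy.lev; fun_prop

lemma Hierarchy.sum_mul_lev (h : Hierarchy Y) {Ω : Type*} [Fintype Ω] (p : Ω → ℝ)
    (n : Ω → Y → ℝ) (j : ℕ) (a : Y) :
    ∑ ω, p ω * h.lev j (n ω) a = h.lev j (fun y => ∑ ω, p ω * n ω y) a := by
  unfold Hierarchy.lev
  simp only [Finset.mul_sum]
  rw [Finset.sum_comm]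

/-- `f` lies, on each level, in the integral box around `z`. -/
def Hierarchy.Near (h : Hierarchy Y) (z f : Y → ℝ) : Prop :=
  ∀ j ≤ h.J, ∀ a, (⌊h.lev j z a⌋ : ℝ) ≤ h.lev j f a ∧ h.lev j f a ≤ ⌈h.lev j z a⌉

/-! ### The fractional part of the rounding step -/

/-- From a balanced random integral vector for `z` one can pass to a random fractional vector for
`z'` such that the expected error on each level is controlled. -/
lemma Hierarchy.exists_fractional_update (h : Hierarchy Y) {Ω : Type*} [Fintype Ω] {p : Ω → ℝ}
    (hp : ∀ ω, 0 < p ω) (hp1 : ∑ ω, p ω = 1) {z z' : Y → ℝ} {K : ℤ} (hz' : ∑ y, z' y = K)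
    {n : Ω → Y → ℝ} (hn : ∀ ω, h.Near z (n ω)) (hnm : ∀ y, ∑ ω, p ω * n ω y = z y)
    (hnK : ∀ ω, ∑ y, n ω y = K) :
    ∃ m : Ω → Y → ℝ, (∀ ω, h.Near z' (m ω)) ∧ (∀ y, ∑ ω, p ω * m ω y = z' y) ∧
      (∀ y, ∑ ω, p ω * |h.lev h.J (n ω) y - h.lev h.J (m ω) y| = 0) ∧
      ∀ j < h.J, ∑ ω, p ω * ∑ a, |h.lev j (n ω) a - h.lev j (m ω) a| ≤
        ∑ ω, p ω * ∑ a, |h.lev (j + 1) (n ω) a - h.lev (j + 1) (m ω) a| +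
          2 * ∑ a, |h.lev j z a - h.lev j z' a| := by
  classical
  -- Levels are treated from the top downwards; `i` counts those done. A vector that is correct at
  -- level `j` is extended to lower levels without altering its sums at higher ones.
  suffices H : ∀ i ≤ h.J, ∃ m : Ω → Y → ℝ,
      (∀ ω, ∀ j ≤ h.J, h.J - i ≤ j → ∀ a,
        (⌊h.lev j z' a⌋ : ℝ) ≤ h.lev j (m ω) a ∧ h.lev j (m ω) a ≤ ⌈h.lev j z' a⌉) ∧
      (∀ j ≤ h.J, h.J - i ≤ j → ∀ a, ∑ ω, p ω * h.lev j (m ω) a = h.lev j z' a) ∧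
      (∀ y, ∑ ω, p ω * |h.lev h.J (n ω) y - h.lev h.J (m ω) y| = 0) ∧
      ∀ j < h.J, h.J - i ≤ j → ∑ ω, p ω * ∑ a, |h.lev j (n ω) a - h.lev j (m ω) a| ≤
        ∑ ω, p ω * ∑ a, |h.lev (j + 1) (n ω) a - h.lev (j + 1) (m ω) a| +
          2 * ∑ a, |h.lev j z a - h.lev j z' a| by
    obtain ⟨m, h1, h2, h3, h4⟩ := H h.J le_rfl
    refine ⟨m, fun ω j hj a => h1 ω j hj (by omega) a, fun y => ?_, h3,
      fun j hj => h4 j hj (by omega)⟩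
    have := h2 0 (Nat.zero_le _) (by omega) y
    simpa only [h.lev_zero] using this
  intro i
  induction i with
  | zero =>
    intro _
    have e : ∀ y, h.lev h.J z' y = if y = h.top then (K : ℝ) else 0 := fun y => by
      rw [h.lev_top, hz']
    have e2 : ∀ ω y, h.lev h.J (n ω) y = if y = h.top then (K : ℝ) else 0 := fun ω y => by
      rw [h.lev_top, hnK]
    refine ⟨fun _ => z', fun ω j hj hj' a => ?_, fun j hj hj' a => ?_, fun y => ?_, fun j hj hj' => ?_⟩
    · exact ⟨Int.floor_le _, Int.le_ceil _⟩
    · rw [← Finset.sum_mul, hp1, one_mul]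
    · simp [e, e2]
    · omega
  | succ i ih =>
    intro hi
    obtain ⟨m, h1, h2, h3, h4⟩ := ih (by omega)
    set j := h.J - (i + 1) with hj
    have hj1 : h.J - i = j + 1 := by omega
    have hjJ : j + 1 ≤ h.J := by omega
    rw [hj1] at h1 h2 h4
    have hnj : ∀ a, ∑ ω, p ω * h.lev j (n ω) a = h.lev j z a := fun a => by
      rw [h.sum_mul_lev]; simp only [hnm]
    -- Each cluster of level `j` is adjusted separately. Its sums within parent clusters need not
    -- match level `j + 1` yet; that is repaired by the fiber correction.
    choose y hy1 hy2 hy3 using fun a => exists_adjusted_coordinate (z' := h.lev j z' a) hp1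
      (fun ω => (hn ω j (by omega) a).1) (fun ω => (hn ω j (by omega) a).2) (hnj a)
    have hfib : ∀ f : Y → ℝ, ∀ b, ∑ a with h.c (j + 1) a = b, h.lev j f a = h.lev (j + 1) f b :=
      fun f b => congrFun (h.lev_lev (Nat.le_succ j) f) b
    obtain ⟨w, w1, w2, w3, w4⟩ := exists_fiber_sum_correction hp (h.c (j + 1))
      (lo := fun a => ⌊h.lev j z' a⌋) (hi := fun a => ⌈h.lev j z' a⌉) (q := fun ω a => y a ω)
      (fun ω a => hy1 a ω) (R := fun ω b => h.lev (j + 1) (m ω) b)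
      (L := fun b => ⌊h.lev (j + 1) z' b⌋) (U := fun b => ⌈h.lev (j + 1) z' b⌉)
      (fun b => Int.ceil_le_floor_add_one _) (fun ω b => h1 ω (j + 1) hjJ le_rfl b) (fun b => by
        rw [h2 (j + 1) hjJ le_rfl b]
        simp only [Finset.mul_sum]
        rw [Finset.sum_comm, ← hfib]
        exact Finset.sum_congr rfl fun a _ => hy2 a)
    -- At a point that does not represent a cluster of level `j`, the box is `[0, 0]`, so `w`
    -- vanishes there and can be read as a vector on points.
    have hwj : ∀ ω, h.lev j (w ω) = w ω := by
      intro ω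
      funext a
      have hz : ∀ b, h.c j b ≠ b → w ω b = 0 := by
        intro b hb
        have := w1 ω b
        rw [h.lev_eq_zero hb] at this
        simp only [Int.floor_zero, Int.ceil_zero, Int.cast_zero] at this
        exact le_antisymm this.2 this.1
      by_cases ha : h.c j a = a
      · unfold Hierarchy.lev
        rw [Finset.sum_eq_single a]
        · intro b hb hba
          apply hz
          rw [(Finset.mem_filter.1 hb).2]
          exact hba.symm
        · intro h5
          exact (h5 (by simp [ha])).elim
      · rw [h.lev_eq_zero ha, hz a ha]
    have hwl : ∀ ω l, j + 1 ≤ l → h.lev l (w ω) = h.lev l (m ω) := by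
      intro ω l hl
      rw [← h.lev_lev hl (w ω), ← h.lev_lev hl (m ω)]
      congr 1
      funext b
      exact w3 ω b
    refine ⟨w, fun ω l hl hl' a => ?_, fun l hl hl' a => ?_, fun y => ?_, fun l hl hl' => ?_⟩
    · rcases hl'.eq_or_lt with h5 | h5
      · rw [← h5, hwj]; exact w1 ω a
      · rw [hwl ω l h5]; exact h1 ω l hl h5 a
    · rcases hl'.eq_or_lt with h5 | h5
      · simp only [← h5, hwj]; rw [w2, hy2]
      · simp only [hwl _ l h5]; exact h2 l hl h5 a
    · simp only [hwl _ h.J hjJ]; exact h3 y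
    · rcases hl'.eq_or_lt with h5 | h5
      · subst h5
        simp only [hwj, hwl _ (j + 1) le_rfl]
        have b1 : ∀ ω, ∑ a, |h.lev j (n ω) a - w ω a| ≤
            ∑ a, |y a ω - h.lev j (n ω) a| + ∑ a, |w ω a - y a ω| := by
          intro ω
          rw [← Finset.sum_add_distrib]
          refine Finset.sum_le_sum fun a _ => ?_
          rw [abs_sub_comm (y a ω), abs_sub_comm (w ω a)]
          exact abs_sub_le _ _ _
        -- The discrepancy comes from the adjustment at level `j` and the inherited error at level
        -- `j + 1`. As the adjustment itself also counts, the term `d j` occurs twice.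
        have b2 : ∀ ω, ∑ b, |∑ a with h.c (j + 1) a = b, y a ω - h.lev (j + 1) (m ω) b| ≤
            ∑ a, |y a ω - h.lev j (n ω) a| +
              ∑ b, |h.lev (j + 1) (n ω) b - h.lev (j + 1) (m ω) b| := by
          intro ω
          rw [← Finset.sum_fiberwise Finset.univ (h.c (j + 1)) (fun a => |y a ω - h.lev j (n ω) a|), ← Finset.sum_add_distrib]
          refine Finset.sum_le_sum fun b _ => (abs_sub_le _ (h.lev (j + 1) (n ω) b) _).trans ?_
          rw [← hfib, ← Finset.sum_sub_distrib]
          gcongr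
          exact Finset.abs_sum_le_sum_abs _ _
        have b3 : ∑ ω, p ω * ∑ a, |y a ω - h.lev j (n ω) a| ≤
            ∑ a, |h.lev j z a - h.lev j z' a| := by
          simp only [Finset.mul_sum]
          rw [Finset.sum_comm]
          exact Finset.sum_le_sum fun a _ => hy3 a
        have b4 : ∑ ω, p ω * ∑ a, |h.lev j (n ω) a - w ω a| ≤
            ∑ ω, p ω * ∑ a, |y a ω - h.lev j (n ω) a| + ∑ ω, p ω * ∑ a, |w ω a - y a ω| := by
          rw [← Finset.sum_add_distrib]
          refine Finset.sum_le_sum fun ω _ => ?_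
          rw [← mul_add]
          exact mul_le_mul_of_nonneg_left (b1 ω) (hp ω).le
        have b5 : ∑ ω, p ω * ∑ b, |∑ a with h.c (j + 1) a = b, y a ω - h.lev (j + 1) (m ω) b| ≤
            ∑ ω, p ω * ∑ a, |y a ω - h.lev j (n ω) a| +
              ∑ ω, p ω * ∑ b, |h.lev (j + 1) (n ω) b - h.lev (j + 1) (m ω) b| := by
          rw [← Finset.sum_add_distrib]
          refine Finset.sum_le_sum fun ω _ => ?_
          rw [← mul_add]
          exact mul_le_mul_of_nonneg_left (b2 ω) (hp ω).le
        linarith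
      · simp only [hwl _ l h5, hwl _ (l + 1) (by omega : j + 1 ≤ l + 1)]
        exact h4 l hl h5

/-! ### Integral points of the boxes -/

/-- A sum of integers is an integer, so a cluster of fractional mass has a subcluster of fractional
mass, down to a single point. -/
lemma Hierarchy.exists_fractional_point (h : Hierarchy Y) {g : Y → ℝ} (j : ℕ) :
    ∀ a, (∀ n : ℤ, h.lev j g a ≠ n) →
      ∃ y, h.c j y = a ∧ ∀ i ≤ j, ∀ n : ℤ, h.lev i g (h.c i y) ≠ n := by
  classical
  induction j with
  | zero =>
    intro a ha
    refine ⟨a, h.c_zero a, fun i hi => ?_⟩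
    obtain rfl : i = 0 := by omega
    rw [h.c_zero]; exact ha
  | succ j ih =>
    intro a ha
    have e : h.lev (j + 1) g a = ∑ b with h.c (j + 1) b = a, h.lev j g b :=
      (congrFun (h.lev_lev (Nat.le_succ j) g) a).symm
    obtain ⟨b, hb, hb'⟩ : ∃ b, h.c (j + 1) b = a ∧ ∀ n : ℤ, h.lev j g b ≠ n := by
      by_contra! hcon
      choose! n hn using hcon
      apply ha (∑ b with h.c (j + 1) b = a, n b)
      rw [e, Int.cast_sum]
      exact Finset.sum_congr rfl fun b hb => hn b (Finset.mem_filter.1 hb).2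
    obtain ⟨y, hy, hy'⟩ := ih b hb'
    have hya : h.c (j + 1) y = a := by rw [← hb, ← hy, h.c_comp j (j + 1) (Nat.le_succ j)]
    refine ⟨y, hya, fun i hi => ?_⟩
    rcases hi.eq_or_lt with h1 | h1
    · rw [h1, hya]; exact ha
    · exact hy' i (by omega)

/-- On the highest level with a fractional cluster, the parent has integral mass, so a second child
is fractional as well. Descending from both gives two points such that every cluster separating them
is fractional; mass can be exchanged between them in both directions. -/
lemma Hierarchy.exists_fractional_pair (h : Hierarchy Y) {g : Y → ℝ}
    (htop : ∀ a, ∃ n : ℤ, h.lev h.J g a = n) (hg : ∃ j ≤ h.J, ∃ a, ∀ n : ℤ, h.lev j g a ≠ n) :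
    ∃ x y, x ≠ y ∧ ∀ i ≤ h.J, h.c i x ≠ h.c i y →
      (∀ n : ℤ, h.lev i g (h.c i x) ≠ n) ∧ ∀ n : ℤ, h.lev i g (h.c i y) ≠ n := by
  classical
  obtain ⟨j, ⟨hjJ, a, ha⟩, hmax⟩ : ∃ j, (j ≤ h.J ∧ ∃ a, ∀ n : ℤ, h.lev j g a ≠ n) ∧
      ∀ i ≤ h.J, j < i → ∀ a, ∃ n : ℤ, h.lev i g a = n := by
    set P : ℕ → Prop := fun j => ∃ a, ∀ n : ℤ, h.lev j g a ≠ n with hP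
    obtain ⟨j₀, hj₀, hPj₀⟩ := hg
    refine ⟨Nat.findGreatest P h.J, ⟨Nat.findGreatest_le _, Nat.findGreatest_spec (P := P) hj₀ hPj₀⟩, ?_⟩
    intro i hi hlt b
    by_contra! hcon
    exact Nat.findGreatest_is_greatest hlt hi ⟨b, hcon⟩
  have hlt : j < h.J := lt_of_le_of_ne hjJ fun heq => by
    obtain ⟨n, hn⟩ := htop a
    rw [heq] at ha
    exact ha n hn
  obtain ⟨b, hba, hb, hb'⟩ : ∃ b, b ≠ a ∧ h.c (j + 1) b = h.c (j + 1) a ∧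
      ∀ n : ℤ, h.lev j g b ≠ n := by
    by_contra! hcon
    choose! n hn using hcon
    have e : h.lev (j + 1) g (h.c (j + 1) a) =
        ∑ b with h.c (j + 1) b = h.c (j + 1) a, h.lev j g b :=
      (congrFun (h.lev_lev (Nat.le_succ j) g) _).symm
    obtain ⟨N, hN⟩ := hmax (j + 1) hlt (Nat.lt_succ_self j) (h.c (j + 1) a)
    rw [hN, ← Finset.add_sum_erase (Finset.univ.filter fun b => h.c (j + 1) b = h.c (j + 1) a) _
      (show a ∈ _ by simp)] at e
    have e2 : ∑ b ∈ (Finset.univ.filter fun b => h.c (j + 1) b = h.c (j + 1) a).erase a,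
        h.lev j g b = ((∑ b ∈ (Finset.univ.filter fun b => h.c (j + 1) b =
          h.c (j + 1) a).erase a, n b : ℤ) : ℝ) := by
      rw [Int.cast_sum]
      refine Finset.sum_congr rfl fun b hb => ?_
      obtain ⟨hb1, hb2⟩ := Finset.mem_erase.1 hb
      exact hn b hb1 (Finset.mem_filter.1 hb2).2
    rw [e2] at e
    apply ha (N - ∑ b ∈ (Finset.univ.filter fun b => h.c (j + 1) b =
          h.c (j + 1) a).erase a, n b)
    push_cast at e ⊢
    linarith
  obtain ⟨x, hx, hx'⟩ := h.exists_fractional_point j a ha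
  obtain ⟨y, hy, hy'⟩ := h.exists_fractional_point j b hb'
  refine ⟨x, y, ?_, fun i hi hne => ?_⟩
  · rintro rfl
    exact hba (hy.symm.trans hx)
  · rcases Nat.lt_or_ge j i with h1 | h1
    · exfalso
      apply hne
      have e : h.c (j + 1) x = h.c (j + 1) y := by
        rw [← h.c_comp j (j + 1) (Nat.le_succ j) x, ← h.c_comp j (j + 1) (Nat.le_succ j) y, hx, hy, hb]
      rw [← h.c_comp (j + 1) i h1 x, e, h.c_comp (j + 1) i h1 y]
    · exact ⟨hx' i h1, hy' i h1⟩

lemma eventually_mem_floor_ceil {v w : ℝ} {lo hi : ℤ} (hl : (lo : ℝ) ≤ v) (hh : v ≤ hi)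
    (hv : w ≠ 0 → ∀ n : ℤ, v ≠ n) :
    ∀ᶠ t in 𝓝 (0 : ℝ), (lo : ℝ) ≤ v + t * w ∧ v + t * w ≤ hi := by
  by_cases hw : w = 0
  · subst hw
    simp [hl, hh]
  · have hl' : (lo : ℝ) < v := lt_of_le_of_ne hl (hv hw lo).symm
    have hh' : v < hi := lt_of_le_of_ne hh (hv hw hi)
    have hc : Tendsto (fun t : ℝ => v + t * w) (𝓝 0) (𝓝 (v + 0 * w)) :=
      Continuous.tendsto (by fun_prop) 0
    rw [zero_mul, add_zero] at hc
    filter_upwards [hc.eventually_const_lt hl', hc.eventually_lt_const hh'] with t h1 h2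
    exact ⟨h1.le, h2.le⟩

open Classical in
/-- A fractional vector is a convex combination of integral vectors in its integral boxes. -/
lemma Hierarchy.exists_integral_decomposition (h : Hierarchy Y) {f : Y → ℝ} {K : ℤ}
    (hf : ∑ y, f y = K) :
    ∃ (E : Finset (Y → ℤ)) (q : (Y → ℤ) → ℝ), (∀ e ∈ E, 0 ≤ q e) ∧ ∑ e ∈ E, q e = 1 ∧
      (∀ e ∈ E, h.Near f (fun y => (e y : ℝ))) ∧ ∀ y, ∑ e ∈ E, q e * e y = f y := by
  set P : Set (Y → ℝ) := {g | h.Near f g} with hP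
  have hPc : IsClosed P := by
    simp only [hP, Hierarchy.Near, Set.ofPred_forall, Set.ofPred_and]
    exact isClosed_iInter fun j => isClosed_iInter fun _ => isClosed_iInter fun a =>
      IsClosed.inter (isClosed_le continuous_const (h.continuous_lev j a))
        (isClosed_le (h.continuous_lev j a) continuous_const)
  have hPb : P ⊆ Set.Icc (fun y => (⌊f y⌋ : ℝ)) (fun y => (⌈f y⌉ : ℝ)) := by
    intro g hg
    constructor <;> intro y
    · have := (hg 0 (Nat.zero_le _) y).1
      simpa only [h.lev_zero] using this
    · have := (hg 0 (Nat.zero_le _) y).2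
      simpa only [h.lev_zero] using this
  have hPk : IsCompact P := isCompact_Icc.of_isClosed_subset hPc hPb
  have hPconv : Convex ℝ P := by
    intro u hu v hv a b ha hb hab j hj y
    rw [h.lev_add, h.lev_smul, h.lev_smul]
    obtain ⟨u1, u2⟩ := hu j hj y
    obtain ⟨v1, v2⟩ := hv j hj y
    constructor
    · calc (⌊h.lev j f y⌋ : ℝ) = a * ⌊h.lev j f y⌋ + b * ⌊h.lev j f y⌋ := by
            rw [← add_mul, hab, one_mul]
        _ ≤ _ := by gcongr
    · calc _ ≤ a * (⌈h.lev j f y⌉ : ℝ) + b * ⌈h.lev j f y⌉ := by gcongr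
        _ = _ := by rw [← add_mul, hab, one_mul]
  have hfP : f ∈ P := fun j _ a => ⟨Int.floor_le _, Int.le_ceil _⟩
  set emb : (Y → ℤ) → (Y → ℝ) := fun e y => (e y : ℝ) with hemb
  set E : Finset (Y → ℤ) := (Finset.Icc (fun y => ⌊f y⌋) (fun y => ⌈f y⌉)).filter
    fun e => h.Near f (emb e) with hE
  -- At a point with some fractional cluster mass, shifting mass both ways within a fractional pair
  -- stays in `P`, so the point is not extreme.
  have hext : P.extremePoints ℝ ⊆ emb '' E := by
    intro g hg
    have hgP : g ∈ P := hg.1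
    by_cases hint : ∀ j ≤ h.J, ∀ a, ∃ n : ℤ, h.lev j g a = n
    · choose e he using hint 0 (Nat.zero_le _)
      have hge : g = emb e := by
        funext y
        have h0 := he y
        rwa [h.lev_zero] at h0
      refine ⟨e, ?_, hge.symm⟩
      simp only [hE, Finset.coe_filter, Finset.mem_Icc, Set.mem_ofPred_eq]
      refine ⟨⟨fun y => ?_, fun y => ?_⟩, hge ▸ hgP⟩
      · have := (hPb hgP).1 y
        rw [hge] at this
        exact (Int.cast_le (R := ℝ)).1 this
      · have := (hPb hgP).2 y
        rw [hge] at this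
        exact (Int.cast_le (R := ℝ)).1 this
    · exfalso
      push Not at hint
      have htop : ∀ a, ∃ n : ℤ, h.lev h.J g a = n := by
        intro a
        have h1 := hgP h.J le_rfl a
        have h2 : h.lev h.J f a = ((if a = h.top then K else 0 : ℤ) : ℝ) := by
          rw [h.lev_top, hf]; split_ifs <;> simp
        rw [h2, Int.floor_intCast, Int.ceil_intCast] at h1
        exact ⟨_, le_antisymm h1.2 h1.1⟩
      obtain ⟨x, y, hxy, hsep⟩ := h.exists_fractional_pair htop hint
      set d : Y → ℝ := fun w => (if w = x then 1 else 0) - (if w = y then 1 else 0) with hd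
      have hdl : ∀ j a, h.lev j d a =
          (if h.c j x = a then 1 else 0) - (if h.c j y = a then 1 else 0) := by
        intro j a
        simp only [Hierarchy.lev, hd, Finset.sum_sub_distrib, Finset.sum_ite_eq', Finset.mem_filter,
          Finset.mem_univ, true_and]
      have hev : ∀ᶠ t in 𝓝 (0 : ℝ), g + t • d ∈ P := by
        have : ∀ᶠ t in 𝓝 (0 : ℝ), ∀ j : Fin (h.J + 1), ∀ a,
            (⌊h.lev j f a⌋ : ℝ) ≤ h.lev j g a + t * h.lev j d a ∧
              h.lev j g a + t * h.lev j d a ≤ ⌈h.lev j f a⌉ := by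
          refine eventually_all.2 fun j => eventually_all.2 fun a => ?_
          have hj : j.val ≤ h.J := Nat.lt_succ_iff.1 j.2
          obtain ⟨h1, h2⟩ := hgP j hj a
          refine eventually_mem_floor_ceil h1 h2 fun hne => ?_
          rw [hdl] at hne
          have hne' : h.c j x ≠ h.c j y := fun heq => hne (by rw [heq, sub_self])
          obtain ⟨s1, s2⟩ := hsep j hj hne'
          by_cases hxa : h.c j x = a
          · rw [← hxa]; exact s1
          · by_cases hya : h.c j y = a
            · rw [← hya]; exact s2
            · simp [hxa, hya] at hne
        filter_upwards [this] with t ht j hj a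
        rw [h.lev_add, h.lev_smul]
        exact ht ⟨j, Nat.lt_succ_of_le hj⟩ a
      obtain ⟨ε, hε, hball⟩ := Metric.eventually_nhds_iff.1 hev
      have h1 : g + (ε / 2) • d ∈ P := hball (by
        rw [Real.dist_eq, sub_zero, abs_of_pos (by linarith)]; linarith)
      have h2 : g + (-(ε / 2)) • d ∈ P := hball (by
        rw [Real.dist_eq, sub_zero, abs_neg, abs_of_pos (by linarith)]; linarith)
      have h3 := hg.2 h1 h2 ⟨1 / 2, 1 / 2, by norm_num, by norm_num, by norm_num, by
        funext w
        simp only [Pi.add_apply, Pi.smul_apply, smul_eq_mul]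
        ring⟩
      have h4 := congrFun h3 x
      simp only [Pi.add_apply, Pi.smul_apply, smul_eq_mul, hd, if_true, if_neg hxy] at h4
      linarith
  have hfin : ((emb '' E : Set (Y → ℝ))).Finite := E.finite_toSet.image emb
  -- Krein–Milman; the closure is superfluous because the hull of a finite set is closed.
  have hfE : f ∈ convexHull ℝ (emb '' E) := by
    have := closure_convexHull_extremePoints hPk hPconv
    rw [← this] at hfP
    exact closure_minimal (convexHull_mono hext) (hfin.isClosed_convexHull ℝ) hfP
  have hinj : Function.Injective emb := fun e e' hee => by
    funext y
    have := congrFun hee y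
    simpa only [hemb, Int.cast_inj] using this
  rw [← Finset.coe_image, Finset.mem_convexHull'] at hfE
  obtain ⟨w, hw0, hw1, hwf⟩ := hfE
  rw [Finset.sum_image (fun a _ b _ hab => hinj hab)] at hw1 hwf
  refine ⟨E, fun e => w (emb e), fun e he => hw0 _ (Finset.mem_image_of_mem _ he), hw1,
    fun e he => (Finset.mem_filter.1 he).2, fun y => ?_⟩
  have := congrFun hwf y
  simpa using this

end Hierarchy

/-! ### Transport in a hierarchy and the update of random server placements -/

section Labelled

variable {Y : Type*} [Fintype Y] {ι : Type*} [Fintype ι]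

open Classical in
/-- The distance of two points in a hierarchy with cluster diameters `σ * 2 ^ j`. -/
noncomputable def Hierarchy.levelDist (h : Hierarchy Y) (σ : ℝ) (u v : Y) : ℝ :=
  ∑ j ∈ Finset.range h.J, σ * 2 ^ j * (if h.c j u = h.c j v then 0 else 1)

omit [Fintype Y] in
lemma Hierarchy.levelDist_nonneg (h : Hierarchy Y) {σ : ℝ} (hσ : 0 ≤ σ) (u v : Y) :
    0 ≤ h.levelDist σ u v :=
  Finset.sum_nonneg fun j _ => by split_ifs <;> positivity

omit [Fintype Y] in
lemma Hierarchy.levelDist_self (h : Hierarchy Y) (σ : ℝ) (u : Y) : h.levelDist σ u u = 0 := by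
  simp [Hierarchy.levelDist]

omit [Fintype Y] in
lemma Hierarchy.levelDist_comm (h : Hierarchy Y) (σ : ℝ) (u v : Y) :
    h.levelDist σ u v = h.levelDist σ v u := by
  classical
  unfold Hierarchy.levelDist
  exact Finset.sum_congr rfl fun j _ => by congr 1; exact if_congr eq_comm rfl rfl

omit [Fintype Y] in
lemma Hierarchy.levelDist_triangle (h : Hierarchy Y) {σ : ℝ} (hσ : 0 ≤ σ) (u v w : Y) :
    h.levelDist σ u w ≤ h.levelDist σ u v + h.levelDist σ v w := by
  unfold Hierarchy.levelDist
  rw [← Finset.sum_add_distrib]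
  refine Finset.sum_le_sum fun j _ => ?_
  rw [← mul_add]
  refine mul_le_mul_of_nonneg_left ?_ (by positivity)
  by_cases h1 : h.c j u = h.c j v
  · rw [h1]; simp
  · rw [if_neg h1]
    split_ifs <;> norm_num

open Classical in
/-- The number of indices at each point. -/
noncomputable def pointCount (s : ι → Y) (y : Y) : ℝ := (Finset.univ.filter fun i => s i = y).card

open Classical in
lemma Hierarchy.lev_pointCount (h : Hierarchy Y) (j : ℕ) (s : ι → Y) (a : Y) :
    h.lev j (pointCount s) a = ∑ i, if h.c j (s i) = a then (1 : ℝ) else 0 := by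
  unfold Hierarchy.lev pointCount
  simp only [Finset.card_filter, Nat.cast_sum, Nat.cast_ite, Nat.cast_one, Nat.cast_zero]
  rw [Finset.sum_comm]
  refine Finset.sum_congr rfl fun i _ => ?_
  simp [Finset.sum_ite_eq]

omit [Fintype Y] in
lemma pointCount_comp_perm (s : ι → Y) (π : Equiv.Perm ι) : pointCount (s ∘ π) = pointCount s := by
  classical
  funext y
  unfold pointCount
  simp only [Finset.card_filter, Nat.cast_inj, Function.comp_apply]
  exact Equiv.sum_comp π fun i => if s i = y then 1 else 0

lemma sum_pointCount (s : ι → Y) : ∑ y, pointCount s y = Fintype.card ι := by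
  classical
  unfold pointCount
  have := Finset.card_eq_sum_card_fiberwise (f := s) (s := Finset.univ) (t := Finset.univ) (by simp)
  rw [← Nat.cast_sum, ← this, Finset.card_univ]

-- Two pairs that cross a cluster in opposite directions can be uncrossed: the new pair inside the
-- cluster is no longer separated at level `j`, and at no other level do the swapped pairs cost
-- more.
omit [Fintype Y] in
lemma Hierarchy.levelDist_swap_lt (h : Hierarchy Y) {σ : ℝ} (hσ : 0 < σ) {j : ℕ} (hj : j < h.J)
    {x y x' y' : Y} (h1 : h.c j x ≠ h.c j y) (h2 : h.c j x = h.c j y') (h3 : h.c j x ≠ h.c j x') :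
    h.levelDist σ x y' + h.levelDist σ x' y < h.levelDist σ x y + h.levelDist σ x' y' := by
  classical
  unfold Hierarchy.levelDist
  simp only [← Finset.sum_add_distrib, ← mul_add]
  have up : ∀ l, j ≤ l → ∀ {u v}, h.c j u = h.c j v → h.c l u = h.c l v := fun l hl u v huv => by
    rw [← h.c_comp j l hl u, huv, h.c_comp j l hl]
  have down : ∀ l, l ≤ j → ∀ {u v}, h.c j u ≠ h.c j v → h.c l u ≠ h.c l v :=
    fun l hl u v huv heq => huv (by rw [← h.c_comp l j hl u, heq, h.c_comp l j hl])
  have h4 : h.c j x' ≠ h.c j y' := by rw [← h2]; exact h3.symm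
  refine Finset.sum_lt_sum (fun l _ => mul_le_mul_of_nonneg_left ?_ (by positivity))
    ⟨j, Finset.mem_range.2 hj, mul_lt_mul_of_pos_left ?_ (by positivity)⟩
  · rcases le_total j l with hl | hl
    · rw [if_pos (up l hl h2), zero_add]
      by_cases h5 : h.c l x' = h.c l y
      · rw [if_pos h5]
        split_ifs <;> norm_num
      · rw [if_neg h5]
        by_cases h6 : h.c l x = h.c l y
        · have h7 : h.c l x' ≠ h.c l y' := fun h7 => h5 (by rw [h7, ← up l hl h2, h6])
          rw [if_neg h7]; split_ifs; norm_num
        · rw [if_neg h6]; split_ifs <;> norm_num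
    · rw [if_neg (down l hl h1), if_neg (down l hl h4)]
      split_ifs <;> norm_num
  · rw [if_pos h2, if_neg h1, if_neg h4]
    split_ifs <;> norm_num

/-- Optimal relabelling: the transport cost is controlled by the differences of the cluster
masses. -/
lemma Hierarchy.exists_perm_levelDist_le (h : Hierarchy Y) {σ : ℝ} (hσ : 0 < σ) (s s' : ι → Y) :
    ∃ π : Equiv.Perm ι, ∑ i, h.levelDist σ (s i) (s' (π i)) ≤
      ∑ j ∈ Finset.range h.J, σ * 2 ^ j *
        ∑ a, |h.lev j (pointCount s) a - h.lev j (pointCount s') a| := by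
  classical
  obtain ⟨π, -, hπ⟩ := Finset.exists_min_image (Finset.univ : Finset (Equiv.Perm ι))
    (fun π => ∑ i, h.levelDist σ (s i) (s' (π i))) ⟨1, Finset.mem_univ _⟩
  refine ⟨π, ?_⟩
  set t : ι → Y := s' ∘ π with ht
  have hcount : pointCount s' = pointCount t := (pointCount_comp_perm s' π).symm
  rw [hcount]
  change ∑ i, h.levelDist σ (s i) (t i) ≤ _
  unfold Hierarchy.levelDist
  rw [Finset.sum_comm]
  refine Finset.sum_le_sum fun j hj => ?_
  rw [← Finset.mul_sum]
  refine mul_le_mul_of_nonneg_left ?_ (by positivity)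
  -- In an optimal matching no cluster is both left by one server and entered by another. Hence the
  -- number leaving or entering is exactly the difference of the counts.
  have hno : ∀ a i i', h.c j (s i) = a → h.c j (t i) ≠ a → h.c j (t i') = a →
      h.c j (s i') ≠ a → False := by
    intro a i i' h1 h2 h3 h4
    have hne : i ≠ i' := by rintro rfl; exact h4 h1
    have hmin := hπ (π * Equiv.swap i i') (Finset.mem_univ _)
    have e : ∀ l, s' ((π * Equiv.swap i i') l) = t (Equiv.swap i i' l) := fun l => rfl
    have e' : ∀ l, s' (π l) = t l := fun l => rfl
    simp only [e, e'] at hmin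
    rw [← Finset.add_sum_erase _ _ (Finset.mem_univ i), ← Finset.add_sum_erase _ _
      (Finset.mem_erase.2 ⟨hne.symm, Finset.mem_univ i'⟩),
      ← Finset.add_sum_erase _ (fun l => h.levelDist σ (s l) (t (Equiv.swap i i' l)))
        (Finset.mem_univ i),
      ← Finset.add_sum_erase _ (fun l => h.levelDist σ (s l) (t (Equiv.swap i i' l)))
      (Finset.mem_erase.2 ⟨hne.symm, Finset.mem_univ i'⟩)] at hmin
    have hrest : ∑ l ∈ (Finset.univ.erase i).erase i', h.levelDist σ (s l) (t (Equiv.swap i i' l)) =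
        ∑ l ∈ (Finset.univ.erase i).erase i', h.levelDist σ (s l) (t l) := by
      refine Finset.sum_congr rfl fun l hl => ?_
      rw [Finset.mem_erase, Finset.mem_erase] at hl
      rw [Equiv.swap_apply_of_ne_of_ne hl.2.1 hl.1]
    rw [hrest, Equiv.swap_apply_left, Equiv.swap_apply_right] at hmin
    have := h.levelDist_swap_lt hσ (Finset.mem_range.1 hj) (x := s i) (y := t i) (x' := s i')
      (y' := t i') (by rw [h1]; exact h2.symm) (by rw [h1, h3]) (by rw [h1]; exact h4.symm)
    linarith
  have h5 : ∀ i, (if h.c j (s i) = h.c j (t i) then (0 : ℝ) else 1) =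
      ∑ a, if h.c j (s i) = a ∧ h.c j (t i) ≠ a then 1 else 0 := by
    intro i
    rw [Finset.sum_eq_single (h.c j (s i))]
    · by_cases h6 : h.c j (s i) = h.c j (t i)
      · simp [h6]
      · simp [h6, Ne.symm h6]
    · intro b _ hb
      rw [if_neg]
      exact fun h7 => hb h7.1.symm
    · simp
  simp only [h5]
  rw [Finset.sum_comm]
  refine Finset.sum_le_sum fun a _ => ?_
  rw [h.lev_pointCount, h.lev_pointCount, ← Finset.sum_sub_distrib]
  by_cases h6 : ∃ i, h.c j (s i) = a ∧ h.c j (t i) ≠ a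
  · obtain ⟨i, hi1, hi2⟩ := h6
    refine le_trans (le_of_eq ?_) (le_abs_self _)
    refine Finset.sum_congr rfl fun i' _ => ?_
    have := hno a i i' hi1 hi2
    by_cases h7 : h.c j (s i') = a <;> by_cases h8 : h.c j (t i') = a
    · simp [h7, h8]
    · simp [h7, h8]
    · exact (this h8 h7).elim
    · simp [h7, h8]
  · push Not at h6
    rw [Finset.sum_eq_zero]
    · exact abs_nonneg _
    · intro i _
      rw [if_neg]
      exact fun h7 => h7.2 (h6 i h7.1)

lemma exists_pointCount_eq {e : Y → ℤ} (he : ∀ y, 0 ≤ e y) (hsum : ∑ y, e y = Fintype.card ι) :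
    ∃ s : ι → Y, ∀ y, pointCount s y = e y := by
  classical
  have hcard : Fintype.card ι = Fintype.card (Σ y, Fin (e y).toNat) := by
    rw [Fintype.card_sigma]
    simp only [Fintype.card_fin]
    have h1 : ((∑ y, (e y).toNat : ℕ) : ℤ) = Fintype.card ι := by
      rw [← hsum]
      push_cast
      exact Finset.sum_congr rfl fun y _ => by simp [he y]
    exact_mod_cast h1.symm
  set E := Fintype.equivOfCardEq hcard
  refine ⟨fun i => (E i).1, fun y => ?_⟩
  unfold pointCount
  have h2 : (Finset.univ.filter fun i => (E i).1 = y).card = (e y).toNat := by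
    rw [Finset.card_filter, Equiv.sum_comp E fun p => if p.1 = y then 1 else 0, Fintype.sum_sigma]
    rw [Finset.sum_eq_single y]
    · simp
    · intro b _ hb; simp [hb]
    · simp
  rw [h2]
  have h3 := Int.toNat_of_nonneg (he y)
  exact_mod_cast h3

/-! ### The rounding step -/

/-- Since scales double, shifting the index halves the weighted error sum. The inherited errors are
thus at most half of the left side and can be absorbed. -/
lemma sum_geometric_error_le {J : ℕ} {e d : ℕ → ℝ} (heJ : e J = 0) (he : ∀ j, 0 ≤ e j)
    (h : ∀ j < J, e j ≤ e (j + 1) + 2 * d j) :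
    ∑ j ∈ Finset.range J, 2 ^ j * e j ≤ 4 * ∑ j ∈ Finset.range J, 2 ^ j * d j := by
  have h1 : ∑ j ∈ Finset.range J, 2 ^ j * e j ≤
      ∑ j ∈ Finset.range J, 2 ^ j * e (j + 1) + 2 * ∑ j ∈ Finset.range J, 2 ^ j * d j := by
    rw [Finset.mul_sum, ← Finset.sum_add_distrib]
    refine Finset.sum_le_sum fun j hj => ?_
    have := mul_le_mul_of_nonneg_left (h j (Finset.mem_range.1 hj)) (show (0 : ℝ) ≤ 2 ^ j by positivity)
    linarith
  have h2 : 2 * ∑ j ∈ Finset.range J, 2 ^ j * e (j + 1) ≤ ∑ j ∈ Finset.range J, 2 ^ j * e j := by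
    have h3 := Finset.sum_range_succ (fun j => (2 : ℝ) ^ j * e j) J
    have h4 := Finset.sum_range_succ' (fun j => (2 : ℝ) ^ j * e j) J
    rw [heJ] at h3
    have h5 : 2 * ∑ j ∈ Finset.range J, 2 ^ j * e (j + 1) =
        ∑ j ∈ Finset.range J, 2 ^ (j + 1) * e (j + 1) := by
      rw [Finset.mul_sum]
      exact Finset.sum_congr rfl fun j _ => by ring
    have := he 0
    simp only [pow_zero, one_mul] at h4
    linarith
  linarith

/-- The rounding step: a balanced random placement of servers for the mass distribution `z` can be
updated to one for `z'`, at an expected cost comparable to the cost of moving `z` to `z'`. -/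
lemma Hierarchy.exists_rounding_kernel [DecidableEq ι] (h : Hierarchy Y) {σ : ℝ} (hσ : 0 < σ) {Ω : Type*} [Fintype Ω]
    {p : Ω → ℝ} (hp : ∀ ω, 0 < p ω) (hp1 : ∑ ω, p ω = 1) {z z' : Y → ℝ}
    (hz'0 : ∀ y, 0 ≤ z' y) (hz' : ∑ y, z' y = Fintype.card ι) {s : Ω → ι → Y}
    (hs : ∀ ω, h.Near z (pointCount (s ω))) (hsm : ∀ y, ∑ ω, p ω * pointCount (s ω) y = z y) :
    ∃ κ : Ω → (ι → Y) → ℝ, (∀ ω s', 0 ≤ κ ω s') ∧ (∀ ω, ∑ s', κ ω s' = 1) ∧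
      (∀ ω s', κ ω s' ≠ 0 → h.Near z' (pointCount s')) ∧
      (∀ y, ∑ ω, p ω * ∑ s', κ ω s' * pointCount s' y = z' y) ∧
      ∑ ω, p ω * ∑ s', κ ω s' * ∑ i, h.levelDist σ (s ω i) (s' i) ≤
        4 * ∑ j ∈ Finset.range h.J, σ * 2 ^ j * ∑ a, |h.lev j z a - h.lev j z' a| := by
  classical
  obtain ⟨m, m1, m2, m3, m4⟩ := h.exists_fractional_update hp hp1 (K := Fintype.card ι)
    (by simpa using hz') hs hsm (fun ω => by simpa using sum_pointCount (s ω))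
  have hmK : ∀ ω, ∑ y, m ω y = ((Fintype.card ι : ℤ) : ℝ) := by
    intro ω
    have h1 := m1 ω h.J le_rfl h.top
    rw [h.lev_top, h.lev_top, if_pos rfl, if_pos rfl, hz', Int.floor_natCast, Int.ceil_natCast] at h1
    exact le_antisymm h1.2 h1.1
  -- Given the old outcome, the fractional vector `m ω` is sampled as an integral vector, and the
  -- servers are then relabelled optimally.
  choose E q hq0 hq1 hqN hqm using fun ω => h.exists_integral_decomposition (hmK ω)
  have hnear : ∀ ω, ∀ e ∈ E ω, h.Near z' (fun y => (e y : ℝ)) := by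
    intro ω e he j hj a
    have h1 := hqN ω e he j hj a
    have h2 := m1 ω j hj a
    exact ⟨le_trans (by exact_mod_cast Int.le_floor.2 h2.1) h1.1,
      h1.2.trans (by exact_mod_cast Int.ceil_le.2 h2.2)⟩
  have hS : ∀ ω, ∀ e : Y → ℤ, ∃ s' : ι → Y, e ∈ E ω → (pointCount s' = fun y => (e y : ℝ)) ∧
      ∑ i, h.levelDist σ (s ω i) (s' i) ≤ ∑ j ∈ Finset.range h.J, σ * 2 ^ j *
        ∑ a, |h.lev j (pointCount (s ω)) a - h.lev j (fun y => (e y : ℝ)) a| := by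
    intro ω e
    by_cases he : e ∈ E ω
    · have h0 : ∀ y, 0 ≤ e y := by
        intro y
        have h1 := (hnear ω e he 0 (Nat.zero_le _) y).1
        rw [h.lev_zero, h.lev_zero] at h1
        have h2 : ⌊z' y⌋ ≤ e y := by exact_mod_cast h1
        exact (Int.floor_nonneg.2 (hz'0 y)).trans h2
      have hsum : ∑ y, e y = Fintype.card ι := by
        have h1 := hnear ω e he h.J le_rfl h.top
        rw [h.lev_top, h.lev_top, if_pos rfl, if_pos rfl, hz', Int.floor_natCast,
          Int.ceil_natCast] at h1
        have h2 := le_antisymm h1.2 h1.1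
        exact_mod_cast h2
      obtain ⟨s'', hs''⟩ := exists_pointCount_eq (ι := ι) h0 hsum
      obtain ⟨π, hπ⟩ := h.exists_perm_levelDist_le hσ (s ω) s''
      refine ⟨s'' ∘ π, fun _ => ?_⟩
      rw [pointCount_comp_perm, funext hs'']
      rw [funext hs''] at hπ
      exact ⟨rfl, hπ⟩
    · exact ⟨s ω, fun h => absurd h he⟩
  choose S hS using hS
  set κ : Ω → (ι → Y) → ℝ := fun ω s' => ∑ e ∈ E ω with S ω e = s', q ω e with hκ
  have hκsum : ∀ ω (F : (ι → Y) → ℝ), ∑ s', κ ω s' * F s' = ∑ e ∈ E ω, q ω e * F (S ω e) := by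
    intro ω F
    rw [← Finset.sum_fiberwise (E ω) (S ω)]
    refine Finset.sum_congr rfl fun s' _ => ?_
    rw [hκ, Finset.sum_mul]
    exact Finset.sum_congr rfl fun e he => by rw [(Finset.mem_filter.1 he).2]
  refine ⟨κ, fun ω s' => Finset.sum_nonneg fun e he => hq0 ω e (Finset.mem_filter.1 he).1,
    fun ω => ?_, fun ω s' hne => ?_, fun y => ?_, ?_⟩
  · have := hκsum ω (fun _ => 1)
    simp only [mul_one] at this
    rw [this, hq1]
  · obtain ⟨e, he, -⟩ := Finset.exists_ne_zero_of_sum_ne_zero hne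
    obtain ⟨he1, rfl⟩ := Finset.mem_filter.1 he
    rw [(hS ω e he1).1]
    exact hnear ω e he1
  · rw [← m2 y]
    refine Finset.sum_congr rfl fun ω _ => ?_
    rw [hκsum, ← hqm ω y]
    congr 1
    exact Finset.sum_congr rfl fun e he => by rw [(hS ω e he).1]
  · set err : ℕ → ℝ := fun j => ∑ ω, p ω * ∑ a, |h.lev j (pointCount (s ω)) a - h.lev j (m ω) a|
      with herr
    have a1 : ∑ ω, p ω * ∑ s', κ ω s' * ∑ i, h.levelDist σ (s ω i) (s' i) ≤
        ∑ j ∈ Finset.range h.J, σ * 2 ^ j * err j := by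
      have b1 : ∀ ω, ∑ s', κ ω s' * ∑ i, h.levelDist σ (s ω i) (s' i) ≤
          ∑ j ∈ Finset.range h.J, σ * 2 ^ j *
            ∑ a, |h.lev j (pointCount (s ω)) a - h.lev j (m ω) a| := by
        intro ω
        rw [hκsum]
        refine (Finset.sum_le_sum fun e he =>
          mul_le_mul_of_nonneg_left (hS ω e he).2 (hq0 ω e he)).trans (le_of_eq ?_)
        simp only [Finset.mul_sum]
        rw [Finset.sum_comm]
        refine Finset.sum_congr rfl fun j hj => ?_
        rw [Finset.sum_comm]
        refine Finset.sum_congr rfl fun a _ => ?_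
        have hN : ∃ N : ℤ, h.lev j (pointCount (s ω)) a = N := by
          refine ⟨∑ i, if h.c j (s ω i) = a then 1 else 0, ?_⟩
          rw [h.lev_pointCount]; push_cast; rfl
        obtain ⟨N, hN⟩ := hN
        have hmean : ∑ e ∈ E ω, q ω e * h.lev j (fun y => (e y : ℝ)) a = h.lev j (m ω) a := by
          simp only [Hierarchy.lev, Finset.mul_sum]
          rw [Finset.sum_comm]
          exact Finset.sum_congr rfl fun y _ => hqm ω y
        have hc : ∀ e ∈ E ω, _ := fun e he => hqN ω e he j (Finset.mem_range.1 hj).le a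
        -- The old count `N` is an integer and so never lies strictly inside the box of `m ω`. The
        -- absolute value is therefore linear on that box, and sampling costs nothing beyond the
        -- error of `m ω`.
        have c1 : ∑ e ∈ E ω, q ω e * |(N : ℝ) - h.lev j (fun y => (e y : ℝ)) a| =
            |(N : ℝ) - h.lev j (m ω) a| := by
          rcases lt_or_ge N ⌈h.lev j (m ω) a⌉ with hlt | hge
          · have hNf : (N : ℝ) ≤ ⌊h.lev j (m ω) a⌋ := by
              have := Int.ceil_le_floor_add_one (h.lev j (m ω) a)
              exact_mod_cast (by omega : N ≤ ⌊h.lev j (m ω) a⌋)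
            rw [abs_of_nonpos (by linarith [Int.floor_le (h.lev j (m ω) a)])]
            rw [Finset.sum_congr rfl fun e he => by
              rw [abs_of_nonpos (by linarith [(hc e he).1])]]
            simp only [neg_sub, mul_sub, Finset.sum_sub_distrib, ← Finset.sum_mul]
            rw [hmean, hq1, one_mul]
          · have hNc : (⌈h.lev j (m ω) a⌉ : ℝ) ≤ N := by exact_mod_cast hge
            rw [abs_of_nonneg (by linarith [Int.le_ceil (h.lev j (m ω) a)])]
            rw [Finset.sum_congr rfl fun e he => by
              rw [abs_of_nonneg (by linarith [(hc e he).2])]]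
            simp only [mul_sub, Finset.sum_sub_distrib, ← Finset.sum_mul]
            rw [hmean, hq1, one_mul]
        rw [hN, ← c1, Finset.mul_sum]
        exact Finset.sum_congr rfl fun e _ => by ring
      refine (Finset.sum_le_sum fun ω _ => mul_le_mul_of_nonneg_left (b1 ω) (hp ω).le).trans
        (le_of_eq ?_)
      simp only [Finset.mul_sum, herr]
      rw [Finset.sum_comm]
      refine Finset.sum_congr rfl fun j _ => Finset.sum_congr rfl fun ω _ =>
        Finset.sum_congr rfl fun a _ => by ring
    have a2 := sum_geometric_error_le (J := h.J) (e := err)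
      (d := fun j => ∑ a, |h.lev j z a - h.lev j z' a|)
      (by
        simp only [herr, Finset.mul_sum]
        rw [Finset.sum_comm]
        exact Finset.sum_eq_zero fun a _ => m3 a)
      (fun j => Finset.sum_nonneg fun ω _ => mul_nonneg (hp ω).le
        (Finset.sum_nonneg fun a _ => abs_nonneg _)) m4
    have a3 := mul_le_mul_of_nonneg_left a2 hσ.le
    refine a1.trans ?_
    simp only [Finset.mul_sum, mul_assoc] at a3 ⊢
    simp only [mul_left_comm σ (4 : ℝ)] at a3
    exact a3

end Labelled

/-! ### Lazy servers -/

section Lazy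

variable {X : Type*} [MetricSpace X] {k : ℕ}

lemma moveCost_le (S S' : Config X k) (f : {x // x ∈ S.1} ≃ {x // x ∈ S'.1}) :
    moveCost S S' ≤ ∑ x : {x // x ∈ S.1}, dist (x : X) (f x : X) :=
  ciInf_le ⟨0, by
    rintro _ ⟨g, rfl⟩
    exact Finset.sum_nonneg fun x _ => dist_nonneg⟩ f

lemma moveCost_nonneg (S S' : Config X k) : 0 ≤ moveCost S S' :=
  Real.iInf_nonneg fun _ => Finset.sum_nonneg fun _ _ => dist_nonneg

lemma moveCost_self (S : Config X k) : moveCost S S = 0 :=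
  le_antisymm ((moveCost_le S S (Equiv.refl _)).trans (by simp)) (moveCost_nonneg S S)

/-- The configuration given by labelled servers. -/
def embConfig (a : Fin k ↪ X) : Config X k := ⟨Finset.univ.map a, by simp⟩

omit [MetricSpace X] in
lemma mem_embConfig {a : Fin k ↪ X} {x : X} : x ∈ (embConfig a).1 ↔ ∃ i, a i = x := by
  simp [embConfig]

/-- The labelling of the points of a configuration. -/
noncomputable def embConfigEquiv (a : Fin k ↪ X) : Fin k ≃ {x // x ∈ (embConfig a).1} :=
  Equiv.ofBijective (fun i => ⟨a i, mem_embConfig.2 ⟨i, rfl⟩⟩)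
    ⟨fun _ _ hij => a.injective (congrArg Subtype.val hij), fun ⟨_, hx⟩ =>
      (mem_embConfig.1 hx).imp fun _ hi => Subtype.ext hi⟩

lemma moveCost_embConfig_le (a a' : Fin k ↪ X) :
    moveCost (embConfig a) (embConfig a') ≤ ∑ i, dist (a i) (a' i) := by
  set ea := embConfigEquiv a
  set ea' := embConfigEquiv a'
  refine (moveCost_le (embConfig a) (embConfig a') (ea.symm.trans ea')).trans (le_of_eq ?_)
  rw [← ea.sum_comp]
  refine Finset.sum_congr rfl fun i _ => ?_
  rw [Equiv.trans_apply, Equiv.symm_apply_apply]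
  rfl

/-- Labelled servers that follow the virtual servers `s` lazily: they serve the request `r`, and
the cost is paid for by the decrease of the distances to the virtual servers. -/
lemma exists_lazy_update {V : Type*} {D : V → V → ℝ} (hD0 : ∀ v, D v v = 0)
    (hDt : ∀ u v w, D u w ≤ D u v + D v w) (ψ : X → V) {C₁ : ℝ}
    (hC₁ : 0 ≤ C₁) (hdist : ∀ x y, dist x y ≤ C₁ * D (ψ x) (ψ y)) (a : Fin k ↪ X) (s : Fin k → V)
    {r : X} (hs : ∃ i, s i = ψ r) :
    ∃ a' : Fin k ↪ X, r ∈ (embConfig a').1 ∧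
      moveCost (embConfig a) (embConfig a') + C₁ * ∑ i, D (ψ (a' i)) (s i) ≤
        C₁ * ∑ i, D (ψ (a i)) (s i) := by
  classical
  obtain ⟨i, hi⟩ := hs
  -- If `r` is already occupied, exchanging two labels leaves the configuration unchanged, and the
  -- triangle inequality shows that the lag does not grow. Otherwise server `i`, whose virtual
  -- server is at `r`, moves there and pays with its own lag; in both cases the positions stay
  -- distinct.
  by_cases hr : ∃ j, a j = r
  · obtain ⟨j, hj⟩ := hr
    set a' : Fin k ↪ X := (Equiv.swap i j).toEmbedding.trans a with ha'
    have ha'e : ∀ l, a' l = a (Equiv.swap i j l) := fun l => rfl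
    have hc : embConfig a' = embConfig a := by
      apply Subtype.ext
      ext x
      rw [mem_embConfig, mem_embConfig]
      constructor
      · rintro ⟨l, hl⟩
        exact ⟨_, hl⟩
      · rintro ⟨l, hl⟩
        exact ⟨Equiv.swap i j l, by rw [ha'e, Equiv.swap_apply_self, hl]⟩
    refine ⟨a', mem_embConfig.2 ⟨i, by rw [ha'e, Equiv.swap_apply_left, hj]⟩, ?_⟩
    rw [hc, moveCost_self, zero_add]
    refine mul_le_mul_of_nonneg_left ?_ hC₁
    by_cases hij : i = j
    · subst hij
      simp [ha'e]
    · rw [← Finset.add_sum_erase _ _ (Finset.mem_univ i), ← Finset.add_sum_erase _ _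
        (Finset.mem_erase.2 ⟨Ne.symm hij, Finset.mem_univ j⟩),
        ← Finset.add_sum_erase _ (fun l => D (ψ (a l)) (s l)) (Finset.mem_univ i),
        ← Finset.add_sum_erase _ (fun l => D (ψ (a l)) (s l))
        (Finset.mem_erase.2 ⟨Ne.symm hij, Finset.mem_univ j⟩)]
      have hrest : ∑ l ∈ (Finset.univ.erase i).erase j, D (ψ (a' l)) (s l) =
          ∑ l ∈ (Finset.univ.erase i).erase j, D (ψ (a l)) (s l) := by
        refine Finset.sum_congr rfl fun l hl => ?_
        rw [Finset.mem_erase, Finset.mem_erase] at hl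
        rw [ha'e, Equiv.swap_apply_of_ne_of_ne hl.2.1 hl.1]
      rw [hrest, ha'e, ha'e, Equiv.swap_apply_left, Equiv.swap_apply_right, hj, hi, hD0]
      have := hDt (ψ (a i)) (ψ r) (s j)
      linarith
  · push Not at hr
    set a' : Fin k ↪ X := ⟨Function.update a i r, by
      intro l l' hll
      by_cases h1 : l = i <;> by_cases h2 : l' = i
      · rw [h1, h2]
      · subst h1
        rw [Function.update_self, Function.update_of_ne h2] at hll
        exact absurd hll.symm (hr l')
      · subst h2
        rw [Function.update_self, Function.update_of_ne h1] at hll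
        exact absurd hll (hr l)
      · rw [Function.update_of_ne h1, Function.update_of_ne h2] at hll
        exact a.injective hll⟩ with ha'
    have hi' : a' i = r := Function.update_self i r a
    have hne : ∀ l, l ≠ i → a' l = a l := fun l hl => Function.update_of_ne hl r a
    refine ⟨a', mem_embConfig.2 ⟨i, hi'⟩, ?_⟩
    have h1 := moveCost_embConfig_le a a'
    have hrest1 : ∑ l ∈ Finset.univ.erase i, dist (a l) (a' l) = 0 :=
      Finset.sum_eq_zero fun l hl => by rw [hne l (Finset.ne_of_mem_erase hl), dist_self]
    have hrest2 : ∑ l ∈ Finset.univ.erase i, D (ψ (a' l)) (s l) =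
        ∑ l ∈ Finset.univ.erase i, D (ψ (a l)) (s l) :=
      Finset.sum_congr rfl fun l hl => by rw [hne l (Finset.ne_of_mem_erase hl)]
    rw [← Finset.add_sum_erase _ _ (Finset.mem_univ i), hrest1, add_zero, hi'] at h1
    rw [← Finset.add_sum_erase _ _ (Finset.mem_univ i), hrest2,
      ← Finset.add_sum_erase _ (fun l => D (ψ (a l)) (s l)) (Finset.mem_univ i), hi', hi, hD0]
    have := hdist (a i) r
    linarith

end Lazy

/-! ### One step of the online algorithm -/

section OnlineStep

variable {X : Type*} [Fintype X] [MetricSpace X] {V : Type*} [Fintype V] {k : ℕ}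

/-- An internal state of the online algorithm: a fractional state and a distribution on pairs of
labelled servers and virtual servers. -/
structure OnlineState (X V : Type*) (k : ℕ) where
  x : V × Fin k → ℝ
  μ : (Fin k ↪ X) × (Fin k → V) → ℝ

open Classical in
/-- The invariants of the internal states. -/
structure OnlineState.Valid (T : ParentTree V) (h : Hierarchy V) (δ : ℝ)
    (q : OnlineState X V k) : Prop where
  mem : q.x ∈ serverPolytope T k
  le_one : ∀ p, q.x p ≤ 1
  nonneg : ∀ ω, 0 ≤ q.μ ω
  sum_eq : ∑ ω, q.μ ω = 1
  near : ∀ ω, q.μ ω ≠ 0 → h.Near (massAt T (roundedCount δ q.x)) (pointCount ω.2)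
  mean : ∀ y, ∑ ω, q.μ ω * pointCount ω.2 y = massAt T (roundedCount δ q.x) y

open Classical in
/-- The expected distance between servers and virtual servers. -/
noncomputable def OnlineState.lag (D : V → V → ℝ) (ψ : X → V) (q : OnlineState X V k) : ℝ :=
  ∑ ω, q.μ ω * ∑ i, D (ψ (ω.1 i)) (ω.2 i)

/-- A change of the count below `v` shifts mass between `v` and its parent; summed over the levels
that separate them, this costs `levelDist`, hence at most `C₂ * wt v`. The constant is `6 = 2 * 3`:
two clusters per crossed edge, and the Lipschitz constant of the rounded counts. -/
lemma sum_levels_massAt_le (T : ParentTree V) (h : Hierarchy V) {σ : ℝ} (hσ : 0 < σ) {C₂ : ℝ}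
    (hC₂ : ∀ v, v ≠ T.root → h.levelDist σ v (T.par v) ≤ C₂ * T.wt v)
    {δ : ℝ} (hδ : δ ≤ 1 / 4) {x x' : V × Fin k → ℝ}
    (hroot : roundedCount δ x T.root = roundedCount δ x' T.root) (hC₂0 : 0 ≤ C₂) :
    ∑ j ∈ Finset.range h.J, σ * 2 ^ j * ∑ a, |h.lev j (massAt T (roundedCount δ x)) a -
      h.lev j (massAt T (roundedCount δ x')) a| ≤ 6 * C₂ * ∑ p, T.wt p.1 * |x' p - x p| := by
  classical
  set Y := roundedCount δ x
  set Y' := roundedCount δ x'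
  have h1 : ∀ j, ∑ a, |h.lev j (massAt T Y) a - h.lev j (massAt T Y') a| ≤
      2 * ∑ v with v ≠ T.root, |Y v - Y' v| * (if h.c j v = h.c j (T.par v) then 0 else 1) := by
    intro j
    refine (sum_abs_fiber_massAt_le T (h.c j) Y Y' hroot).trans (le_of_eq ?_)
    rw [← Finset.filter_filter, Finset.sum_filter (fun v => h.c j v ≠ h.c j (T.par v))]
    congr 1
    refine Finset.sum_congr rfl fun v _ => ?_
    by_cases hv : h.c j v = h.c j (T.par v) <;> simp [hv]
  have h2 : ∑ j ∈ Finset.range h.J, σ * 2 ^ j * ∑ a, |h.lev j (massAt T Y) a -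
      h.lev j (massAt T Y') a| ≤ 2 * ∑ v with v ≠ T.root, |Y v - Y' v| *
        h.levelDist σ v (T.par v) := by
    refine (Finset.sum_le_sum fun j _ => mul_le_mul_of_nonneg_left (h1 j) (by positivity)).trans
      (le_of_eq ?_)
    unfold Hierarchy.levelDist
    simp only [Finset.mul_sum]
    rw [Finset.sum_comm]
    exact Finset.sum_congr rfl fun v _ => Finset.sum_congr rfl fun j _ => by ring
  have h3 : ∀ v ∈ Finset.univ.filter (fun v => v ≠ T.root),
      |Y v - Y' v| * h.levelDist σ v (T.par v) ≤
      3 * C₂ * ∑ i, T.wt v * |x' (v, i) - x (v, i)| := by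
    intro v hv
    have e1 := abs_roundedCount_sub_le hδ x x' v
    rw [abs_sub_comm] at e1
    have e2 := hC₂ v (Finset.mem_filter.1 hv).2
    have e3 : 0 ≤ C₂ * T.wt v := mul_nonneg hC₂0 (T.wt_pos v).le
    refine (mul_le_mul_of_nonneg_left e2 (abs_nonneg _)).trans
      ((mul_le_mul_of_nonneg_right e1 e3).trans (le_of_eq ?_))
    rw [← Finset.mul_sum]
    ring
  have h4 : ∑ v with v ≠ T.root, |Y v - Y' v| * h.levelDist σ v (T.par v) ≤
      ∑ v, 3 * C₂ * ∑ i, T.wt v * |x' (v, i) - x (v, i)| := by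
    refine (Finset.sum_le_sum h3).trans (Finset.sum_le_sum_of_subset_of_nonneg
      (Finset.filter_subset _ _) fun v _ _ => ?_)
    have := T.wt_pos v
    positivity
  refine h2.trans ((mul_le_mul_of_nonneg_left h4 (by norm_num)).trans (le_of_eq ?_))
  rw [Fintype.sum_prod_type, ← Finset.mul_sum]
  ring

open Classical in
/-- One step of the online algorithm, with its amortized cost. -/
lemma exists_online_step (T : ParentTree V) (h : Hierarchy V) {σ : ℝ} (hσ : 0 < σ)
    {ψ : X → V} (hψ : ∀ x, ψ x ≠ T.root) (hleaf : ∀ x v, v ≠ T.root → T.par v ≠ ψ x)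
    {C₁ C₂ : ℝ} (hC₁ : 0 ≤ C₁) (hC₂ : 0 ≤ C₂)
    (hdist : ∀ x y, dist x y ≤ C₁ * h.levelDist σ (ψ x) (ψ y))
    (hpar : ∀ v, v ≠ T.root → h.levelDist σ v (T.par v) ≤ C₂ * T.wt v)
    {H : ℝ} (hH : ∀ v, (T.dep v : ℝ) ≤ H) (hk : 1 ≤ k) {δ : ℝ} (hδ : δ = 1 / (4 * k))
    {q : OnlineState X V k} (hq : q.Valid T h δ) (r : X) :
    ∃ (q' : OnlineState X V k) (γ : (Fin k ↪ X) × (Fin k → V) → (Fin k ↪ X) × (Fin k → V) → ℝ),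
      q'.Valid T h δ ∧ (∀ ω ω', 0 ≤ γ ω ω') ∧ (∀ ω, ∑ ω', γ ω ω' = q.μ ω) ∧
      (∀ ω', ∑ ω, γ ω ω' = q'.μ ω') ∧ (∀ ω ω', γ ω ω' ≠ 0 → r ∈ (embConfig ω'.1).1) ∧
      ∀ A : Config X k, r ∈ A.1 →
        ∑ ω, ∑ ω', γ ω ω' * moveCost (embConfig ω.1) (embConfig ω'.1) ≤
          C₁ * (q.lag (h.levelDist σ) ψ - q'.lag (h.levelDist σ) ψ) +
          24 * C₁ * C₂ * (∑ p, (2 * T.dep p.1 - 1) * T.wt p.1 * (q'.x p - q.x p) + 6 * H *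
            (entropyDiv T δ (integralState T k fun x : A.1 => ψ x) q.x -
              entropyDiv T δ (integralState T k fun x : A.1 => ψ x) q'.x)) := by
  have hk' : (1 : ℝ) ≤ k := by exact_mod_cast hk
  have hδ4 : δ ≤ 1 / 4 := by
    rw [hδ]; exact one_div_le_one_div_of_le (by norm_num) (by linarith)
  have hδ0 : 0 < δ := by rw [hδ]; positivity
  set i₀ : Fin k := ⟨0, hk⟩
  obtain ⟨x', hx', hx'1, hx'r, hx'c⟩ := exists_fractional_serve T hδ0 hq.mem hq.le_one hH (hψ r)
    (hleaf r) i₀ (y₀ := integralState T k fun _ : Fin k => ψ r)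
    (integralState_mem T _ (by simp)) (integralState_le_one T _)
    (integralState_eq_zero T _ (i := i₀) rfl rfl)
  set z := massAt T (roundedCount δ q.x) with hz
  set z' := massAt T (roundedCount δ x') with hz'
  have hz'0 : ∀ y, 0 ≤ z' y := massAt_roundedCount_nonneg T (by linarith) hx' hx'1
  have hz'k : ∑ y, z' y = Fintype.card (Fin k) := by
    rw [hz', sum_massAt, roundedCount_root T hk hδ hx'.2.1]; simp
  have hz'r : 1 ≤ z' (ψ r) := by
    rw [hz', massAt_leaf T _ (hleaf r)]
    exact one_le_roundedCount (by linarith) hx'1 hx'r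
  -- The rounding step needs positive probabilities, so it is applied on the support of `q.μ`.
  set Ω := {ω : (Fin k ↪ X) × (Fin k → V) // q.μ ω ≠ 0}
  have hsub : ∀ F : (Fin k ↪ X) × (Fin k → V) → ℝ,
      ∑ ω : Ω, q.μ ω.1 * F ω.1 = ∑ ω, q.μ ω * F ω := by
    intro F
    rw [← Finset.sum_filter_add_sum_filter_not Finset.univ (fun ω => q.μ ω ≠ 0),
      Finset.sum_eq_zero (s := Finset.univ.filter fun ω => ¬ q.μ ω ≠ 0), add_zero]
    · exact (Finset.sum_subtype (Finset.univ.filter fun ω => q.μ ω ≠ 0) (by simp)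
        (fun ω => q.μ ω * F ω)).symm
    · intro ω hω
      have := (Finset.mem_filter.1 hω).2
      push Not at this
      rw [this, zero_mul]
  have hsub1 : ∑ ω : Ω, q.μ ω.1 = 1 := by
    have := hsub fun _ => 1
    simpa [hq.sum_eq] using this
  obtain ⟨κ, κ1, κ2, κ3, κ4, κ5⟩ := h.exists_rounding_kernel hσ (Ω := Ω) (p := fun ω => q.μ ω.1)
    (fun ω => lt_of_le_of_ne (hq.nonneg _) (Ne.symm ω.2)) hsub1 (z := z) (z' := z') hz'0 hz'k
    (s := fun ω => ω.1.2) (fun ω => hq.near ω.1 ω.2)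
    (fun y => by rw [hsub fun ω => pointCount ω.2 y]; exact hq.mean y)
  -- The fractional mass at `ψ r` is at least 1; balance at level 0 then forces a virtual server
  -- there in every outcome.
  have hserve : ∀ (ω : Ω) s', κ ω s' ≠ 0 → ∃ i, s' i = ψ r := by
    intro ω s' hne
    have h1 := (κ3 ω s' hne 0 (Nat.zero_le _) (ψ r)).1
    rw [h.lev_zero, h.lev_zero] at h1
    have h2 : (1 : ℝ) ≤ ⌊z' (ψ r)⌋ := by exact_mod_cast Int.le_floor.2 (by simpa using hz'r)
    by_contra! hcon
    have h3 : pointCount s' (ψ r) = 0 := by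
      unfold pointCount
      rw [Finset.filter_eq_empty_iff.2 fun i _ => hcon i]
      simp
    linarith
  have hlazy : ∀ (a : Fin k ↪ X) (s' : Fin k → V), ∃ a' : Fin k ↪ X, (∃ i, s' i = ψ r) →
      r ∈ (embConfig a').1 ∧ moveCost (embConfig a) (embConfig a') +
        C₁ * ∑ i, h.levelDist σ (ψ (a' i)) (s' i) ≤
        C₁ * ∑ i, h.levelDist σ (ψ (a i)) (s' i) := by
    intro a s'
    by_cases hs' : ∃ i, s' i = ψ r
    · obtain ⟨a', h1⟩ := exists_lazy_update (h.levelDist_self σ) (h.levelDist_triangle hσ.le) ψ hC₁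
        hdist a s' hs'
      exact ⟨a', fun _ => h1⟩
    · exact ⟨a, fun h => absurd h hs'⟩
  choose L hL using hlazy
  set κ' : (Fin k ↪ X) × (Fin k → V) → (Fin k → V) → ℝ :=
    fun ω s' => if hω : q.μ ω ≠ 0 then κ ⟨ω, hω⟩ s' else 0 with hκ'
  have hκ'0 : ∀ ω s', 0 ≤ κ' ω s' := fun ω s' => by
    simp only [hκ']; split_ifs
    · exact κ1 _ _
    · exact le_rfl
  have hκ'Ω : ∀ (ω : Ω), κ' ω.1 = κ ω := fun ω => by
    funext s'; simp only [hκ']; rw [dif_pos ω.2]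
  have hκ'ne : ∀ ω s', κ' ω s' ≠ 0 → ∃ hω : q.μ ω ≠ 0, κ ⟨ω, hω⟩ s' ≠ 0 := fun ω s' hne => by
    simp only [hκ'] at hne
    split_ifs at hne with h1
    · exact ⟨h1, hne⟩
    · exact absurd rfl hne
  -- The virtual servers move by the kernel and the real ones follow deterministically by the lazy
  -- rule `L`.
  set γ : (Fin k ↪ X) × (Fin k → V) → (Fin k ↪ X) × (Fin k → V) → ℝ :=
    fun ω ω' => if ω'.1 = L ω.1 ω'.2 then q.μ ω * κ' ω ω'.2 else 0 with hγ
  have hγsum : ∀ ω (F : (Fin k ↪ X) × (Fin k → V) → ℝ),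
      ∑ ω', γ ω ω' * F ω' = q.μ ω * ∑ s', κ' ω s' * F (L ω.1 s', s') := by
    intro ω F
    rw [Fintype.sum_prod_type_right, Finset.mul_sum]
    refine Finset.sum_congr rfl fun s' _ => ?_
    simp only [hγ, ite_mul, zero_mul, Finset.sum_ite_eq', Finset.mem_univ, if_true]
    ring
  have hγ0 : ∀ ω ω', 0 ≤ γ ω ω' := fun ω ω' => by
    simp only [hγ]; split_ifs
    · exact mul_nonneg (hq.nonneg _) (hκ'0 _ _)
    · exact le_rfl
  have hγne : ∀ ω ω', γ ω ω' ≠ 0 → ω'.1 = L ω.1 ω'.2 ∧ ∃ hω : q.μ ω ≠ 0, κ ⟨ω, hω⟩ ω'.2 ≠ 0 := by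
    intro ω ω' hne
    simp only [hγ] at hne
    split_ifs at hne with h1
    · exact ⟨h1, hκ'ne _ _ (right_ne_zero_of_mul hne)⟩
    · exact absurd rfl hne
  have hγ1 : ∀ ω, ∑ ω', γ ω ω' = q.μ ω := by
    intro ω
    have h1 := hγsum ω fun _ => 1
    simp only [mul_one] at h1
    rw [h1]
    by_cases hω : q.μ ω ≠ 0
    · rw [hκ'Ω ⟨ω, hω⟩, κ2, mul_one]
    · push Not at hω
      rw [hω, zero_mul]
  set q' : OnlineState X V k := ⟨x', fun ω' => ∑ ω, γ ω ω'⟩ with hq'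
  have hq'sum : ∀ F : (Fin k ↪ X) × (Fin k → V) → ℝ,
      ∑ ω', q'.μ ω' * F ω' = ∑ ω : Ω, q.μ ω.1 * ∑ s', κ ω s' * F (L ω.1.1 s', s') := by
    intro F
    simp only [hq', Finset.sum_mul]
    rw [Finset.sum_comm]
    simp only [hγsum]
    rw [← hsub]
    simp only [hκ'Ω]
  have hval : q'.Valid T h δ := by
    refine ⟨hx', hx'1, fun ω' => Finset.sum_nonneg fun ω _ => hγ0 _ _, ?_, fun ω' hne => ?_,
      fun y => ?_⟩
    · have := hq'sum fun _ => 1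
      simp only [mul_one, κ2] at this
      rw [this, hsub1]
    · obtain ⟨ω, -, h1⟩ := Finset.exists_ne_zero_of_sum_ne_zero hne
      obtain ⟨-, hω, h2⟩ := hγne _ _ h1
      exact κ3 _ _ h2
    · rw [hq'sum fun ω => pointCount ω.2 y]
      exact κ4 y
  refine ⟨q', γ, hval, hγ0, hγ1, fun _ => rfl, fun ω ω' hne => ?_, fun A hA => ?_⟩
  · obtain ⟨h1, hω, h2⟩ := hγne _ _ hne
    rw [h1]
    exact (hL _ _ (hserve _ _ h2)).1
  · have hA' := hx'c _ (integralState_mem T (fun x : A.1 => ψ x) (by simp [A.2]))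
      (integralState_le_one T _) (integralState_eq_zero T _ (i := ⟨r, hA⟩) rfl rfl)
    have hlev := sum_levels_massAt_le (k := k) T h hσ hpar hδ4 (x := q.x) (x' := x')
      (by rw [roundedCount_root T hk hδ hq.mem.2.1, roundedCount_root T hk hδ hx'.2.1]) hC₂
    have hmove : ∑ ω, ∑ ω', γ ω ω' * moveCost (embConfig ω.1) (embConfig ω'.1) =
        ∑ ω : Ω, q.μ ω.1 * ∑ s', κ ω s' * moveCost (embConfig ω.1.1) (embConfig (L ω.1.1 s')) := by
      simp only [hγsum _ fun ω' => moveCost _ (embConfig ω'.1)]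
      rw [← hsub]
      simp only [hκ'Ω]
    have hlag : q.lag (h.levelDist σ) ψ =
        ∑ ω : Ω, q.μ ω.1 * ∑ s', κ ω s' * ∑ i, h.levelDist σ (ψ (ω.1.1 i)) (ω.1.2 i) := by
      simp only [← Finset.sum_mul, κ2, one_mul]
      exact (hsub fun ω => ∑ i, h.levelDist σ (ψ (ω.1 i)) (ω.2 i)).symm
    have hlag' : q'.lag (h.levelDist σ) ψ =
        ∑ ω : Ω, q.μ ω.1 * ∑ s', κ ω s' * ∑ i, h.levelDist σ (ψ (L ω.1.1 s' i)) (s' i) :=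
      hq'sum fun ω => ∑ i, h.levelDist σ (ψ (ω.1 i)) (ω.2 i)
    have hmain : ∑ ω : Ω, q.μ ω.1 * ∑ s', κ ω s' *
        moveCost (embConfig ω.1.1) (embConfig (L ω.1.1 s')) ≤
        C₁ * (q.lag (h.levelDist σ) ψ - q'.lag (h.levelDist σ) ψ) +
          C₁ * ∑ ω : Ω, q.μ ω.1 * ∑ s', κ ω s' * ∑ i, h.levelDist σ (ω.1.2 i) (s' i) := by
      rw [hlag, hlag', ← mul_add, ← Finset.sum_sub_distrib, ← Finset.sum_add_distrib, Finset.mul_sum]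
      refine Finset.sum_le_sum fun ω _ => ?_
      rw [← mul_sub, ← mul_add, mul_left_comm]
      refine mul_le_mul_of_nonneg_left ?_ (hq.nonneg _)
      rw [← Finset.sum_sub_distrib, ← Finset.sum_add_distrib, Finset.mul_sum]
      refine Finset.sum_le_sum fun s' _ => ?_
      rw [← mul_sub, ← mul_add, mul_left_comm]
      by_cases hne : κ ω s' = 0
      · rw [hne]; simp
      refine mul_le_mul_of_nonneg_left ?_ (κ1 _ _)
      have h1 := (hL ω.1.1 s' (hserve ω s' hne)).2
      have h2 : ∑ i, h.levelDist σ (ψ (ω.1.1 i)) (s' i) ≤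
          ∑ i, h.levelDist σ (ψ (ω.1.1 i)) (ω.1.2 i) + ∑ i, h.levelDist σ (ω.1.2 i) (s' i) := by
        rw [← Finset.sum_add_distrib]
        exact Finset.sum_le_sum fun i _ => h.levelDist_triangle hσ.le _ _ _
      have h3 := mul_le_mul_of_nonneg_left h2 hC₁
      linarith
    rw [hmove]
    refine hmain.trans ?_
    have h4 : ∑ ω : Ω, q.μ ω.1 * ∑ s', κ ω s' * ∑ i, h.levelDist σ (ω.1.2 i) (s' i) ≤
        24 * C₂ * (∑ p, (2 * T.dep p.1 - 1) * T.wt p.1 * (x' p - q.x p) + 6 * H *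
            (entropyDiv T δ (integralState T k fun x : A.1 => ψ x) q.x -
              entropyDiv T δ (integralState T k fun x : A.1 => ψ x) x')) := by
      have h5 := mul_le_mul_of_nonneg_left hA' (show 0 ≤ 24 * C₂ by positivity)
      linarith
    have h6 := mul_le_mul_of_nonneg_left h4 hC₁
    have h7 : q'.x = x' := rfl
    rw [h7]
    linarith

end OnlineStep

/-! ### Randomized algorithms from couplings -/

section Algorithm

variable {X : Type*} {k : ℕ}

/-- The internal state after the first `t` requests. -/
def runState {Q : Type*} (q₀ : Q) (step : Q → X → Q) (r : ℕ → X) : ℕ → Q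
  | 0 => q₀
  | t + 1 => step (runState q₀ step r t) (r t)

lemma runState_congr {Q : Type*} (q₀ : Q) (step : Q → X → Q) {r r' : ℕ → X} (t : ℕ)
    (h : ∀ i < t, r i = r' i) : runState q₀ step r t = runState q₀ step r' t := by
  induction t with
  | zero => rfl
  | succ t ih =>
    rw [runState, runState, ih fun i hi => h i (by omega), h t (by omega)]

lemma exists_config_mem (hk : 1 ≤ k) (S : Config X k) (x : X) : ∃ S' : Config X k, x ∈ S'.1 := by
  classical
  by_cases hx : x ∈ S.1
  · exact ⟨S, hx⟩
  · obtain ⟨y, hy⟩ : S.1.Nonempty := Finset.card_pos.1 (by rw [S.2]; omega)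
    refine ⟨⟨insert x (S.1.erase y), ?_⟩, Finset.mem_insert_self _ _⟩
    rw [Finset.card_insert_of_notMem fun h => hx (Finset.mem_of_mem_erase h),
      Finset.card_erase_of_mem hy, S.2]
    omega

/-- A finitely supported conditional distribution. -/
lemma exists_conditional_pmf {β : Type*} [Fintype β] {m : ℝ} (hm : m ≠ 0) {g : β → ℝ}
    (hg : ∀ b, 0 ≤ g b) (hgm : ∑ b, g b = m) :
    ∃ P : PMF β, (∀ b, (P b).toReal = g b / m) ∧ ∀ b ∈ P.support, g b ≠ 0 := by
  have hm0 : 0 ≤ m := hgm ▸ Finset.sum_nonneg fun b _ => hg b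
  have h1 : ∑ b, ENNReal.ofReal (g b / m) = 1 := by
    rw [← ENNReal.ofReal_sum_of_nonneg fun b _ => div_nonneg (hg b) hm0, ← Finset.sum_div, hgm,
      div_self hm, ENNReal.ofReal_one]
  refine ⟨PMF.ofFintype _ h1, fun b => ?_, fun b hb => ?_⟩
  · rw [PMF.ofFintype_apply, ENNReal.toReal_ofReal (div_nonneg (hg b) hm0)]
  · rintro h2
    rw [PMF.mem_support_iff, PMF.ofFintype_apply, h2, zero_div, ENNReal.ofReal_zero] at hb
    exact hb rfl

variable [Fintype X] [MetricSpace X]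

omit [Fintype X] in
lemma pathCost_snoc {T : ℕ} (A : Fin (T + 1) → Config X k) (B : Config X k) :
    pathCost (Fin.snoc (α := fun _ => Config X k) A B : Fin (T + 2) → Config X k) =
      pathCost A + moveCost (A (Fin.last T)) B := by
  unfold pathCost
  rw [Fin.sum_univ_castSucc]
  congr 1
  · refine Finset.sum_congr rfl fun t _ => ?_
    rw [← Fin.castSucc_succ, Fin.snoc_castSucc, Fin.snoc_castSucc]
  · rw [Fin.snoc_castSucc, Fin.succ_last, Fin.snoc_last]

omit [MetricSpace X] in
lemma sum_snoc {T : ℕ} (F : (Fin (T + 2) → Config X k) → ℝ) :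
    ∑ A, F A = ∑ A : Fin (T + 1) → Config X k, ∑ B, F (Fin.snoc (α := fun _ => Config X k) A B) := by
  rw [← (Fin.snocEquiv fun _ : Fin (T + 2) => Config X k).sum_comp, Fintype.sum_prod_type_right]
  rfl

omit [Fintype X] [MetricSpace X] in
lemma law_succ_snoc (alg : RandomizedServerAlgorithm X k) (A₀ : Config X k) (r : ℕ → X) (t : ℕ)
    (A : Fin (t + 1) → Config X k) (B : Config X k) :
    (alg.law A₀ r (t + 1) (Fin.snoc (α := fun _ => Config X k) A B)).toReal =
      (alg.law A₀ r t A).toReal * (alg.next t (fun i => r i) A B).toReal := by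
  classical
  have hinj : ∀ A' B', (Fin.snoc (α := fun _ => Config X k) A B : Fin (t + 2) → Config X k) =
      Fin.snoc (α := fun _ => Config X k) A' B' → A = A' ∧ B = B' := fun A' B' h =>
    Fin.snoc_inj.1 h
  rw [← ENNReal.toReal_mul]
  congr 1
  rw [RandomizedServerAlgorithm.law, PMF.bind_apply, tsum_eq_single A]
  · congr 1
    rw [PMF.map_apply, tsum_eq_single B]
    · simp
    · intro B' hB'
      rw [if_neg fun h => hB' (hinj _ _ h).2.symm]
  · intro A' hA'
    rw [PMF.map_apply, ENNReal.tsum_eq_zero.2, mul_zero]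
    intro B'
    rw [if_neg fun h => hA' (hinj _ _ h).1.symm]

open Classical in
/-- A consistent family of couplings of distributions on configurations defines a randomized
online algorithm whose expected cost is the sum of the costs of the couplings. -/
lemma exists_algorithm_of_config_couplings (hk : 1 ≤ k) {Q : Type*} (q₀ : Q) (step : Q → X → Q)
    (μ : Q → Config X k → ℝ) (γ : Q → X → Config X k → Config X k → ℝ)
    (hγ0 : ∀ q r S S', 0 ≤ γ q r S S') (hγ1 : ∀ q r S, ∑ S', γ q r S S' = μ q S)
    (hγ2 : ∀ q r S', ∑ S, γ q r S S' = μ (step q r) S')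
    (hserve : ∀ q r S S', γ q r S S' ≠ 0 → r ∈ S'.1) (A₀ : Config X k)
    (h0 : ∀ S, μ q₀ S = if S = A₀ then 1 else 0) :
    ∃ alg : RandomizedServerAlgorithm X k, ∀ (r : ℕ → X) (T : ℕ), alg.expectedCost A₀ r T =
      ∑ t ∈ Finset.range T, ∑ S, ∑ S', γ (runState q₀ step r t) (r t) S S' * moveCost S S' := by
  -- Any extension of the finite history to a sequence will do: the state at time `t` reads only
  -- earlier requests. Here indices wrap around modulo `t + 1`.
  set ext : ∀ t : ℕ, (Fin (t + 1) → X) → ℕ → X := fun t ρ i => ρ (Fin.ofNat (t + 1) i) with hext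
  have hext' : ∀ t (r : ℕ → X) i, i ≤ t → ext t (fun i => r i) i = r i := by
    intro t r i hi
    simp only [hext, Fin.ofNat]
    rw [Nat.mod_eq_of_lt (by omega)]
  have hnext : ∀ (t : ℕ) (ρ : Fin (t + 1) → X) (A : Fin (t + 1) → Config X k),
      ∃ P : PMF (Config X k), (∀ S ∈ P.support, ρ (Fin.last t) ∈ S.1) ∧
        (μ (runState q₀ step (ext t ρ) t) (A (Fin.last t)) ≠ 0 → ∀ S, (P S).toReal =
          γ (runState q₀ step (ext t ρ) t) (ρ (Fin.last t)) (A (Fin.last t)) S /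
            μ (runState q₀ step (ext t ρ) t) (A (Fin.last t))) := by
    intro t ρ A
    by_cases hm : μ (runState q₀ step (ext t ρ) t) (A (Fin.last t)) ≠ 0
    · obtain ⟨P, hP1, hP2⟩ := exists_conditional_pmf hm
        (hγ0 (runState q₀ step (ext t ρ) t) (ρ (Fin.last t)) (A (Fin.last t))) (hγ1 _ _ _)
      exact ⟨P, fun S hS => hserve _ _ _ _ (hP2 S hS), fun _ => hP1⟩
    -- A configuration of probability zero under the marginal: any answer containing the request is
    -- allowed.
    · obtain ⟨S, hS⟩ := exists_config_mem hk (A 0) (ρ (Fin.last t))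
      refine ⟨PMF.pure S, fun S' hS' => ?_, fun h => absurd h hm⟩
      rw [PMF.support_pure, Set.mem_singleton_iff] at hS'
      rw [hS']; exact hS
  choose next hn1 hn2 using hnext
  set alg : RandomizedServerAlgorithm X k := ⟨next, hn1⟩ with halg
  have hnextr : ∀ (r : ℕ → X) t (A : Fin (t + 1) → Config X k),
      μ (runState q₀ step r t) (A (Fin.last t)) ≠ 0 → ∀ S,
      (alg.next t (fun i => r i) A S).toReal =
        γ (runState q₀ step r t) (r t) (A (Fin.last t)) S /
          μ (runState q₀ step r t) (A (Fin.last t)) := by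
    intro r t A
    have h1 := hn2 t (fun i => r i) A
    rwa [runState_congr (r' := r) q₀ step t fun i hi => hext' t r i hi.le] at h1
  -- The last configuration of the constructed process has law `μ` of the current state. So
  -- transitions depending on that configuration alone reproduce the couplings.
  have hmarg : ∀ (r : ℕ → X) t (F : Config X k → ℝ),
      ∑ A, (alg.law A₀ r t A).toReal * F (A (Fin.last t)) =
        ∑ S, μ (runState q₀ step r t) S * F S := by
    intro r t
    induction t with
    | zero =>
      intro F
      simp only [runState, h0, ite_mul, one_mul, zero_mul, Finset.sum_ite_eq', Finset.mem_univ,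
        if_true]
      rw [Finset.sum_eq_single (fun _ => A₀)]
      · simp [RandomizedServerAlgorithm.law]
      · intro A _ hA
        rw [RandomizedServerAlgorithm.law, PMF.pure_apply, if_neg hA]
        simp
      · simp
    | succ t ih =>
      intro F
      rw [sum_snoc]
      simp only [law_succ_snoc, Fin.snoc_last, mul_assoc, ← Finset.mul_sum]
      set G : Config X k → ℝ := fun S => ∑ S', γ (runState q₀ step r t) (r t) S S' /
          μ (runState q₀ step r t) S * F S' with hG
      have h1 : ∀ A : Fin (t + 1) → Config X k, (alg.law A₀ r t A).toReal *
          ∑ B, (alg.next t (fun i => r i) A B).toReal * F B =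
          (alg.law A₀ r t A).toReal * G (A (Fin.last t)) := by
        intro A
        by_cases hA : μ (runState q₀ step r t) (A (Fin.last t)) ≠ 0
        · congr 1
          exact Finset.sum_congr rfl fun B _ => by rw [hnextr r t A hA]
        · have h2 := ih fun S => if S = A (Fin.last t) then 1 else 0
          simp only [mul_ite, mul_one, mul_zero, Finset.sum_ite_eq', Finset.mem_univ, if_true] at h2
          push Not at hA
          rw [hA, Finset.sum_eq_zero_iff_of_nonneg fun A' _ => by
            split_ifs
            · exact ENNReal.toReal_nonneg
            · exact le_rfl] at h2
          have h3 := h2 A (Finset.mem_univ _)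
          rw [if_pos rfl] at h3
          rw [h3, zero_mul, zero_mul]
      rw [Finset.sum_congr rfl fun A _ => h1 A, ih]
      have h4 : ∀ S, μ (runState q₀ step r t) S * G S =
          ∑ S', γ (runState q₀ step r t) (r t) S S' * F S' := by
        intro S
        by_cases hS : μ (runState q₀ step r t) S = 0
        · have h5 := hγ1 (runState q₀ step r t) (r t) S
          rw [hS, Finset.sum_eq_zero_iff_of_nonneg fun S' _ => hγ0 _ _ _ _] at h5
          rw [hS, zero_mul, Finset.sum_eq_zero fun S' hS' => by rw [h5 S' hS', zero_mul]]
        · rw [hG, Finset.mul_sum]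
          refine Finset.sum_congr rfl fun S' _ => ?_
          field_simp
      simp only [h4]
      rw [Finset.sum_comm]
      simp only [← Finset.sum_mul, hγ2]
      rfl
  refine ⟨alg, fun r T => ?_⟩
  induction T with
  | zero =>
    simp [RandomizedServerAlgorithm.expectedCost, pathCost]
  | succ T ih =>
    rw [Finset.sum_range_succ, ← ih]
    unfold RandomizedServerAlgorithm.expectedCost
    rw [sum_snoc]
    simp only [law_succ_snoc, pathCost_snoc, mul_assoc, ← Finset.mul_sum]
    set G : Config X k → ℝ := fun S => ∑ S', γ (runState q₀ step r T) (r T) S S' /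
          μ (runState q₀ step r T) S * moveCost S S' with hG
    have h1 : ∀ A : Fin (T + 1) → Config X k, (alg.law A₀ r T A).toReal *
        ∑ B, (alg.next T (fun i => r i) A B).toReal * (pathCost A + moveCost (A (Fin.last T)) B) =
        (alg.law A₀ r T A).toReal * pathCost A +
          (alg.law A₀ r T A).toReal * G (A (Fin.last T)) := by
      intro A
      have hp1 : ∑ B, (alg.next T (fun i => r i) A B).toReal = 1 := by
        rw [← ENNReal.toReal_sum fun B _ => PMF.apply_ne_top _ _, ← tsum_fintype (L := .unconditional _), PMF.tsum_coe,
          ENNReal.toReal_one]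
      simp only [mul_add, Finset.sum_add_distrib, ← Finset.sum_mul, hp1, one_mul]
      congr 1
      by_cases hA : μ (runState q₀ step r T) (A (Fin.last T)) ≠ 0
      · congr 1
        exact Finset.sum_congr rfl fun B _ => by rw [hnextr r T A hA]
      · have h2 := hmarg r T fun S => if S = A (Fin.last T) then 1 else 0
        simp only [mul_ite, mul_one, mul_zero, Finset.sum_ite_eq', Finset.mem_univ, if_true] at h2
        push Not at hA
        rw [hA, Finset.sum_eq_zero_iff_of_nonneg fun A' _ => by
          split_ifs
          · exact ENNReal.toReal_nonneg
          · exact le_rfl] at h2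
        have h3 := h2 A (Finset.mem_univ _)
        rw [if_pos rfl] at h3
        rw [h3, zero_mul, zero_mul]
    rw [Finset.sum_congr rfl fun A _ => h1 A, Finset.sum_add_distrib, hmarg]
    congr 1
    refine Finset.sum_congr rfl fun S _ => ?_
    by_cases hS : μ (runState q₀ step r T) S = 0
    · have h5 := hγ1 (runState q₀ step r T) (r T) S
      rw [hS, Finset.sum_eq_zero_iff_of_nonneg fun S' _ => hγ0 _ _ _ _] at h5
      rw [hS, zero_mul, Finset.sum_eq_zero fun S' hS' => by rw [h5 S' hS', zero_mul]]
    · rw [hG, Finset.mul_sum]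
      refine Finset.sum_congr rfl fun S' _ => ?_
      field_simp

open Classical in
/-- The same for couplings of distributions on a finite set of states that determine the
configurations. -/
lemma exists_algorithm_of_couplings (hk : 1 ≤ k) {S : Type*} [Fintype S] (f : S → Config X k)
    {Q : Type*} (q₀ : Q) (step : Q → X → Q) (μ : Q → S → ℝ) (γ : Q → X → S → S → ℝ)
    (hγ0 : ∀ q r s s', 0 ≤ γ q r s s') (hγ1 : ∀ q r s, ∑ s', γ q r s s' = μ q s)
    (hγ2 : ∀ q r s', ∑ s, γ q r s s' = μ (step q r) s')
    (hserve : ∀ q r s s', γ q r s s' ≠ 0 → r ∈ (f s').1) (A₀ : Config X k) (s₀ : S)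
    (hs₀ : f s₀ = A₀) (h0 : ∀ s, μ q₀ s = if s = s₀ then 1 else 0) :
    ∃ alg : RandomizedServerAlgorithm X k, ∀ (r : ℕ → X) (T : ℕ), alg.expectedCost A₀ r T =
      ∑ t ∈ Finset.range T, ∑ s, ∑ s', γ (runState q₀ step r t) (r t) s s' *
        moveCost (f s) (f s') := by
  obtain ⟨alg, halg⟩ := exists_algorithm_of_config_couplings hk q₀ step
    (fun q A => ∑ s with f s = A, μ q s)
    (fun q r A B => ∑ s with f s = A, ∑ s' with f s' = B, γ q r s s')
    (fun q r A B => Finset.sum_nonneg fun s _ => Finset.sum_nonneg fun s' _ => hγ0 _ _ _ _)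
    (fun q r A => by
      rw [Finset.sum_comm]
      refine Finset.sum_congr rfl fun s _ => ?_
      rw [Finset.sum_fiberwise Finset.univ f fun s' => γ q r s s', hγ1])
    (fun q r B => by
      rw [Finset.sum_fiberwise Finset.univ f fun s => ∑ s' with f s' = B, γ q r s s',
        Finset.sum_comm]
      exact Finset.sum_congr rfl fun s' _ => hγ2 _ _ _)
    (fun q r A B hne => by
      obtain ⟨s, -, h1⟩ := Finset.exists_ne_zero_of_sum_ne_zero hne
      obtain ⟨s', hs', h2⟩ := Finset.exists_ne_zero_of_sum_ne_zero h1
      rw [← (Finset.mem_filter.1 hs').2]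
      exact hserve _ _ _ _ h2)
    A₀ (fun A => by
      simp only [h0, Finset.sum_ite_eq', Finset.mem_filter, Finset.mem_univ, true_and, hs₀]
      exact if_congr eq_comm rfl rfl)
  refine ⟨alg, fun r T => (halg r T).trans (Finset.sum_congr rfl fun t _ => ?_)⟩
  rw [← Finset.sum_fiberwise Finset.univ f]
  refine Finset.sum_congr rfl fun A _ => ?_
  simp only [Finset.sum_mul]
  rw [Finset.sum_comm]
  refine Finset.sum_congr rfl fun s hs => ?_
  rw [← Finset.sum_fiberwise Finset.univ f]
  refine Finset.sum_congr rfl fun B _ => Finset.sum_congr rfl fun s' hs' => ?_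
  rw [(Finset.mem_filter.1 hs).2, (Finset.mem_filter.1 hs').2]

end Algorithm

/-! ### The potential argument for the competitive ratio -/

section Competitive

variable {X : Type*} {k : ℕ}

lemma exists_embConfig_eq (A : Config X k) : ∃ a : Fin k ↪ X, embConfig a = A := by
  set e := A.1.equivFinOfCardEq A.2
  refine ⟨e.symm.toEmbedding.trans (Function.Embedding.subtype _), Subtype.ext ?_⟩
  ext x
  rw [mem_embConfig]
  constructor
  · rintro ⟨i, rfl⟩
    exact (e.symm i).2
  · intro hx
    exact ⟨e ⟨x, hx⟩, by simp⟩

/-- Here `(1 + δ) / δ = 4k + 1 ≤ (k + 1)^3`, `1 + δ ≤ 5/4` and `1 ≤ 2 log (k + 1)`; in total `15/4 +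
2 ≤ 6`. -/
lemma entropy_factor_le (hk : 1 ≤ k) {δ : ℝ} (hδ : δ = 1 / (4 * k)) :
    (1 + δ) * Real.log ((1 + δ) / δ) + 1 ≤ 6 * Real.log (k + 1) := by
  have hk' : (1 : ℝ) ≤ k := by exact_mod_cast hk
  have hδ4 : δ ≤ 1 / 4 := by
    rw [hδ]; exact one_div_le_one_div_of_le (by norm_num) (by linarith)
  have hδ0 : 0 < δ := by rw [hδ]; positivity
  have h1 : (1 + δ) / δ = 4 * k + 1 := by rw [hδ]; field_simp
  have h2 : Real.log (4 * k + 1) ≤ 3 * Real.log (k + 1) := by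
    have : Real.log ((k + 1) ^ 3) = 3 * Real.log (k + 1) := by
      rw [Real.log_pow]; norm_num
    rw [← this]
    apply Real.log_le_log (by linarith)
    nlinarith [sq_nonneg ((k : ℝ) - 1)]
  have h3 : 1 / 2 ≤ Real.log (k + 1) := by
    have := Real.log_two_gt_d9
    have h4 : Real.log 2 ≤ Real.log (k + 1) := Real.log_le_log (by norm_num) (by linarith)
    linarith
  rw [h1]
  have h5 : 0 ≤ Real.log (4 * k + 1) := Real.log_nonneg (by linarith)
  nlinarith

variable [MetricSpace X]

/-- A bound against all feasible offline solutions is a bound against the optimum. -/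
lemma le_mul_offlineOpt (hk : 1 ≤ k) (A₀ : Config X k) (r : ℕ → X) (T : ℕ) {E c b : ℝ} (hc : 0 ≤ c)
    (h : ∀ A : Fin (T + 1) → Config X k, IsFeasible A₀ r A → E ≤ c * pathCost A + b) :
    E ≤ c * offlineOpt A₀ r T + b := by
  obtain ⟨A, hA⟩ : ∃ A : Fin (T + 1) → Config X k, IsFeasible A₀ r A := by
    choose S hS using exists_config_mem (X := X) hk A₀
    exact ⟨Fin.cons A₀ fun t : Fin T => S (r t), rfl, fun t => by simpa using hS (r t)⟩
  rcases hc.eq_or_lt with h0 | h0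
  · have := h A hA
    rw [← h0, zero_mul] at this ⊢
    exact this
  · have h1 : (E - b) / c ≤ offlineOpt A₀ r T := by
      refine le_csInf ⟨_, A, hA, rfl⟩ ?_
      rintro _ ⟨A', hA', rfl⟩
      rw [div_le_iff₀ h0]
      linarith [h A' hA']
    rw [div_le_iff₀ h0] at h1
    linarith

variable [Fintype X] {V : Type*} [Fintype V]

/-- Competitive algorithms on trees whose metric is equivalent to that of a hierarchy. -/
theorem exists_competitive_of_hierarchy (T : ParentTree V) (h : Hierarchy V) {σ : ℝ} (hσ : 0 < σ)
    {ψ : X → V} (hψ : ∀ x, ψ x ≠ T.root) (hleaf : ∀ x v, v ≠ T.root → T.par v ≠ ψ x)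
    {C₁ C₂ C₃ : ℝ} (hC₁ : 0 ≤ C₁) (hC₂ : 0 ≤ C₂) (hC₃ : 0 ≤ C₃)
    (hdist : ∀ x y, dist x y ≤ C₁ * h.levelDist σ (ψ x) (ψ y))
    (hpar : ∀ v, v ≠ T.root → h.levelDist σ v (T.par v) ≤ C₂ * T.wt v)
    (hedge : ∀ x y, edgeDist T (ψ x) (ψ y) ≤ C₃ * dist x y)
    {H : ℝ} (hH : ∀ v, (T.dep v : ℝ) ≤ H) (hk : 1 ≤ k) :
    ∃ b : ℝ, ∀ A₀ : Config X k, ∃ alg : RandomizedServerAlgorithm X k,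
      alg.IsCompetitive A₀ (864 * C₁ * C₂ * C₃ * H * Real.log (k + 1)) b := by
  classical
  have hH0 : 0 ≤ H := (Nat.cast_nonneg _).trans (hH T.root)
  have hk' : (1 : ℝ) ≤ k := by exact_mod_cast hk
  have hlog : 0 ≤ Real.log (k + 1) := Real.log_nonneg (by linarith)
  obtain ⟨δ, hδ⟩ : ∃ δ : ℝ, δ = 1 / (4 * k) := ⟨_, rfl⟩
  have hδ0 : 0 < δ := by rw [hδ]; positivity
  set B := (1 + δ) * Real.log ((1 + δ) / δ) + 1 with hB
  have hB6 := entropy_factor_le hk hδ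
  set Ψ : (V × Fin k → ℝ) → ℝ := fun x => ∑ p, (2 * T.dep p.1 - 1) * T.wt p.1 * x p with hΨ
  set W : ℝ := ∑ p : V × Fin k, |(2 * (T.dep p.1 : ℝ) - 1) * T.wt p.1| with hW
  have hΨb : ∀ x x' : V × Fin k → ℝ, (∀ p, 0 ≤ x p) → (∀ p, x p ≤ 1) → (∀ p, 0 ≤ x' p) →
      (∀ p, x' p ≤ 1) → Ψ x' - Ψ x ≤ W := by
    intro x x' h1 h2 h3 h4
    rw [hΨ, hW, ← Finset.sum_sub_distrib]
    refine Finset.sum_le_sum fun p _ => ?_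
    rw [← mul_sub]
    refine (le_abs_self _).trans ?_
    rw [abs_mul]
    refine mul_le_of_le_one_right (abs_nonneg _) (abs_le.2 ⟨?_, ?_⟩) <;>
      linarith [h1 p, h2 p, h3 p, h4 p]
  -- The additive term is the largest possible change of the linear potential `Ψ` on states in `[0,
  -- 1]`; it depends neither on `A₀` nor on the requests.
  refine ⟨24 * C₁ * C₂ * W, fun A₀ => ?_⟩
  obtain ⟨a₀, ha₀⟩ := exists_embConfig_eq A₀
  set s₀ : Fin k → V := ψ ∘ a₀ with hs₀
  set q₀ : OnlineState X V k := ⟨integralState T k s₀, fun ω => if ω = (a₀, s₀) then 1 else 0⟩ with hq₀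
  have hmass : massAt T (roundedCount δ (integralState T k s₀)) = pointCount s₀ := by
    funext u
    exact massAt_integralState T hk hδ s₀ (by simp) u
  have hval₀ : q₀.Valid T h δ := by
    refine ⟨integralState_mem T s₀ (by simp), integralState_le_one T s₀, fun ω => ?_, ?_,
      fun ω hω => ?_, fun y => ?_⟩
    · simp only [hq₀]; split_ifs <;> norm_num
    · simp [hq₀]
    · simp only [hq₀, ne_eq, ite_eq_right_iff, one_ne_zero, imp_false, not_not] at hω
      rw [hω]
      change h.Near (massAt T (roundedCount δ (integralState T k s₀))) (pointCount s₀)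
      rw [hmass]
      exact fun j _ a => ⟨Int.floor_le _, Int.le_ceil _⟩
    · change _ = massAt T (roundedCount δ (integralState T k s₀)) y
      rw [hmass]
      simp [hq₀]
  choose step γ hstep hγ0 hγ1 hγ2 hserve hcost using fun (q : {q : OnlineState X V k // q.Valid T h δ})
    (r : X) => exists_online_step T h hσ hψ hleaf hC₁ hC₂ hdist hpar hH hk hδ q.2 r
  obtain ⟨alg, halg⟩ := exists_algorithm_of_couplings hk (fun ω : (Fin k ↪ X) × (Fin k → V) =>
    embConfig ω.1) (⟨q₀, hval₀⟩ : {q : OnlineState X V k // q.Valid T h δ})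
    (fun q r => ⟨step q r, hstep q r⟩) (fun q => q.1.μ) γ hγ0 hγ1 hγ2 hserve A₀ (a₀, s₀) ha₀
    (fun ω => by simp only [hq₀]; by_cases hω : ω = (a₀, s₀) <;> simp [hω])
  refine ⟨alg, fun r N => ?_⟩
  refine le_mul_offlineOpt hk A₀ r N (by positivity) fun A hA => ?_
  set A' : ℕ → Config X k := fun t => if ht : t < N + 1 then A ⟨t, ht⟩ else A₀ with hA'
  have hpath : pathCost A = ∑ t ∈ Finset.range N, moveCost (A' t) (A' (t + 1)) := by
    unfold pathCost
    rw [← Fin.sum_univ_eq_sum_range (fun t => moveCost (A' t) (A' (t + 1)))]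
    refine Finset.sum_congr rfl fun t _ => ?_
    simp only [hA']
    rw [dif_pos (by omega), dif_pos (by omega)]
    rfl
  have hA'0 : A' 0 = A₀ := by
    simp only [hA']; rw [dif_pos (by omega)]; exact hA.1
  have hA'r : ∀ t < N, r t ∈ (A' (t + 1)).1 := by
    intro t ht
    simp only [hA']
    rw [dif_pos (by omega)]
    exact hA.2 ⟨t, ht⟩
  set st := runState (⟨q₀, hval₀⟩ : {q : OnlineState X V k // q.Valid T h δ})
    (fun q r => ⟨step q r, hstep q r⟩) r with hst
  set y : Config X k → V × Fin k → ℝ := fun A => integralState T k fun x : A.1 => ψ x with hy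
  have hymove : ∀ (A B : Config X k) (x : V × Fin k → ℝ), (∀ p, 0 ≤ x p) → (∀ p, x p ≤ 1) →
      entropyDiv T δ (y B) x ≤ entropyDiv T δ (y A) x +
        6 * Real.log (k + 1) * (C₃ * moveCost A B) := by
    intro A B x hx hx1
    have hne : Nonempty ({x // x ∈ A.1} ≃ {x // x ∈ B.1}) := ⟨Finset.equivOfCardEq (by rw [A.2, B.2])⟩
    have h1 : ∑ u, T.wt u * |(serversBelow T (fun x : B.1 => ψ x) u : ℝ) -
        serversBelow T (fun x : A.1 => ψ x) u| ≤ C₃ * moveCost A B := by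
      unfold moveCost
      rw [Real.mul_iInf_of_nonneg hC₃]
      refine le_ciInf fun e => (sum_wt_abs_serversBelow_sub_le T _ _ e).trans ?_
      rw [Finset.mul_sum]
      exact Finset.sum_le_sum fun i _ => hedge _ _
    refine (entropyDiv_integralState_le T hδ0 hx hx1 (fun x : A.1 => ψ x)
      (fun x : B.1 => ψ x)).trans ?_
    refine add_le_add le_rfl (mul_le_mul hB6 h1 (Finset.sum_nonneg fun u _ =>
      mul_nonneg (T.wt_pos u).le (abs_nonneg _)) (by positivity))
  -- Both states describe the same servers with different index types, so all server counts agree.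
  have hinit : entropyDiv T δ (y A₀) q₀.x ≤ 0 := by
    have h1 := entropyDiv_integralState_le T hδ0 (integralState_nonneg (k := k) T s₀)
      (integralState_le_one (k := k) T s₀) s₀ (fun x : A₀.1 => ψ x)
    have h2 : entropyDiv T δ (integralState T k s₀) (integralState T k s₀) = 0 := by
      unfold entropyDiv
      exact Finset.sum_eq_zero fun p _ => by
        rw [klTerm_self hδ0 (integralState_nonneg T s₀ p), mul_zero]
    subst ha₀
    have h3 := sum_wt_abs_serversBelow_sub_le T s₀ (fun x : (embConfig a₀).1 => ψ x)
      (embConfigEquiv a₀)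
    have h4 : ∑ i, edgeDist T (s₀ i) (ψ (embConfigEquiv a₀ i)) = 0 :=
      Finset.sum_eq_zero fun i _ => by
        have : (embConfigEquiv a₀ i : X) = a₀ i := rfl
        simp [hs₀, this, edgeDist]
    rw [h4] at h3
    have hB0 : 0 ≤ B := (klTerm_nonneg hδ0 le_rfl le_rfl).trans
      (klTerm_le (a := 0) (b := 0) hδ0 le_rfl zero_le_one le_rfl zero_le_one)
    rw [h2, zero_add] at h1
    exact h1.trans (mul_nonpos_of_nonneg_of_nonpos hB0 h3)
  have hlag0 : q₀.lag (h.levelDist σ) ψ = 0 := by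
    unfold OnlineState.lag
    refine Finset.sum_eq_zero fun ω _ => ?_
    simp only [hq₀, ite_mul, one_mul, zero_mul, ite_eq_right_iff]
    rintro rfl
    exact Finset.sum_eq_zero fun i _ => h.levelDist_self σ _
  -- The potential combines the lag, the linear functional `Ψ` and the divergence to the offline
  -- configuration. In each round the offline solution moves first, raising only the divergence; the
  -- online step is then paid for against the new offline configuration, which serves the request.
  have key : ∀ t ≤ N, ∑ i ∈ Finset.range t, ∑ ω, ∑ ω', γ (st i) (r i) ω ω' *
      moveCost (embConfig ω.1) (embConfig ω'.1) ≤
      - C₁ * (st t).1.lag (h.levelDist σ) ψ + 24 * C₁ * C₂ * (Ψ (st t).1.x - Ψ q₀.x) +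
      144 * C₁ * C₂ * H * (6 * Real.log (k + 1) * C₃ *
        ∑ i ∈ Finset.range t, moveCost (A' i) (A' (i + 1)) - entropyDiv T δ (y (A' t)) (st t).1.x) := by
    intro t
    induction t with
    | zero =>
      intro _
      have e0 : (st 0).1 = q₀ := rfl
      simp only [Finset.range_zero, Finset.sum_empty, e0, hlag0, hA'0]
      have : 0 ≤ 144 * C₁ * C₂ * H * -entropyDiv T δ (y A₀) q₀.x :=
        mul_nonneg (by positivity) (by linarith)
      linarith
    | succ t ih =>
      intro ht
      have h1 := ih (by omega)
      have h2 := hcost (st t) (r t) (A' (t + 1)) (hA'r t (by omega))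
      have e1 : (st (t + 1)).1 = step (st t) (r t) := rfl
      have h3 := hymove (A' t) (A' (t + 1)) (st t).1.x (st t).2.mem.1 (st t).2.le_one
      have h4 := mul_le_mul_of_nonneg_left h3 (show 0 ≤ 144 * C₁ * C₂ * H by positivity)
      have e2 : ∑ p, (2 * (T.dep p.1 : ℝ) - 1) * T.wt p.1 * ((step (st t) (r t)).x p - (st t).1.x p) =
          Ψ (step (st t) (r t)).x - Ψ (st t).1.x := by
        rw [hΨ, ← Finset.sum_sub_distrib]
        exact Finset.sum_congr rfl fun p _ => by ring
      rw [e2] at h2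
      rw [Finset.sum_range_succ, Finset.sum_range_succ, e1]
      change _ ≤ C₁ * _ + 24 * C₁ * C₂ * (_ + 6 * H * (entropyDiv T δ (y (A' (t + 1))) _ -
        entropyDiv T δ (y (A' (t + 1))) _)) at h2
      linarith
  rw [halg r N]
  refine (key N le_rfl).trans ?_
  rw [← hpath]
  have h1 : 0 ≤ C₁ * (st N).1.lag (h.levelDist σ) ψ :=
    mul_nonneg hC₁ (Finset.sum_nonneg fun ω _ => mul_nonneg ((st N).2.nonneg ω)
      (Finset.sum_nonneg fun i _ => h.levelDist_nonneg hσ.le _ _))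
  have h2 := mul_le_mul_of_nonneg_left (hΨb q₀.x (st N).1.x hval₀.mem.1 hval₀.le_one (st N).2.mem.1
    (st N).2.le_one) (show 0 ≤ 24 * C₁ * C₂ by positivity)
  have h3 : 0 ≤ 144 * C₁ * C₂ * H * entropyDiv T δ (y (A' N)) (st N).1.x :=
    mul_nonneg (by positivity) (entropyDiv_nonneg T hδ0 (integralState_nonneg T _) (st N).2.mem.1)
  linarith

end Competitive

/-! ### Hierarchies from HSTs -/

section EdgeDist

variable {V : Type*} [Fintype V] (T : ParentTree V)

lemma edgeDist_self (u : V) : edgeDist T u u = 0 := by simp [edgeDist]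

lemma edgeDist_nonneg (u v : V) : 0 ≤ edgeDist T u v :=
  Finset.sum_nonneg fun a _ => mul_nonneg (T.wt_pos a).le (abs_nonneg _)

lemma edgeDist_comm (u v : V) : edgeDist T u v = edgeDist T v u := by
  unfold edgeDist
  exact Finset.sum_congr rfl fun a _ => by rw [abs_sub_comm]

lemma edgeDist_triangle (u v w : V) : edgeDist T u w ≤ edgeDist T u v + edgeDist T v w := by
  unfold edgeDist
  rw [← Finset.sum_add_distrib]
  refine Finset.sum_le_sum fun a _ => ?_
  rw [← mul_add]
  exact mul_le_mul_of_nonneg_left (abs_sub_le _ _ _) (T.wt_pos a).le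

lemma edgeDist_par {v : V} (hv : v ≠ T.root) : edgeDist T v (T.par v) = T.wt v := by
  classical
  unfold edgeDist
  rw [Finset.sum_eq_single v]
  · rw [ancInd_eq T v hv]; simp
  · intro a _ ha
    rw [ancInd_eq T a hv]; simp [ha]
  · simp

lemma wt_le_edgeDist {u v a : V} (hu : IsAnc T a u) (hv : ¬ IsAnc T a v) :
    T.wt a ≤ edgeDist T u v := by
  unfold edgeDist
  refine le_trans (le_of_eq ?_) (Finset.single_le_sum (f := fun a => T.wt a *
    |ancInd T a u - ancInd T a v|) (fun a _ => mul_nonneg (T.wt_pos a).le (abs_nonneg _))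
    (Finset.mem_univ a))
  simp [ancInd, hu, hv]

omit [Fintype V] in
lemma IsAnc.eq_of_dep_le {T : ParentTree V} {a v : V} (h : IsAnc T a v) (hd : T.dep v ≤ T.dep a) :
    a = v := by
  by_cases hv : v = T.root
  · rw [hv, isAnc_root_iff] at h
    rw [h, hv]
  · rcases (isAnc_iff T).1 h with h1 | h1
    · exact h1
    · have := h1.dep_le
      have := T.dep_par v hv
      omega

lemma exists_wt_le_edgeDist {u v : V} (huv : u ≠ v) : ∃ a, T.wt a ≤ edgeDist T u v := by
  by_cases h1 : IsAnc T u v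
  · have h2 : ¬ IsAnc T v u := fun h2 => huv (h1.eq_of_dep_le h2.dep_le)
    exact ⟨v, by rw [edgeDist_comm]; exact wt_le_edgeDist T (isAnc_refl T v) h2⟩
  · exact ⟨u, wt_le_edgeDist T (isAnc_refl T u) h1⟩

end EdgeDist

/-! ### Clusters obtained by contracting short edges -/

section Climb

variable {V : Type*} (T : ParentTree V)

open Classical in
/-- The first vertex on the way from `v` to the root that is the root or satisfies `P`. -/
noncomputable def climb (P : V → Prop) (v : V) : V :=
  if _h : v = T.root ∨ P v then v else climb P (T.par v)
termination_by T.dep v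
decreasing_by
  push Not at _h
  have := T.dep_par v _h.1
  omega

variable {T}

lemma climb_of_pos {P : V → Prop} {v : V} (h : v = T.root ∨ P v) : climb T P v = v := by
  rw [climb, dif_pos h]

lemma climb_of_neg {P : V → Prop} {v : V} (h : ¬ (v = T.root ∨ P v)) :
    climb T P v = climb T P (T.par v) := by
  rw [climb, dif_neg h]

lemma climb_climb {P P' : V → Prop} (h : ∀ v, P' v → P v) (v : V) :
    climb T P' (climb T P v) = climb T P' v := by
  induction v using T.induction with
  | root => rw [climb_of_pos (P := P) (Or.inl rfl)]
  | step v hv ih =>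
    by_cases h1 : P v
    · rw [climb_of_pos (P := P) (Or.inr h1)]
    · rw [climb_of_neg (P := P) (by tauto), ih, ← climb_of_neg (P := P') (by have := h v; tauto)]

lemma climb_eq_root {P : V → Prop} (h : ∀ v, ¬ P v) (v : V) : climb T P v = T.root := by
  induction v using T.induction with
  | root => exact climb_of_pos (Or.inl rfl)
  | step v hv ih => rw [climb_of_neg (by have := h v; tauto), ih]

/-- The bound `σ * 2 ^ J` carries the induction: when the next term is still below `w`, the whole
sum is less than twice that term. -/
lemma sum_lt_geometric_le {σ w : ℝ} (hσ : 0 < σ) (hw : 0 ≤ w) (J : ℕ) :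
    ∑ j ∈ Finset.range J, (if σ * 2 ^ j < w then σ * 2 ^ j else 0) ≤ min (2 * w) (σ * 2 ^ J) := by
  induction J with
  | zero => simp only [Finset.range_zero, Finset.sum_empty, pow_zero, mul_one]; positivity
  | succ J ih =>
    rw [Finset.sum_range_succ]
    rw [le_min_iff] at ih ⊢
    have : 0 < σ * 2 ^ J := by positivity
    rw [pow_succ]
    split_ifs with h <;> constructor <;> linarith

lemma Hierarchy.exists_last_separated {Y : Type*} (h : Hierarchy Y) {x y : Y} (hxy : x ≠ y) :
    ∃ j < h.J, h.c j x ≠ h.c j y ∧ h.c (j + 1) x = h.c (j + 1) y := by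
  classical
  have hex : ∃ j, h.c j x = h.c j y := ⟨h.J, by rw [h.c_top x, h.c_top y]⟩
  obtain ⟨j, hj⟩ : ∃ j, Nat.find hex = j + 1 := Nat.exists_eq_succ_of_ne_zero fun h0 => by
    have h1 := Nat.find_spec hex
    rw [h0, h.c_zero, h.c_zero] at h1
    exact hxy h1
  have h3 : Nat.find hex ≤ h.J := Nat.find_min' hex (by rw [h.c_top x, h.c_top y])
  exact ⟨j, by omega, Nat.find_min hex (by omega), hj ▸ Nat.find_spec hex⟩

variable [Fintype V]

/-- An HST metric is equivalent to the metric of a hierarchy. -/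
lemma exists_hierarchy_of_hst (T : ParentTree V) {τ : ℝ} (hτ : 1 < τ)
    (hT : ∀ v, v ≠ T.root → T.par v ≠ T.root → τ * T.wt v ≤ T.wt (T.par v)) :
    ∃ (h : Hierarchy V) (σ : ℝ), 0 < σ ∧
      (∀ v, v ≠ T.root → h.levelDist σ v (T.par v) ≤ 2 * T.wt v) ∧
      ∀ u v, edgeDist T u v ≤ 4 * τ / (τ - 1) * h.levelDist σ u v := by
  classical
  obtain ⟨vmin, -, hmin⟩ := Finset.exists_min_image Finset.univ T.wt ⟨T.root, Finset.mem_univ _⟩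
  obtain ⟨vmax, -, hmax⟩ := Finset.exists_max_image Finset.univ T.wt ⟨T.root, Finset.mem_univ _⟩
  set σ := T.wt vmin / 2 with hσ
  have hσ0 : 0 < σ := by have := T.wt_pos vmin; positivity
  have hσw : ∀ v, σ < T.wt v := fun v => by
    have := hmin v (Finset.mem_univ v)
    have := T.wt_pos vmin
    linarith
  obtain ⟨J, hJ⟩ := pow_unbounded_of_one_lt (T.wt vmax / σ) (one_lt_two)
  rw [div_lt_iff₀ hσ0] at hJ
  -- An edge is long at level `j` if it exceeds `σ * 2 ^ j`; a cluster is represented by the vertex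
  -- just below its first long edge upwards. By the choice of `σ` all edges are long at level 0, and
  -- by that of `J` none is at level `J`.
  set P : ℕ → V → Prop := fun j v => σ * 2 ^ j < T.wt v with hP
  set h : Hierarchy V :=
    { c := fun j v => climb T (P j) v
      J := J
      top := T.root
      c_zero := fun v => climb_of_pos (Or.inr (by simpa [hP] using hσw v))
      c_comp := fun i j hij v => climb_climb (fun w hw => by
        refine lt_of_le_of_lt ?_ hw
        have : (2 : ℝ) ^ i ≤ 2 ^ j := pow_le_pow_right₀ (by norm_num) hij
        exact mul_le_mul_of_nonneg_left this hσ0.le) v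
      c_top := fun v => climb_eq_root (fun w hw => by
        have h1 : σ * 2 ^ J < T.wt w := hw
        have h2 := hmax w (Finset.mem_univ w)
        linarith) v } with hh
  refine ⟨h, σ, hσ0, fun v hv => ?_, fun u v => ?_⟩
  · refine le_trans ?_ ((sum_lt_geometric_le hσ0 (T.wt_pos v).le J).trans (min_le_left _ _))
    unfold Hierarchy.levelDist
    refine Finset.sum_le_sum fun j _ => ?_
    by_cases hj : σ * 2 ^ j < T.wt v
    · rw [if_pos hj]
      refine mul_le_of_le_one_right (by positivity) ?_
      split_ifs <;> norm_num
    · have : h.c j v = h.c j (T.par v) := climb_of_neg (by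
        rintro (h1 | h1)
        · exact hv h1
        · exact hj h1)
      rw [if_neg hj, if_pos this, mul_zero]
  · have hτ0 : 0 < τ - 1 := by linarith
    -- The short edges climbed grow by the factor `τ` towards the root, so their sum is geometric.
    -- Subtracting `wt v` in the numerator is what lets the induction close.
    have hclimb' : ∀ j v, v ≠ T.root → ¬ P j v →
        edgeDist T v (h.c j v) ≤ (τ * (σ * 2 ^ j) - T.wt v) / (τ - 1) := by
      intro j v
      induction v using T.induction with
      | root => intro h1; exact absurd rfl h1
      | step v hv ih =>
        intro _ hPv
        have e1 : h.c j v = h.c j (T.par v) := climb_of_neg (by tauto)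
        have e2 := edgeDist_triangle T v (T.par v) (h.c j v)
        rw [edgeDist_par T hv] at e2
        have e3 : T.wt v ≤ σ * 2 ^ j := not_lt.1 hPv
        by_cases h2 : T.par v = T.root ∨ P j (T.par v)
        · have e4 : h.c j (T.par v) = T.par v := climb_of_pos h2
          rw [e1, e4, edgeDist_self, add_zero] at e2
          rw [e1, e4]
          refine e2.trans ?_
          rw [le_div_iff₀ hτ0]
          nlinarith
        · push Not at h2
          have e5 := ih h2.1 h2.2
          have e6 := hT v hv h2.1
          rw [← e1] at e5
          refine e2.trans ((add_le_add le_rfl e5).trans ?_)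
          rw [← sub_nonneg]
          have : (τ * (σ * 2 ^ j) - T.wt v) / (τ - 1) -
              (T.wt v + (τ * (σ * 2 ^ j) - T.wt (T.par v)) / (τ - 1)) =
              (T.wt (T.par v) - τ * T.wt v) / (τ - 1) := by
            field_simp
            ring
          rw [this]
          exact div_nonneg (by linarith) hτ0.le
    have hclimb : ∀ j v, edgeDist T v (h.c j v) ≤ τ / (τ - 1) * (σ * 2 ^ j) := by
      intro j v
      by_cases h1 : v = T.root ∨ P j v
      · have : h.c j v = v := climb_of_pos h1
        rw [this, edgeDist_self]
        positivity
      · push Not at h1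
        refine (hclimb' j v h1.1 h1.2).trans ?_
        rw [div_mul_eq_mul_div τ]
        have := T.wt_pos v
        exact div_le_div_of_nonneg_right (by linarith) hτ0.le
    by_cases huv : u = v
    · rw [huv, edgeDist_self, Hierarchy.levelDist_self, mul_zero]
    -- Level `j` still separates the points and contributes `σ * 2 ^ j`, while level `j + 1` joins
    -- them within twice a climb.
    obtain ⟨j, h3, h2, h1⟩ := h.exists_last_separated huv
    have h4 : σ * 2 ^ j ≤ h.levelDist σ u v := by
      refine le_trans (le_of_eq ?_) (Finset.single_le_sum (f := fun j => σ * 2 ^ j *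
        (if h.c j u = h.c j v then 0 else 1)) (fun j _ => by split_ifs <;> positivity)
        (Finset.mem_range.2 h3))
      rw [if_neg h2, mul_one]
    have h5 := edgeDist_triangle T u (h.c (j + 1) u) v
    have h6 := hclimb (j + 1) u
    have h7 := hclimb (j + 1) v
    rw [edgeDist_comm, ← h1] at h7
    have h8 : 4 * τ / (τ - 1) * (σ * 2 ^ j) = 2 * (τ / (τ - 1) * (σ * 2 ^ (j + 1))) := by
      rw [pow_succ]; ring
    have h9 : 0 ≤ 4 * τ / (τ - 1) := by positivity
    have := mul_le_mul_of_nonneg_left h4 h9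
    linarith

end Climb

/-! ### Attaching leaves -/

section AddLeaves

variable {V X : Type*} (T : ParentTree V)

/-- The tree `T` with a new leaf attached to `φ x` for each `x`. -/
def addLeaves (φ : X → V) {ε : ℝ} (hε : 0 < ε) : ParentTree (V ⊕ X) where
  root := Sum.inl T.root
  par := Sum.elim (fun v => Sum.inl (T.par v)) fun x => Sum.inl (φ x)
  dep := Sum.elim T.dep fun x => T.dep (φ x) + 1
  wt := Sum.elim T.wt fun _ => ε
  par_root := by simp [T.par_root]
  dep_root := by simp [T.dep_root]
  dep_par := by
    rintro (v | x) h
    · exact T.dep_par v fun h' => h (by rw [h'])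
    · rfl
  wt_pos := by
    rintro (v | x)
    · exact T.wt_pos v
    · exact hε

variable {T} {φ : X → V} {ε : ℝ} {hε : 0 < ε}

lemma isAnc_addLeaves_inl_inl {a v : V} :
    IsAnc (addLeaves T φ hε) (Sum.inl a) (Sum.inl v) ↔ IsAnc T a v := by
  have : ∀ m, (addLeaves T φ hε).par^[m] (Sum.inl v) = Sum.inl (T.par^[m] v) := by
    intro m
    induction m with
    | zero => rfl
    | succ m ih => rw [Function.iterate_succ_apply', ih, Function.iterate_succ_apply']; rfl
  simp [IsAnc, this]

lemma not_isAnc_addLeaves_inr_inl {x : X} {v : V} :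
    ¬ IsAnc (addLeaves T φ hε) (Sum.inr x) (Sum.inl v) := by
  induction v using T.induction with
  | root =>
    change ¬ IsAnc (addLeaves T φ hε) (Sum.inr x) (addLeaves T φ hε).root
    rw [isAnc_root_iff]
    exact Sum.inr_ne_inl
  | step v hv ih =>
    rw [isAnc_iff]
    push Not
    exact ⟨Sum.inr_ne_inl, ih⟩

lemma isAnc_addLeaves_inl_inr {a : V} {x : X} :
    IsAnc (addLeaves T φ hε) (Sum.inl a) (Sum.inr x) ↔ IsAnc T a (φ x) := by
  rw [isAnc_iff, ← isAnc_addLeaves_inl_inl (φ := φ) (hε := hε)]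
  simp [addLeaves]

lemma isAnc_addLeaves_inr_inr {z x : X} :
    IsAnc (addLeaves T φ hε) (Sum.inr z) (Sum.inr x) ↔ z = x := by
  rw [isAnc_iff, Sum.inr.injEq]
  exact or_iff_left not_isAnc_addLeaves_inr_inl

lemma edgeDist_addLeaves [Fintype V] [Fintype X] {x y : X} (hxy : x ≠ y) :
    edgeDist (addLeaves T φ hε) (Sum.inr x) (Sum.inr y) = edgeDist T (φ x) (φ y) + 2 * ε := by
  classical
  unfold edgeDist
  rw [Fintype.sum_sum_type]
  congr 1
  · refine Finset.sum_congr rfl fun a _ => ?_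
    simp only [ancInd, isAnc_addLeaves_inl_inr]
    rfl
  · simp only [ancInd, isAnc_addLeaves_inr_inr]
    have : ∀ z : X, (addLeaves T φ hε).wt (Sum.inr z) *
        |(if z = x then (1 : ℝ) else 0) - if z = y then 1 else 0| =
        (if z = x then ε else 0) + if z = y then ε else 0 := by
      intro z
      change ε * _ = _
      by_cases h1 : z = x
      · subst h1; simp [hxy]
      · by_cases h2 : z = y
        · subst h2; simp [h1]
        · simp [h1, h2]
    rw [Finset.sum_congr rfl fun z _ => this z, Finset.sum_add_distrib]
    simp
    ring

/-- Competitive algorithms on metric spaces that are equivalent to HST metrics. -/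
theorem exists_competitive_of_hst [Fintype V] [Fintype X] [MetricSpace X] (T : ParentTree V) {τ : ℝ}
    (hτ : 1 < τ) (hT : ∀ v, v ≠ T.root → T.par v ≠ T.root → τ * T.wt v ≤ T.wt (T.par v))
    {φ : X → V} (hφ : Function.Injective φ) {C₁ C₃ : ℝ} (hC₁ : 0 ≤ C₁) (hC₃ : 0 ≤ C₃)
    (hdist : ∀ x y, dist x y ≤ C₁ * edgeDist T (φ x) (φ y))
    (hedge : ∀ x y, edgeDist T (φ x) (φ y) ≤ C₃ * dist x y)
    {H : ℝ} (hH : ∀ v, (T.dep v : ℝ) ≤ H) {k : ℕ} (hk : 1 ≤ k) :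
    ∃ b : ℝ, ∀ A₀ : Config X k, ∃ alg : RandomizedServerAlgorithm X k,
      alg.IsCompetitive A₀
        (864 * (C₁ * (4 * τ / (τ - 1))) * 2 * (3 * C₃) * (H + 1) * Real.log (k + 1)) b := by
  classical
  obtain ⟨vmin, -, hmin⟩ := Finset.exists_min_image Finset.univ T.wt ⟨T.root, Finset.mem_univ _⟩
  have hτ0 : 0 < τ := by linarith
  -- The fractional algorithm serves leaves only, while points may be inner vertices. Attached leaf
  -- edges of this length respect the ratio `τ` and add `2 * ε`, at most twice the distance of two
  -- distinct points; hence the factor 3 before `C₃`.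
  obtain ⟨ε, hεe⟩ : ∃ ε, ε = T.wt vmin / τ := ⟨_, rfl⟩
  have hε : 0 < ε := hεe ▸ div_pos (T.wt_pos vmin) hτ0
  have hετ : τ * ε = T.wt vmin := by rw [hεe]; field_simp
  have hεw : ∀ v, ε ≤ T.wt v := fun v => by
    have := hmin v (Finset.mem_univ v)
    nlinarith
  set T' := addLeaves T φ hε with hT'
  obtain ⟨h, σ, hσ, hpar, hlev⟩ := exists_hierarchy_of_hst T' hτ (by
    rintro (v | x) h1 h2
    · exact hT v (fun h => h1 (by rw [h]; rfl)) (fun h => h2 (by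
        change Sum.inl (T.par v) = Sum.inl T.root
        rw [h]))
    · change τ * ε ≤ T.wt (φ x)
      rw [hετ]
      exact hmin _ (Finset.mem_univ _))
  have hedge' : ∀ x y, x ≠ y → 2 * ε ≤ 2 * edgeDist T (φ x) (φ y) := by
    intro x y hxy
    obtain ⟨a, ha⟩ := exists_wt_le_edgeDist T (hφ.ne hxy)
    linarith [hεw a]
  refine exists_competitive_of_hierarchy T' h hσ (ψ := Sum.inr) (fun x => Sum.inr_ne_inl)
    ?_ (by have : 0 < τ - 1 := by linarith
           positivity) (by norm_num) (by positivity) ?_ hpar ?_ ?_ hk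
  · rintro x (v | y) - h1
    · exact Sum.inl_ne_inr h1
    · exact Sum.inl_ne_inr h1
  · intro x y
    by_cases hxy : x = y
    · rw [hxy, dist_self, Hierarchy.levelDist_self, mul_zero]
    · refine (hdist x y).trans ?_
      rw [mul_assoc]
      refine mul_le_mul_of_nonneg_left ?_ hC₁
      have := hlev (Sum.inr x) (Sum.inr y)
      rw [edgeDist_addLeaves hxy] at this
      linarith
  · intro x y
    by_cases hxy : x = y
    · rw [hxy, dist_self, edgeDist_self, mul_zero]
    · rw [edgeDist_addLeaves hxy]
      linarith [hedge' x y hxy, hedge x y]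
  · rintro (v | x)
    · change (T.dep v : ℝ) ≤ _
      linarith [hH v]
    · change ((T.dep (φ x) + 1 : ℕ) : ℝ) ≤ _
      push_cast
      linarith [hH (φ x)]

end AddLeaves

/-! ### Recursion for tree distances -/

section PairInduction

variable {V : Type*} (T : ParentTree V)

/-- Induction on pairs of vertices, moving the deeper one of two distinct vertices to its parent. -/
lemma ParentTree.pair_induction {P : V → V → Prop} (refl : ∀ u, P u u)
    (symm : ∀ u v, P u v → P v u)
    (step : ∀ u v, u ≠ T.root → ¬ IsAnc T u v → P (T.par u) v → P u v) (u v : V) : P u v := by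
  induction hn : T.dep u + T.dep v using Nat.strong_induction_on generalizing u v with
  | _ n ih =>
    have key : ∀ u v, T.dep u + T.dep v = n → u ≠ v → T.dep v ≤ T.dep u → P u v := by
      intro u v hn huv hd
      have hu : u ≠ T.root := by
        rintro rfl
        rw [T.dep_root] at hd
        by_cases hv : v = T.root
        · exact huv hv.symm
        · have := T.dep_par v hv
          omega
      exact step u v hu (fun h => huv (h.eq_of_dep_le hd))
        (ih (T.dep (T.par u) + T.dep v) (by have := T.dep_par u hu; omega) _ _ rfl)
    by_cases huv : u = v
    · exact huv ▸ refl u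
    rcases le_total (T.dep v) (T.dep u) with hd | hd
    · exact key u v hn huv hd
    · exact symm _ _ (key v u (by omega) (Ne.symm huv) hd)

variable [Fintype V]

lemma edgeDist_of_not_isAnc {u v : V} (hu : u ≠ T.root) (hvu : ¬ IsAnc T u v) :
    edgeDist T u v = T.wt u + edgeDist T (T.par u) v := by
  classical
  unfold edgeDist
  rw [← Finset.add_sum_erase _ _ (Finset.mem_univ u),
    ← Finset.add_sum_erase (a := u) _ (fun a => T.wt a * |ancInd T a (T.par u) - ancInd T a v|)
      (Finset.mem_univ u), ← add_assoc]
  have hpu : ¬ IsAnc T u (T.par u) := fun h => by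
    have := h.dep_le
    have := T.dep_par u hu
    omega
  congr 1
  · simp [ancInd, hvu, hpu, isAnc_refl]
  · refine Finset.sum_congr rfl fun a ha => ?_
    rw [ancInd_eq T a hu, if_neg (Finset.ne_of_mem_erase ha), zero_add]

lemma Hierarchy.levelDist_le_edgeDist (h : Hierarchy V) {σ C : ℝ} (hσ : 0 ≤ σ)
    (hC : ∀ v, v ≠ T.root → h.levelDist σ v (T.par v) ≤ C * T.wt v) (u v : V) :
    h.levelDist σ u v ≤ C * edgeDist T u v := by
  refine T.pair_induction (P := fun u v => h.levelDist σ u v ≤ C * edgeDist T u v) ?_ ?_ ?_ u v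
  · intro u
    rw [h.levelDist_self, edgeDist_self, mul_zero]
  · intro u v huv
    rwa [h.levelDist_comm, edgeDist_comm]
  · intro u v hu huv ih
    rw [edgeDist_of_not_isAnc T hu huv, mul_add]
    exact (h.levelDist_triangle hσ u (T.par u) v).trans (add_le_add (hC u hu) ih)

end PairInduction

/-! ### The parent function of a tree given as a graph -/

section GraphTree

variable {V : Type*} {G : SimpleGraph V} {root : V} {len : Sym2 V → ℝ} {τ : ℝ}

lemma exists_isChild (hG : G.IsTree) {v : V} (hv : v ≠ root) : ∃ u, IsChild G root u v := by
  obtain ⟨p, hp⟩ := hG.connected.exists_walk_length_eq_dist v root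
  cases p with
  | nil => exact absurd rfl hv
  | @cons _ u _ h q =>
    refine ⟨u, h.symm, ?_⟩
    have h1 : G.dist u root ≤ q.length := SimpleGraph.dist_le q
    rw [SimpleGraph.Walk.length_cons] at hp
    rw [SimpleGraph.dist_comm] at hp h1
    rcases hG.dist_eq_dist_add_one_of_adj root h with h2 | h2
    · exact h2
    · omega

lemma IsChild.unique (hG : G.IsTree) {u u' v : V} (h : IsChild G root u v)
    (h' : IsChild G root u' v) : u = u' := by
  obtain ⟨p, hp⟩ := hG.connected.exists_walk_length_eq_dist root u
  obtain ⟨p', hp'⟩ := hG.connected.exists_walk_length_eq_dist root u'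
  have h1 : (p.concat h.1).IsPath := SimpleGraph.Walk.isPath_of_length_eq_dist _ (by
    rw [SimpleGraph.Walk.length_concat, hp, h.2])
  have h2 : (p'.concat h'.1).IsPath := SimpleGraph.Walk.isPath_of_length_eq_dist _ (by
    rw [SimpleGraph.Walk.length_concat, hp', h'.2])
  have h3 := congrArg (fun q => q.1.penultimate)
    ((hG.isAcyclic.subsingleton_path _ _).elim ⟨p.concat h.1, h1⟩ ⟨p'.concat h'.1, h2⟩)
  simpa using h3

lemma isChild_or_isChild (hG : G.IsTree) {u v : V} (h : G.Adj u v) :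
    IsChild G root u v ∨ IsChild G root v u := by
  rcases hG.dist_eq_dist_add_one_of_adj root h with h1 | h1
  · exact Or.inr ⟨h.symm, h1⟩
  · exact Or.inl ⟨h, h1⟩

lemma treeDist_le_sum_edges (hlen : ∀ e ∈ G.edgeSet, 0 ≤ len e) {u v : V} (p : G.Walk u v) :
    treeDist G len u v ≤ (p.edges.map len).sum := by
  classical
  have hnn : ∀ {u v : V} (q : G.Walk u v), ∀ x ∈ q.edges.map len, 0 ≤ x := by
    intro u v q x hx
    obtain ⟨e, he, rfl⟩ := List.mem_map.1 hx
    exact hlen e (q.edges_subset_edgeSet he)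
  refine (ciInf_le ⟨0, ?_⟩ p.toPath).trans ?_
  · rintro _ ⟨q, rfl⟩
    exact List.sum_nonneg (hnn q.1)
  · obtain ⟨l, hl, hs⟩ := List.subperm_of_subset p.toPath.2.isTrail.edges_nodup
      p.edges_toPath_subset_edges
    rw [← (hl.map len).sum_eq]
    exact (hs.map len).sum_le_sum (hnn p)

/-- By the triangle inequality every walk is at least as long as `edgeDist`. Climbing from the
deeper endpoint produces a walk attaining it. -/
lemma exists_parentTree [Fintype V] (h : IsHST τ G root len) :
    ∃ T : ParentTree V, (∀ v, v ≠ T.root → T.par v ≠ T.root → τ * T.wt v ≤ T.wt (T.par v)) ∧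
      (∀ u v, treeDist G len u v = edgeDist T u v) ∧ ∀ v, T.dep v = G.dist root v := by
  classical
  have hG := h.isTree
  choose! par hpar using fun v (hv : v ≠ root) => exists_isChild hG hv
  set T : ParentTree V :=
    { root := root
      par := fun v => if v = root then root else par v
      dep := fun v => G.dist root v
      wt := fun v => if v = root then 1 else len s(par v, v)
      par_root := if_pos rfl
      dep_root := SimpleGraph.dist_self
      dep_par := fun v hv => by rw [if_neg hv]; exact (hpar v hv).2
      wt_pos := fun v => by
        split_ifs with hv
        · exact one_pos
        · exact h.len_pos _ (hpar v hv).1 } with hT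
  have hTpar : ∀ v, v ≠ root → T.par v = par v := fun v hv => if_neg hv
  have hTwt : ∀ v, v ≠ root → T.wt v = len s(par v, v) := fun v hv => if_neg hv
  have hchild : ∀ u v, IsChild G root u v → edgeDist T u v = len s(u, v) := by
    intro u v huv
    have hv : v ≠ root := by
      rintro rfl
      have := huv.2
      simp at this
    have hu : u = par v := huv.unique hG (hpar v hv)
    rw [hu, ← hTwt v hv, ← hTpar v hv, edgeDist_comm, edgeDist_par T hv]
  have hadj : ∀ u v, G.Adj u v → edgeDist T u v = len s(u, v) := by
    intro u v huv
    rcases isChild_or_isChild (root := root) hG huv with h1 | h1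
    · exact hchild u v h1
    · rw [edgeDist_comm, hchild v u h1, Sym2.eq_swap]
  have hwalk : ∀ {u v : V} (p : G.Walk u v), edgeDist T u v ≤ (p.edges.map len).sum := by
    intro u v p
    induction p with
    | nil => simp [edgeDist_self]
    | cons h1 q ih =>
      rw [SimpleGraph.Walk.edges_cons, List.map_cons, List.sum_cons, ← hadj _ _ h1]
      exact (edgeDist_triangle T _ _ _).trans (add_le_add le_rfl ih)
  have hex : ∀ u v : V, ∃ p : G.Walk u v, (p.edges.map len).sum = edgeDist T u v := by
    refine T.pair_induction (fun u => ⟨SimpleGraph.Walk.nil, by simp [edgeDist_self]⟩) ?_ ?_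
    · rintro u v ⟨p, hp⟩
      refine ⟨p.reverse, ?_⟩
      rw [SimpleGraph.Walk.edges_reverse, List.map_reverse, List.sum_reverse, hp, edgeDist_comm]
    · rintro u v hu huv ⟨q, hq⟩
      have h1 : G.Adj u (T.par u) := by rw [hTpar u hu]; exact (hpar u hu).1.symm
      refine ⟨SimpleGraph.Walk.cons h1 q, ?_⟩
      rw [SimpleGraph.Walk.edges_cons, List.map_cons, List.sum_cons, hq, ← hadj _ _ h1,
        edgeDist_par T hu, edgeDist_of_not_isAnc T hu huv]
  refine ⟨T, fun v hv hpv => ?_, fun u v => le_antisymm ?_ ?_, fun v => rfl⟩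
  · rw [hTpar v hv] at hpv ⊢
    rw [hTwt v hv, hTwt _ hpv]
    exact h.len_decreasing _ _ _ (hpar _ hpv) (hpar v hv)
  · obtain ⟨p, hp⟩ := hex u v
    rw [← hp]
    exact treeDist_le_sum_edges (fun e he => (h.len_pos e he).le) p
  · obtain ⟨p⟩ := hG.connected.preconnected u v
    classical
    have : Nonempty (G.Path u v) := ⟨p.toPath⟩
    exact le_ciInf fun p => hwalk p.1

lemma dist_le_hopDiameter [Finite V] (hG : G.IsTree) (u v : V) : G.dist u v ≤ hopDiameter G := by
  have := Fintype.ofFinite V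
  obtain ⟨p, hp, hl⟩ := hG.connected.exists_path_of_dist u v
  refine le_csSup ⟨Fintype.card V, ?_⟩ ⟨u, v, p, hp, hl⟩
  rintro _ ⟨u, v, p, hp, rfl⟩
  exact hp.length_lt.le

end GraphTree

/-! ### Trees of logarithmic depth -/

section Pullback

variable {Y X : Type*}

/-- The restriction of a hierarchy to a subset. -/
lemma Hierarchy.exists_pullback [Nonempty X] (h : Hierarchy Y) {φ : X → Y}
    (hφ : Function.Injective φ) :
    ∃ h' : Hierarchy X, ∀ σ x y, h'.levelDist σ x y = h.levelDist σ (φ x) (φ y) := by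
  classical
  -- A cluster of `h` may be represented by a point outside the image of `φ`, so new representatives
  -- are chosen inside it.
  have hex : ∀ j a, ∃ y, ∀ x, h.c j (φ x) = a → h.c j (φ y) = a := by
    intro j a
    by_cases h1 : ∃ y, h.c j (φ y) = a
    · exact ⟨h1.choose, fun _ _ => h1.choose_spec⟩
    · exact ⟨Classical.arbitrary X, fun x hx => absurd ⟨x, hx⟩ h1⟩
  choose rep hrep using hex
  have h1 : ∀ j x, h.c j (φ (rep j (h.c j (φ x)))) = h.c j (φ x) := fun j x => hrep j _ x rfl
  have h2 : ∀ j x y, rep j (h.c j (φ x)) = rep j (h.c j (φ y)) ↔ h.c j (φ x) = h.c j (φ y) := by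
    intro j x y
    constructor
    · intro h3
      rw [← h1 j x, ← h1 j y, h3]
    · intro h3
      rw [h3]
  refine ⟨{ c := fun j x => rep j (h.c j (φ x))
            J := h.J
            top := rep h.J h.top
            c_zero := fun x => hφ (by
              have := h1 0 x
              rw [← h.c_zero (φ (rep 0 _)), this, h.c_zero])
            c_comp := fun i j hij x => by
              rw [h2, ← h.c_comp i j hij, h1, h.c_comp i j hij]
            c_top := fun x => by rw [h.c_top] }, fun σ x y => ?_⟩
  unfold Hierarchy.levelDist
  exact Finset.sum_congr rfl fun j _ => congrArg _ (if_congr (h2 j x y) rfl rfl)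

end Pullback

/-! ### The tree of light clusters -/

section LightTree

variable {X : Type*} [Fintype X] (h : Hierarchy X)

open Classical in
/-- The size of the cluster of `x` at level `j`. -/
noncomputable def Hierarchy.size (j : ℕ) (x : X) : ℕ :=
  (Finset.univ.filter fun y => h.c j y = h.c j x).card

/-- The cluster of `x` at level `j` has at most half of the points of its parent cluster. -/
def Hierarchy.IsLight (j : ℕ) (x : X) : Prop := 2 * h.size j x ≤ h.size (j + 1) x

open Classical in
/-- The smallest light cluster of level at least `j` that contains `x`, given by its level and
its representative; `none` stands for the whole space. -/
noncomputable def Hierarchy.node (j : ℕ) (x : X) : Option (Fin h.J × X) :=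
  if hj : j < h.J then
    if h.IsLight j x then some (⟨j, hj⟩, h.c j x) else Hierarchy.node (j + 1) x
  else none
termination_by h.J - j

open Classical in
/-- The number of light clusters of level at least `j` that contain `x`. -/
noncomputable def Hierarchy.lightCount (j : ℕ) (x : X) : ℕ :=
  ((Finset.Ico j h.J).filter fun l => h.IsLight l x).card

variable {h}

omit [Fintype X] in
lemma Hierarchy.c_eq_of_le {i j : ℕ} (hij : i ≤ j) {x y : X} (hxy : h.c i x = h.c i y) :
    h.c j x = h.c j y := by
  rw [← h.c_comp i j hij, hxy, h.c_comp i j hij]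

lemma Hierarchy.size_congr {j : ℕ} {x y : X} (hxy : h.c j x = h.c j y) :
    h.size j x = h.size j y := by
  unfold Hierarchy.size
  rw [hxy]

lemma Hierarchy.isLight_congr {j : ℕ} {x y : X} (hxy : h.c j x = h.c j y) :
    h.IsLight j x ↔ h.IsLight j y := by
  unfold Hierarchy.IsLight
  rw [size_congr hxy, size_congr (c_eq_of_le (Nat.le_succ j) hxy)]

lemma Hierarchy.node_of_le {j : ℕ} (hj : h.J ≤ j) (x : X) : h.node j x = none := by
  rw [Hierarchy.node, dif_neg (by omega)]

lemma Hierarchy.node_of_isLight {j : ℕ} (hj : j < h.J) {x : X} (hx : h.IsLight j x) :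
    h.node j x = some (⟨j, hj⟩, h.c j x) := by
  rw [Hierarchy.node, dif_pos hj, if_pos hx]

lemma Hierarchy.node_of_not_isLight {j : ℕ} (hj : j < h.J) {x : X} (hx : ¬ h.IsLight j x) :
    h.node j x = h.node (j + 1) x := by
  rw [Hierarchy.node, dif_pos hj, if_neg hx]

omit [Fintype X] in
/-- Induction on levels from the top downwards. -/
lemma Hierarchy.level_induction {P : ℕ → Prop} (top : ∀ j, h.J ≤ j → P j)
    (step : ∀ j, j < h.J → P (j + 1) → P j) (j : ℕ) : P j := by
  induction hm : h.J - j generalizing j with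
  | zero => exact top j (by omega)
  | succ m ih => exact step j (by omega) (ih (j + 1) (by omega))

lemma Hierarchy.node_congr {j : ℕ} {x y : X} (hxy : h.c j x = h.c j y) :
    h.node j x = h.node j y := by
  induction j using h.level_induction with
  | top j hj => rw [node_of_le hj, node_of_le hj]
  | step j hj ih =>
    by_cases hx : h.IsLight j x
    · rw [node_of_isLight hj hx, node_of_isLight hj ((isLight_congr hxy).1 hx), hxy]
    · rw [node_of_not_isLight hj hx, node_of_not_isLight hj (mt (isLight_congr hxy).2 hx)]
      exact ih (c_eq_of_le (Nat.le_succ j) hxy)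

lemma Hierarchy.node_c {i j : ℕ} (hij : i ≤ j) (x : X) : h.node j (h.c i x) = h.node j x :=
  node_congr (h.c_comp i j hij x)

lemma Hierarchy.le_of_node_eq_some {j : ℕ} {x a : X} {l : Fin h.J} (hx : h.node j x = some (l, a)) :
    j ≤ l := by
  induction j using h.level_induction with
  | top j hj => rw [node_of_le hj] at hx; cases hx
  | step j hj ih =>
    by_cases h1 : h.IsLight j x
    · rw [node_of_isLight hj h1] at hx
      cases hx
      exact le_rfl
    · rw [node_of_not_isLight hj h1] at hx
      exact (Nat.le_succ j).trans (ih hx)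

lemma Hierarchy.lightCount_of_le {j : ℕ} (hj : h.J ≤ j) (x : X) : h.lightCount j x = 0 := by
  simp [Hierarchy.lightCount, Finset.Ico_eq_empty_of_le hj]

open Classical in
lemma Hierarchy.lightCount_of_lt {j : ℕ} (hj : j < h.J) (x : X) :
    h.lightCount j x = h.lightCount (j + 1) x + if h.IsLight j x then 1 else 0 := by
  unfold Hierarchy.lightCount
  rw [← Finset.insert_Ico_add_one_left_eq_Ico hj, Finset.filter_insert]
  split_ifs with hx
  · rw [Finset.card_insert_of_notMem (by simp)]
  · rfl

lemma Hierarchy.lightCount_congr {j : ℕ} {x y : X} (hxy : h.c j x = h.c j y) :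
    h.lightCount j x = h.lightCount j y := by
  classical
  unfold Hierarchy.lightCount
  congr 1
  refine Finset.filter_congr fun l hl => isLight_congr (c_eq_of_le (Finset.mem_Ico.1 hl).1 hxy)

lemma Hierarchy.size_pos (j : ℕ) (x : X) : 0 < h.size j x :=
  Finset.card_pos.2 ⟨x, by simp⟩

lemma Hierarchy.size_le_size_succ (j : ℕ) (x : X) : h.size j x ≤ h.size (j + 1) x := by
  classical
  refine Finset.card_le_card fun y hy => ?_
  rw [Finset.mem_filter] at hy ⊢
  exact ⟨hy.1, c_eq_of_le (Nat.le_succ j) hy.2⟩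

/-- Going upwards, cluster sizes never shrink and they at least double when leaving a light cluster.
-/
lemma Hierarchy.two_pow_lightCount_mul_size_le (j : ℕ) (x : X) :
    2 ^ h.lightCount j x * h.size j x ≤ Fintype.card X := by
  classical
  induction j using h.level_induction with
  | top j hj =>
    rw [lightCount_of_le hj, pow_zero, one_mul]
    exact Finset.card_le_univ _
  | step j hj ih =>
    refine le_trans ?_ ih
    rw [lightCount_of_lt hj]
    split_ifs with hx
    · rw [pow_succ, mul_assoc]
      exact Nat.mul_le_mul_left _ hx
    · exact Nat.mul_le_mul_left _ (size_le_size_succ j x)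

lemma Hierarchy.two_pow_lightCount_le (j : ℕ) (x : X) :
    2 ^ h.lightCount j x ≤ Fintype.card X :=
  (Nat.le_mul_of_pos_right _ (size_pos j x)).trans (two_pow_lightCount_mul_size_le j x)

/-- Two disjoint clusters inside a common parent cannot both hold more than half of its points. -/
lemma Hierarchy.isLight_or_isLight {j : ℕ} {x y : X} (hxy : h.c j x ≠ h.c j y)
    (hxy' : h.c (j + 1) x = h.c (j + 1) y) : h.IsLight j x ∨ h.IsLight j y := by
  classical
  have h1 : h.size j x + h.size j y ≤ h.size (j + 1) x := by
    unfold Hierarchy.size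
    rw [← Finset.card_union_of_disjoint]
    · refine Finset.card_le_card fun z hz => ?_
      simp only [Finset.mem_union, Finset.mem_filter, Finset.mem_univ, true_and] at hz ⊢
      rcases hz with hz | hz
      · exact c_eq_of_le (Nat.le_succ j) hz
      · rw [hxy']
        exact c_eq_of_le (Nat.le_succ j) hz
    · rw [Finset.disjoint_filter]
      rintro z - h1 h2
      exact hxy (h1.symm.trans h2)
  have h2 := size_congr hxy'
  unfold Hierarchy.IsLight
  omega

variable (h) in
/-- The tree of light clusters. -/
noncomputable def Hierarchy.lightTree {σ : ℝ} (hσ : 0 < σ) : ParentTree (Option (Fin h.J × X)) where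
  -- The vertices are all pairs, including those that are no light cluster or no representative.
  -- Such extra vertices are harmless, since weights and depth bounds hold for them too.
  root := none
  par := fun v => v.elim none fun p => h.node (p.1 + 1) p.2
  dep := fun v => v.elim 0 fun p => h.lightCount (p.1 + 1) p.2 + 1
  wt := fun v => v.elim 1 fun p => σ * 2 ^ (p.1 : ℕ)
  par_root := rfl
  dep_root := rfl
  dep_par := by
    have key : ∀ (x : X) (j : ℕ), (h.node j x).elim 0 (fun p => h.lightCount (p.1 + 1) p.2 + 1) =
        h.lightCount j x := by
      classical
      intro x j
      induction j using h.level_induction with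
      | top j hj => rw [node_of_le hj, lightCount_of_le hj]; rfl
      | step j hj ih =>
        rw [lightCount_of_lt hj]
        split_ifs with hx
        · rw [node_of_isLight hj hx]
          change h.lightCount (j + 1) (h.c j x) + 1 = _
          rw [lightCount_congr (h.c_comp j (j + 1) (Nat.le_succ j) x)]
        · rw [node_of_not_isLight hj hx, ih, add_zero]
    rintro (_ | ⟨l, a⟩) hv
    · exact absurd rfl hv
    · exact congrArg (· + 1) (key a (l + 1)).symm
  wt_pos := by
    rintro (_ | ⟨l, a⟩)
    · exact one_pos
    · exact mul_pos hσ (pow_pos two_pos _)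

variable {σ : ℝ} {hσ : 0 < σ}

lemma Hierarchy.lightTree_wt_par (v : Option (Fin h.J × X)) (hv : v ≠ (h.lightTree hσ).root)
    (hpv : (h.lightTree hσ).par v ≠ (h.lightTree hσ).root) :
    2 * (h.lightTree hσ).wt v ≤ (h.lightTree hσ).wt ((h.lightTree hσ).par v) := by
  rcases v with _ | ⟨l, a⟩
  · exact absurd rfl hv
  · change h.node (l + 1) a ≠ none at hpv
    change 2 * (σ * 2 ^ (l : ℕ)) ≤ (h.lightTree hσ).wt (h.node (l + 1) a)
    obtain ⟨⟨l', b⟩, hn⟩ := Option.ne_none_iff_exists'.1 hpv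
    rw [hn]
    change _ ≤ σ * 2 ^ (l' : ℕ)
    have := pow_le_pow_right₀ (one_le_two (α := ℝ)) (le_of_node_eq_some hn)
    rw [pow_succ] at this
    have := mul_le_mul_of_nonneg_left this hσ.le
    linarith

lemma Hierarchy.lightTree_dep_le (v : Option (Fin h.J × X)) :
    ((h.lightTree hσ).dep v : ℝ) ≤ 1 + Real.log (Fintype.card X) / Real.log 2 := by
  have h2 : 0 < Real.log 2 := Real.log_pos one_lt_two
  rcases v with _ | ⟨l, a⟩
  · change ((0 : ℕ) : ℝ) ≤ _
    have : 0 ≤ Real.log (Fintype.card X) := Real.log_natCast_nonneg _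
    rw [Nat.cast_zero]
    positivity
  · change ((h.lightCount (l + 1) a + 1 : ℕ) : ℝ) ≤ _
    have h1 : ((2 ^ h.lightCount (l + 1) a : ℕ) : ℝ) ≤ Fintype.card X :=
      Nat.cast_le.2 (two_pow_lightCount_le _ _)
    push_cast at h1 ⊢
    have h3 := Real.log_le_log (by positivity) h1
    rw [Real.log_pow, ← le_div_iff₀ h2] at h3
    linarith

lemma Hierarchy.isAnc_node (j : ℕ) (x : X) :
    IsAnc (h.lightTree hσ) (h.node j x) (h.node 0 x) := by
  induction j with
  | zero => exact isAnc_refl _ _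
  | succ j ih =>
    by_cases hj : j < h.J
    · by_cases hx : h.IsLight j x
      · rw [node_of_isLight hj hx] at ih
        obtain ⟨m, hm⟩ := ih
        refine ⟨m + 1, ?_⟩
        rw [Function.iterate_succ_apply', hm]
        exact node_c (Nat.le_succ j) x
      · rwa [node_of_not_isLight hj hx] at ih
    · rw [node_of_le (by omega)]
      exact isAnc_root _ _

/-- Ancestors of the node of `y` are clusters containing `y`. So a light cluster of `x` that does
not contain `y` separates the two nodes in the tree. -/
lemma Hierarchy.c_eq_of_isAnc_node {j : ℕ} {l : Fin h.J} {a y : X}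
    (ha : IsAnc (h.lightTree hσ) (some (l, a)) (h.node j y)) : a = h.c l y := by
  induction j using h.level_induction with
  | top j hj =>
    rw [node_of_le hj] at ha
    exact absurd ((isAnc_root_iff (h.lightTree hσ)).1 ha) (Option.some_ne_none _)
  | step j hj ih =>
    by_cases hy : h.IsLight j y
    · rw [node_of_isLight hj hy, isAnc_iff] at ha
      rcases ha with ha | ha
      · cases ha
        rfl
      · refine ih ?_
        rw [← node_c (Nat.le_succ j)]
        exact ha
    · rw [node_of_not_isLight hj hy] at ha
      exact ih ha

lemma Hierarchy.edgeDist_node_succ_le (j : ℕ) (x : X) :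
    edgeDist (h.lightTree hσ) (h.node j x) (h.node (j + 1) x) ≤ σ * 2 ^ j := by
  have h0 : 0 ≤ σ * 2 ^ j := by positivity
  by_cases hj : j < h.J
  · by_cases hx : h.IsLight j x
    · have h1 : h.node (j + 1) x = (h.lightTree hσ).par (h.node j x) := by
        rw [node_of_isLight hj hx]
        exact (node_c (Nat.le_succ j) x).symm
      have h2 : h.node j x ≠ (h.lightTree hσ).root := by
        rw [node_of_isLight hj hx]
        exact Option.some_ne_none _
      rw [h1, edgeDist_par _ h2, node_of_isLight hj hx]
      exact le_rfl
    · rwa [node_of_not_isLight hj hx, edgeDist_self]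
  · rwa [node_of_le (by omega), node_of_le (by omega), edgeDist_self]

-- Both points climb level by level until their clusters merge; at level `j` each of them crosses at
-- most one edge, of length `σ * 2 ^ j`.
open Classical in
lemma Hierarchy.edgeDist_node_le (x y : X) :
    edgeDist (h.lightTree hσ) (h.node 0 x) (h.node 0 y) ≤ 2 * h.levelDist σ x y := by
  have key : ∀ m, edgeDist (h.lightTree hσ) (h.node 0 x) (h.node 0 y) ≤
      edgeDist (h.lightTree hσ) (h.node m x) (h.node m y) +
        2 * ∑ j ∈ Finset.range m, σ * 2 ^ j * (if h.c j x = h.c j y then 0 else 1) := by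
    intro m
    induction m with
    | zero => simp
    | succ m ih =>
      refine ih.trans ?_
      rw [Finset.sum_range_succ]
      split_ifs with h1
      · rw [node_congr h1, edgeDist_self]
        have := edgeDist_nonneg (h.lightTree hσ) (h.node (m + 1) x) (h.node (m + 1) y)
        linarith
      · have h2 := edgeDist_node_succ_le (h := h) (hσ := hσ) m x
        have h3 := edgeDist_node_succ_le (h := h) (hσ := hσ) m y
        have h4 := edgeDist_triangle (h.lightTree hσ) (h.node m x) (h.node (m + 1) x) (h.node m y)
        have h5 := edgeDist_triangle (h.lightTree hσ) (h.node (m + 1) x) (h.node (m + 1) y)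
          (h.node m y)
        rw [edgeDist_comm _ (h.node m y)] at h3
        linarith
  refine (key h.J).trans (le_of_eq ?_)
  rw [node_of_le le_rfl, node_of_le le_rfl, edgeDist_self, zero_add]
  rfl

/-- The witness is the last level separating `x` and `y`. It dominates the geometric sum in
`levelDist`, and at this level one of the two clusters is light, so its edge separates the nodes. -/
lemma Hierarchy.exists_levelDist_le_edgeDist_node {x y : X} (hxy : x ≠ y) :
    ∃ j, h.levelDist σ x y ≤ 2 * (σ * 2 ^ j) ∧
      σ * 2 ^ j ≤ edgeDist (h.lightTree hσ) (h.node 0 x) (h.node 0 y) := by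
  classical
  obtain ⟨j, hj, hne, heq⟩ := h.exists_last_separated hxy
  refine ⟨j, ?_, ?_⟩
  · have h1 : ∀ i ∈ Finset.range h.J, σ * 2 ^ i * (if h.c i x = h.c i y then 0 else 1) ≤
        if i < j + 1 then σ * 2 ^ i else 0 := by
      intro i _
      by_cases hi : i < j + 1
      · rw [if_pos hi]
        have : 0 ≤ σ * 2 ^ i := by positivity
        split_ifs <;> linarith
      · rw [if_neg hi, if_pos (c_eq_of_le (not_lt.1 hi) heq), mul_zero]
    refine (Finset.sum_le_sum h1).trans ?_
    rw [← Finset.sum_filter]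
    have h2 : (Finset.range h.J).filter (· < j + 1) = Finset.range (j + 1) := by
      ext i
      simp only [Finset.mem_filter, Finset.mem_range]
      omega
    rw [h2, ← Finset.mul_sum, geom_sum_eq (by norm_num), pow_succ]
    nlinarith
  · have key : ∀ x y, h.c j x ≠ h.c j y → h.IsLight j x →
        σ * 2 ^ j ≤ edgeDist (h.lightTree hσ) (h.node 0 x) (h.node 0 y) := by
      intro x y hxy hx
      have h1 := isAnc_node (h := h) (hσ := hσ) j x
      rw [node_of_isLight hj hx] at h1
      exact wt_le_edgeDist (h.lightTree hσ) h1 fun h2 => hxy (c_eq_of_isAnc_node h2)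
    rcases isLight_or_isLight hne heq with hx | hy
    · exact key x y hne hx
    · rw [edgeDist_comm]
      exact key y x (Ne.symm hne) hy

end LightTree

/-- A competitive algorithm on HST metrics whose ratio does not depend on the depth of the HST. -/
theorem exists_log_competitive_of_hst {V X : Type*} [Fintype V] [Fintype X] [Nonempty X]
    [MetricSpace X] (T : ParentTree V) {τ : ℝ} (hτ : 1 < τ)
    (hT : ∀ v, v ≠ T.root → T.par v ≠ T.root → τ * T.wt v ≤ T.wt (T.par v)) {φ : X → V}
    (hφ : Function.Injective φ) (hdist : ∀ x y, dist x y = edgeDist T (φ x) (φ y)) {k : ℕ}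
    (hk : 1 ≤ k) :
    ∃ b : ℝ, ∀ A₀ : Config X k, ∃ alg : RandomizedServerAlgorithm X k,
      alg.IsCompetitive A₀ (331776 * (4 * τ / (τ - 1)) *
        (2 + Real.log (Fintype.card X) / Real.log 2) * Real.log (k + 1)) b := by
  obtain ⟨h₀, σ, hσ, hpar, hlev⟩ := exists_hierarchy_of_hst T hτ hT
  obtain ⟨h, hh⟩ := h₀.exists_pullback hφ
  have hK : 0 ≤ 4 * τ / (τ - 1) := by
    have : 0 < τ - 1 := by linarith
    positivity
  have hinj : Function.Injective (h.node 0) := by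
    intro x y hxy
    by_contra hne
    obtain ⟨j, -, h2⟩ := Hierarchy.exists_levelDist_le_edgeDist_node (h := h) (hσ := hσ) hne
    rw [hxy, edgeDist_self] at h2
    have : 0 < σ * 2 ^ j := by positivity
    linarith
  -- The light tree is a 2-HST of depth at most `1 + log₂ n`, whatever the depth of `T`. Its metric
  -- is equivalent to the original one with constants depending only on `τ`.
  obtain ⟨b, hb⟩ := exists_competitive_of_hst (h.lightTree hσ) one_lt_two h.lightTree_wt_par
    hinj (C₁ := 4 * τ / (τ - 1) * 2) (C₃ := 4) (by positivity) (by norm_num)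
    (fun x y => by
      by_cases hne : x = y
      · rw [hne, dist_self, edgeDist_self, mul_zero]
      · obtain ⟨j, h1, h2⟩ := Hierarchy.exists_levelDist_le_edgeDist_node (h := h) (hσ := hσ) hne
        rw [hdist, mul_assoc]
        refine (hlev _ _).trans (mul_le_mul_of_nonneg_left ?_ hK)
        rw [← hh]
        linarith)
    (fun x y => by
      have h1 := Hierarchy.edgeDist_node_le (h := h) (hσ := hσ) x y
      have h2 := h₀.levelDist_le_edgeDist T hσ.le hpar (φ x) (φ y)
      rw [hh] at h1
      rw [hdist]
      linarith)
    h.lightTree_dep_le hk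
  refine ⟨b, fun A₀ => ?_⟩
  obtain ⟨alg, halg⟩ := hb A₀
  refine ⟨alg, ?_⟩
  convert! halg using 1
  ring

/-! ### The main theorem -/

section Main

variable {X : Type*} {k : ℕ} [Fintype X] [MetricSpace X]

omit [Fintype X] in
lemma offlineOpt_nonneg (A₀ : Config X k) (r : ℕ → X) (T : ℕ) : 0 ≤ offlineOpt A₀ r T := by
  refine Real.sInf_nonneg ?_
  rintro _ ⟨A, -, rfl⟩
  exact Finset.sum_nonneg fun t _ => moveCost_nonneg _ _

lemma RandomizedServerAlgorithm.IsCompetitive.mono {alg : RandomizedServerAlgorithm X k}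
    {A₀ : Config X k} {c c' b : ℝ} (h : alg.IsCompetitive A₀ c b) (hc : c ≤ c') :
    alg.IsCompetitive A₀ c' b := fun r T =>
  (h r T).trans (add_le_add (mul_le_mul_of_nonneg_right hc (offlineOpt_nonneg A₀ r T)) le_rfl)

lemma exists_competitive_of_subsingleton [Subsingleton X] (hk : 1 ≤ k) (A₀ : Config X k) {c : ℝ}
    (hc : 0 ≤ c) : ∃ alg : RandomizedServerAlgorithm X k, alg.IsCompetitive A₀ c 0 := by
  refine ⟨{ next := fun _ _ _ => PMF.pure A₀
            serves := fun t ρ A S hS => ?_ }, fun r T => ?_⟩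
  · rw [PMF.support_pure, Set.mem_singleton_iff] at hS
    obtain ⟨x, hx⟩ := Finset.card_pos.1 (show 0 < S.1.card by rw [S.2]; omega)
    rwa [Subsingleton.elim (ρ (Fin.last t)) x]
  · have hcost : ∀ A : Fin (T + 1) → Config X k, pathCost A = 0 := fun A =>
      Finset.sum_eq_zero fun t _ => by
        have : A t.succ = A t.castSucc := Subtype.ext (Finset.eq_of_subset_of_card_le (fun x hx => by
          obtain ⟨y, hy⟩ := Finset.card_pos.1
            (show 0 < (A t.castSucc).1.card by rw [(A t.castSucc).2]; omega)
          rwa [Subsingleton.elim x y]) (by rw [(A t.succ).2, (A t.castSucc).2]))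
        rw [this, moveCost_self]
    unfold RandomizedServerAlgorithm.expectedCost
    simp only [hcost, mul_zero, Finset.sum_const_zero, add_zero]
    exact mul_nonneg hc (offlineOpt_nonneg A₀ r T)

end Main

theorem mainTheorem5 (τ : ℝ) (hτ : 1 < τ) :
    ∃ C : ℝ, 0 < C ∧
      ∀ (V : Type*) [Finite V] (G : SimpleGraph V) (root : V) (len : Sym2 V → ℝ),
        IsHST τ G root len →
      ∀ (X : Type*) [Fintype X] [MetricSpace X] (φ : X → V),
        (∀ x y : X, dist x y = treeDist G len (φ x) (φ y)) →
      ∀ k : ℕ, 1 ≤ k →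
        ∃ b : ℝ, ∀ A₀ : Config X k, ∃ alg : RandomizedServerAlgorithm X k,
          alg.IsCompetitive A₀
            (C * min (hopDiameter G : ℝ) (Real.log (Fintype.card X)) * Real.log (k + 1)) b := by
  have hK : 0 < 4 * τ / (τ - 1) := by
    have : 0 < τ - 1 := by linarith
    positivity
  obtain ⟨K, hKe⟩ : ∃ K, K = 4 * τ / (τ - 1) := ⟨_, rfl⟩
  rw [← hKe] at hK
  -- `1658880 = 5 * 331776`, where 5 absorbs the lower-order terms of the logarithmic bound; the
  -- bound by the hop-diameter needs less.
  refine ⟨1658880 * K, by positivity, fun V _ G root len hG X _ _ φ hφ k hk => ?_⟩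
  have hlogk : 0 ≤ Real.log (k + 1) := Real.log_nonneg (by linarith [Nat.cast_nonneg (α := ℝ) k])
  have hlogn : 0 ≤ Real.log (Fintype.card X) := Real.log_natCast_nonneg _
  -- For at most one point `log n = 0`, so the cost itself must vanish. With two points, `log n ≥
  -- log 2` and a hop-diameter of at least 1 absorb the additive constants in the depth.
  rcases subsingleton_or_nontrivial X with hX | hX
  · refine ⟨0, fun A₀ => exists_competitive_of_subsingleton hk A₀ ?_⟩
    have : 0 ≤ min (hopDiameter G : ℝ) (Real.log (Fintype.card X)) :=
      le_min (Nat.cast_nonneg _) hlogn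
    positivity
  have := Fintype.ofFinite V
  obtain ⟨T, hT, hdist, hdep⟩ := exists_parentTree hG
  have hdist' : ∀ x y, dist x y = edgeDist T (φ x) (φ y) := fun x y => by rw [hφ, hdist]
  have hinj : Function.Injective φ := fun x y hxy => by
    rw [← dist_eq_zero, hdist', hxy, edgeDist_self]
  have hn : Real.log 2 ≤ Real.log (Fintype.card X) := by
    refine Real.log_le_log two_pos ?_
    exact_mod_cast Fintype.one_lt_card (α := X)
  have hD : (1 : ℝ) ≤ hopDiameter G := by
    obtain ⟨x, y, hxy⟩ := exists_pair_ne X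
    have h1 := dist_le_hopDiameter hG.isTree (φ x) (φ y)
    have h2 := hG.isTree.connected.pos_dist_of_ne (hinj.ne hxy)
    exact_mod_cast h2.trans_le h1
  rcases le_total (hopDiameter G : ℝ) (Real.log (Fintype.card X)) with hmin | hmin
  · rw [min_eq_left hmin]
    obtain ⟨b, hb⟩ := exists_competitive_of_hst T hτ hT hinj (C₁ := 1) (C₃ := 1) zero_le_one
      zero_le_one (fun x y => by rw [one_mul, hdist']) (fun x y => by rw [one_mul, hdist'])
      (H := hopDiameter G) (fun v => by
        rw [hdep]
        exact Nat.cast_le.2 (dist_le_hopDiameter hG.isTree root v)) hk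
    refine ⟨b, fun A₀ => ?_⟩
    obtain ⟨alg, halg⟩ := hb A₀
    refine ⟨alg, halg.mono (mul_le_mul_of_nonneg_right ?_ hlogk)⟩
    rw [← hKe]
    nlinarith
  · rw [min_eq_right hmin]
    obtain ⟨b, hb⟩ := exists_log_competitive_of_hst T hτ hT hinj hdist' hk
    refine ⟨b, fun A₀ => ?_⟩
    obtain ⟨alg, halg⟩ := hb A₀
    refine ⟨alg, halg.mono (mul_le_mul_of_nonneg_right ?_ hlogk)⟩
    rw [← hKe]
    have h2 := Real.log_two_gt_d9
    have h3 : Real.log (Fintype.card X) / Real.log 2 ≤ 3 / 2 * Real.log (Fintype.card X) := by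
      rw [div_le_iff₀ (by linarith)]
      nlinarith
    have h4 : 2 + Real.log (Fintype.card X) / Real.log 2 ≤ 5 * Real.log (Fintype.card X) := by
      linarith
    have := mul_le_mul_of_nonneg_left h4 (show 0 ≤ 331776 * K by positivity)
    linarith
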